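/- Let $F$ be a field of characteristic $\ne 2$ and $A$ a (not necessarily commutative or associative) $F$-algebra. For $a\in A$ let $L_a(y)=ay$, $R_a(y)=ya$, and let $A_{\mu,\eta}(a)=\{y: ay=\mu y,\ ya=\eta y\}$, $A_0(a)=A_{0,0}(a)$. For $\mu\notin\{0,1\}$, a left axis of type $\mu$ is an idempotent $a$ such that $A$ is the direct sum of the eigenspaces of $L_a$ for $1,0,\mu$, and this is a $\mathbb Z_2$-grading with even part the sum of the first two and odd part the third; right axes are defined in the same way with $R_a$. An axis of type $(\mu,\nu)$ is a left axis of type $\mu$ and right axis of type $\nu$ with $L_aR_a=R_aL_a$. A primitive axis of type $(\mu,\nu)$ is a nonzero such axis for which the $1$-eigenspaces of $L_a$ and of $R_a$ both equal $Fa$ and $A_{\mu,0}(a)=A_{0,\nu}(a)=0$; then $A=Fa\oplus A_0(a)\oplus A_{\mu,\nu}(a)$, and $\tau_a$ is the map that is $1$ on $Fa\oplus A_0(a)$ and $-1$ on $A_{\mu,\nu}(a)$. Let $\chi(A)$ be the set of all primitive axes of $A$, of any type. The type of $a$ is unique unless $A_{\mu,\nu}(a)=0$. For a set $X$ of primitive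 axes, $\mathrm{Cl}(X)$ is its orbit under the group generated by the $\tau_x$, $x\in X$, and $\langle\langle X\rangle\rangle$ is the subalgebra generated by $X$. Connectedness and components refer to the graph in which distinct axes $x,y$ are joined when $xy\neq0$ or $yx\ne 0$. An algebra is called the direct product of a family of subalgebras if it is the direct sum of these subspaces and distinct members annihilate each other (so for infinite families this is the restricted direct product). For a set $E$, $U_E(\mu)$ is the algebra with basis $E$ and $ef=(1-\mu)e+\mu f$ for $e,f\in E$. **Theorem.** Let $\lambda,\delta\in F\setminus\{0,1\}$, $\lambda+\delta=1$, $\lambda\ne\delta$. Let $A=\langle\langle X\rangle\rangle$, where $X=X'\sqcup X''$ is a disjoint union, $X'$ consists of primitive axes of type $(\lambda,\delta)$ and $X''$ of primitive axes of type $(\delta,\lambda)$. Put $A'=\langle\langle X'\rangle\rangle$, $A''=\langle\langle X''\rangle\rangle$, $Z=\mathrm{span}\{x'x'':x'\in X',\,x''\in X''\}$, and, for $a\in A'$ resp. $a\in A''$, $A'_{\lambda,\delta}(a)=A'\cap A_{\lambda,\delta}(a)$, $A''_{\delta,\lambda}(a)=A''\cap A_{\delta,\lambda}(a)$. 1. The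 following holds for $(S,B,\mu,\nu)=(X',A',\lambda,\delta)$ and for $(X'',A'',\delta,\lambda)$. $B$ is spanned by $S$, and $S$ contains a basis of $B$. If $S$ is connected, then $B=U_T(\mu)$ for some basis $T\subseteq S$ of $B$, and $xy\ne0$ for all $x,y\in \mathrm{Cl}(S)$. For every basis $T\subseteq S$ of $B$ with components $T_i$: each $T_i$ lies in a component $S_i$ of $\mathrm{Cl}(S)$, $\langle\langle S_i\rangle\rangle=U_{T_i}(\mu)$ with basis $T_i$, and $B$ is the direct product of the $\langle\langle S_i\rangle\rangle$. A nonzero idempotent of $B$ is a primitive axis of $B$ iff it lies in $\langle\langle D\rangle\rangle$ for some component $D$ of $\mathrm{Cl}(S)$. All axes of $B$ are of type $(\mu,\nu)$, and all primitive axes of $B$ are primitive axes of type $(\mu,\nu)$. 2. Let $a,a'\in A$ be primitive axes of type $(\lambda,\delta)$ and $b\ne a$ a primitive axis of $A$ of type $(\delta,\lambda)$. If $aa'\neq0$, then $ab,ba\in A_{\lambda,\delta}(a')$; if $aa'=0$, then $ab,ba\in A_0(a')$. If $x',a'\in A$ are primitive axes of type $(\lambda,\delta)$ with $a'x'\ne0$,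 then $A_0(a')\cap Z=A_0(x')\cap Z$ and $A_{\lambda,\delta}(a')\cap Z=A_{\lambda,\delta}(x')\cap Z$. 3. $Z$ is an ideal of $A$, $Z^2=0$, $A=A'+A''+Z$, and with $\overline{A'},\overline{A''}$ the images of $A',A''$ in $A/Z$, the map $(u,v)\mapsto u+v$ is an isomorphism of algebras $\overline{A'}\times\overline{A''}\to A/Z$. Moreover $\dim A\le\dim A'+\dim A''+\dim Z$, and if $X$ is finite, then $\dim A<\infty$. 4. If $a\in A$ is a primitive axis of type $(\lambda,\delta)$, every $w\in A_{\lambda,\delta}(a)$ is $v+z$ with $v\in(Fa+A')\cap A_{\lambda,\delta}(a)$ and $z\in Z\cap A_{\lambda,\delta}(a)$, and $A_{\lambda,\delta}(a)^2=0$. If $a\in X'$, then $A_{\lambda,\delta}(a)=A'_{\lambda,\delta}(a)+Z\cap A_{\lambda,\delta}(a)$. If $a_1,a_2$ are in the same component of $X'$, then $A_{\lambda,\delta}(a_1)=A_{\lambda,\delta}(a_2)$. 5. Every primitive axis of $A'$ (resp. $A''$) is a primitive axis of $A$, of type $(\lambda,\delta)$ (resp. $(\delta,\lambda)$). 6. Let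 $a\in X'$, $z\in Z$. Then $a+z$ is an idempotent iff $z\in A_{\lambda,\delta}(a)$, and in that case $a+z$ is a primitive axis of type $(\lambda,\delta)$. If $X'$ is connected, $a+z$ is a primitive axis of type $(\lambda,\delta)$ for all $a\in X'$, $z\in Z$. The same holds with $X''$ and $(\delta,\lambda)$ in place of $X'$ and $(\lambda,\delta)$. 7. If $X'$ is the set of all primitive axes of $A$ of type $(\lambda,\delta)$ and $a'_j$ is any choice of one axis from each component of $X'$, then $Z\subseteq\sum_jA'_{\lambda,\delta}(a'_j)$. If $X''$ is the set of all primitive axes of $A$ of type $(\delta,\lambda)$ and $a''_j$ is any choice of one axis from each component of $X''$, then $Z\subseteq\sum_jA''_{\delta,\lambda}(a''_j)$. 8. If $X'$ is connected, then for every $a\in X'$ we have $A_{\lambda,\delta}(a)=\sum_{x'\in X'}F(x'-a)+Z$, this is an ideal of $A$, and $A/A_{\lambda,\delta}(a)\cong F\times\overline{A''}$. 9. If $X=\chi(A)$ and $a'_j$, $a''_j$ are any choices of one axis from each component of $X'$, $X''$ respectively, then $I=\sum_jA'_{\lambda,\delta}(a'_j)+\sum_jA''_{\delta,\lambda}(a''_j)$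 is an ideal of $A$, and $A/I$ is a direct product (restricted, if infinite) of copies of $F$, one for each component of $X'$ and each component of $X''$. 10. If $u\in A$ and $Au=0$ or $uA=0$, then $u=0$. $A$ is the direct product of the subalgebras $\langle\langle X_i\rangle\rangle$, where the $X_i$ are the components of $\mathrm{Cl}(X)$. -/

import Mathlib

namespace Axial

section Axes

variable (F : Type*) {A : Type*} [Field F] [NonUnitalNonAssocRing A] [Module F A]
  [IsScalarTower F A A] [SMulCommClass F A A]

/-- The left eigenspace `A_μ(L_a) = {y | a * y = μ • y}`. -/
def eigL (a : A) (mu : F) : Submodule F A := Module.End.eigenspace (LinearMap.mulLeft F a) mu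

/-- The right eigenspace `A_η(R_a) = {y | y * a = η • y}`. -/
def eigR (a : A) (eta : F) : Submodule F A := Module.End.eigenspace (LinearMap.mulRight F a) eta

/-- `A_{μ,η}(a) = A_μ(L_a) ∩ A_η(R_a)`. -/
def eig (mu eta : F) (a : A) : Submodule F A := eigL F a mu ⊓ eigR F a eta

/-- `A_0(a) = A_{0,0}(a)`. -/
def eig0 (a : A) : Submodule F A := eig F 0 0 a

/-- `A = P ⊕ M` is a `ℤ/2`-grading with even part `P` and odd part `M`. -/
structure IsZ2Grading (P M : Submodule F A) : Prop where
  isCompl : IsCompl P M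
  even_even : ∀ x ∈ P, ∀ y ∈ P, x * y ∈ P
  even_odd : ∀ x ∈ P, ∀ y ∈ M, x * y ∈ M
  odd_even : ∀ x ∈ M, ∀ y ∈ P, x * y ∈ M
  odd_odd : ∀ x ∈ M, ∀ y ∈ M, x * y ∈ P

/-- A left axis of type `lam`: an idempotent with
`A = (A_1(L_a) ⊕ A_0(L_a)) ⊕ A_lam(L_a)`, a `ℤ/2`-grading (eigenspaces for the distinct
eigenvalues `1` and `0` are automatically independent). -/
structure IsLeftAxis (a : A) (lam : F) : Prop where
  ne_zero : lam ≠ 0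
  ne_one : lam ≠ 1
  idem : a * a = a
  grading : IsZ2Grading F (eigL F a 1 ⊔ eigL F a 0) (eigL F a lam)

/-- A right axis of type `del`. -/
structure IsRightAxis (a : A) (del : F) : Prop where
  ne_zero : del ≠ 0
  ne_one : del ≠ 1
  idem : a * a = a
  grading : IsZ2Grading F (eigR F a 1 ⊔ eigR F a 0) (eigR F a del)

/-- A (two-sided) axis of type `(lam, del)`: a left axis of type `lam` that is a right axis of
type `del`, with `L_a R_a = R_a L_a`. -/
structure IsAxis (a : A) (lam del : F) : Prop where
  left : IsLeftAxis F a lam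
  right : IsRightAxis F a del
  comm : ∀ y : A, a * (y * a) = (a * y) * a

/-- A primitive axis of type `(lam, del)`: a nonzero axis of this type with
`A_1(L_a) = F a = A_1(R_a)` and `A_{lam,0}(a) = A_{0,del}(a) = 0`, so that
`A = (F a ⊕ A_0(a)) ⊕ A_{lam,del}(a)`. -/
structure IsPrimitiveAxis (a : A) (lam del : F) : Prop extends IsAxis F a lam del where
  ne_zero : a ≠ 0
  left_one : eigL F a 1 = Submodule.span F {a}
  right_one : eigR F a 1 = Submodule.span F {a}
  eig_lam_zero : eig F lam 0 a = ⊥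
  eig_zero_del : eig F 0 del a = ⊥

variable (A) in
/-- `χ(A)`, the set of all primitive axes of `A`, of any type. -/
def chi : Set A := {a | ∃ mu nu : F, IsPrimitiveAxis F a mu nu}

/-- `tau` is the Miyamoto involution `τ_a` of the primitive axis `a`: identity on
`F a ⊕ A_0(a)`, minus the identity on `A_{mu,nu}(a)`, where `(mu, nu)` is the type of `a`. -/
def IsMiyamoto (a : A) (tau : A ≃ₗ[F] A) : Prop :=
  ∃ mu nu : F, IsPrimitiveAxis F a mu nu ∧
    (∀ y ∈ Submodule.span F {a} ⊔ eig0 F a, tau y = y) ∧ ∀ y ∈ eig F mu nu a, tau y = -y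

/-- The Miyamoto group of a set of primitive axes. -/
def miyamotoGroup (X : Set A) : Subgroup (A ≃ₗ[F] A) :=
  Subgroup.closure {tau | ∃ a ∈ X, IsMiyamoto F a tau}

/-- `Cl(X)`, the orbit of `X` under its Miyamoto group. -/
def Cl (X : Set A) : Set A := {y | ∃ rho ∈ miyamotoGroup F X, ∃ x ∈ X, y = rho x}

/-- `B` is the direct product of its subalgebras `B i`: it is the internal direct sum of them,
and distinct ones annihilate each other. For an infinite family this is the restricted
(finitely supported) product. -/
structure IsDirectProduct {I : Type*} (Bi : I → NonUnitalSubalgebra F A)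
    (B : NonUnitalSubalgebra F A) : Prop where
  indep : iSupIndep fun i => (Bi i).toSubmodule
  iSup_eq : ⨆ i, (Bi i).toSubmodule = B.toSubmodule
  mul_eq_zero : ∀ i j, i ≠ j → ∀ x ∈ Bi i, ∀ y ∈ Bi j, x * y = 0

/-- The set `S` is a vector space basis of `B`. -/
def IsBasisOf (S : Set A) (B : NonUnitalSubalgebra F A) : Prop :=
  LinearIndepOn F id S ∧ Submodule.span F S = B.toSubmodule

/-- The span `Z` of all products `x' x''` with `x' ∈ X'` and `x'' ∈ X''`. -/
def crossSpan (X' X'' : Set A) : Submodule F A :=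
  Submodule.span F (Set.image2 (fun x y => x * y) X' X'')

end Axes

section Graph

variable {A : Type*} [NonUnitalNonAssocRing A]

/-- The axial graph on `S`: distinct `x` and `y` are joined when their product is nonzero
(in one order or the other; for primitive axes the two conditions agree). -/
def axialGraph (S : Set A) : SimpleGraph S := SimpleGraph.fromRel fun x y => (x : A) * y ≠ 0

/-- The set of connected components of `S` in the axial graph. -/
abbrev Comp (S : Set A) : Type _ := (axialGraph S).ConnectedComponent

/-- The vertex set of a connected component of `S`. -/
def compSet {S : Set A} (C : Comp S) : Set A := Subtype.val '' C.supp

/-- Any two elements of `S` are joined by a path in the axial graph of `S`. -/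
def IsConn (S : Set A) : Prop := (axialGraph S).Preconnected

end Graph

section UAlgebra

variable (F : Type*) [Field F] (E : Type*) (lam : F)

/-- The underlying vector space, with basis `E`, of the algebra `U_E(lam)`. -/
@[nolint unusedArguments]
def UAlg (_lam : F) : Type _ := E →₀ F

namespace UAlg

noncomputable instance : AddCommGroup (UAlg F E lam) := inferInstanceAs (AddCommGroup (E →₀ F))

noncomputable instance : Module F (UAlg F E lam) := inferInstanceAs (Module F (E →₀ F))

variable {F E lam}

/-- The basis vector `e_i`. -/
noncomputable def e (i : E) : UAlg F E lam := (Finsupp.single i (1 : F) : E →₀ F)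

/-- The sum of the coordinates. -/
noncomputable def eps : UAlg F E lam →ₗ[F] F :=
  (Finsupp.linearCombination F fun _ : E => (1 : F) : (E →₀ F) →ₗ[F] F)

/-- The bilinear extension of `e_i e_j = (1 - lam) e_i + lam e_j`; see `e_mul_e`. -/
noncomputable instance : NonUnitalNonAssocRing (UAlg F E lam) where
  __ := (inferInstance : AddCommGroup (UAlg F E lam))
  mul x y := ((1 - lam) * eps y) • x + (lam * eps x) • y
  left_distrib x y z := by
    change ((1 - lam) * eps (y + z)) • x + (lam * eps x) • (y + z) =
      (((1 - lam) * eps y) • x + (lam * eps x) • y) + (((1 - lam) * eps z) • x + (lam * eps x) • z)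
    rw [map_add]; module
  right_distrib x y z := by
    change ((1 - lam) * eps z) • (x + y) + (lam * eps (x + y)) • z =
      (((1 - lam) * eps z) • x + (lam * eps x) • z) + (((1 - lam) * eps z) • y + (lam * eps y) • z)
    rw [map_add]; module
  zero_mul x := by
    change ((1 - lam) * eps x) • (0 : UAlg F E lam) + (lam * eps (0 : UAlg F E lam)) • x = 0
    simp
  mul_zero x := by
    change ((1 - lam) * eps (0 : UAlg F E lam)) • x + (lam * eps x) • (0 : UAlg F E lam) = 0
    simp

theorem mul_def (x y : UAlg F E lam) :
    x * y = ((1 - lam) * eps y) • x + (lam * eps x) • y := rfl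

theorem eps_e (i : E) : eps (e i : UAlg F E lam) = 1 := by
  change Finsupp.linearCombination F (fun _ : E => (1 : F)) (Finsupp.single i (1 : F)) = 1
  simp

theorem e_mul_e (i j : E) :
    (e i * e j : UAlg F E lam) = (1 - lam) • e i + lam • e j := by
  simp [mul_def, eps_e]

instance : IsScalarTower F (UAlg F E lam) (UAlg F E lam) where
  smul_assoc c x y := by
    simp only [smul_eq_mul, mul_def, map_smul]; module

instance : SMulCommClass F (UAlg F E lam) (UAlg F E lam) where
  smul_comm c x y := by
    simp only [smul_eq_mul, mul_def, map_smul]; module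

end UAlg

/-- The set `S` is a basis of the subalgebra `B`, and `B = U_S(lam)` with respect to it. -/
def IsUAlg {F : Type*} {A : Type*} [Field F] [NonUnitalNonAssocRing A] [Module F A]
    (B : NonUnitalSubalgebra F A) (S : Set A) (lam : F) : Prop :=
  ∃ f : UAlg F S lam →ₙₐ[F] A, Function.Injective f ∧ NonUnitalAlgHom.range f = B ∧
    ∀ s : S, f (UAlg.e s) = (s : A)

end UAlgebra

section Quotient

variable (F : Type*) (A : Type*) [Field F] [NonUnitalNonAssocRing A] [Module F A]

/-- A (two-sided) ideal of a nonassociative algebra. -/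
structure AlgIdeal extends Submodule F A where
  mul_mem_left : ∀ (x : A) {y : A}, y ∈ toSubmodule → x * y ∈ toSubmodule
  mul_mem_right : ∀ (x : A) {y : A}, y ∈ toSubmodule → y * x ∈ toSubmodule

variable {F A}

/-- The quotient algebra `A / I`. -/
def AlgIdeal.Quot (I : AlgIdeal F A) : Type _ := A ⧸ I.toSubmodule

namespace AlgIdeal

variable (I : AlgIdeal F A)

instance : AddCommGroup I.Quot := inferInstanceAs (AddCommGroup (A ⧸ I.toSubmodule))

instance : Module F I.Quot := inferInstanceAs (Module F (A ⧸ I.toSubmodule))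

/-- The class of an element in the quotient. -/
def cls (x : A) : I.Quot := Submodule.Quotient.mk (p := I.toSubmodule) x

theorem cls_eq {x y : A} : I.cls x = I.cls y ↔ x - y ∈ I.toSubmodule :=
  Submodule.Quotient.eq I.toSubmodule

instance : Mul I.Quot where
  mul := Quotient.map₂ (fun x y => x * y) (by
    intro a b hab c d hcd
    have h1 : a - b ∈ I.toSubmodule := (Submodule.quotientRel_def _).1 hab
    have h2 : c - d ∈ I.toSubmodule := (Submodule.quotientRel_def _).1 hcd
    refine (Submodule.quotientRel_def _).2 ?_
    have h3 : a * c - b * d = (a - b) * c + b * (c - d) := by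
      rw [sub_mul, mul_sub]; abel
    rw [h3]
    exact I.toSubmodule.add_mem (I.mul_mem_right _ h1) (I.mul_mem_left _ h2))

theorem cls_mul (x y : A) : I.cls (x * y) = I.cls x * I.cls y := rfl

theorem cls_add (x y : A) : I.cls (x + y) = I.cls x + I.cls y := rfl

theorem cls_surjective : Function.Surjective I.cls :=
  Submodule.Quotient.mk_surjective I.toSubmodule

instance : NonUnitalNonAssocRing I.Quot where
  __ := (inferInstance : AddCommGroup I.Quot)
  __ := (inferInstance : Mul I.Quot)
  left_distrib x y z := by
    obtain ⟨x, rfl⟩ := I.cls_surjective x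
    obtain ⟨y, rfl⟩ := I.cls_surjective y
    obtain ⟨z, rfl⟩ := I.cls_surjective z
    change I.cls (x * (y + z)) = I.cls (x * y + x * z)
    rw [mul_add]
  right_distrib x y z := by
    obtain ⟨x, rfl⟩ := I.cls_surjective x
    obtain ⟨y, rfl⟩ := I.cls_surjective y
    obtain ⟨z, rfl⟩ := I.cls_surjective z
    change I.cls ((x + y) * z) = I.cls (x * z + y * z)
    rw [add_mul]
  zero_mul x := by
    obtain ⟨x, rfl⟩ := I.cls_surjective x
    change I.cls (0 * x) = I.cls 0
    rw [zero_mul]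
  mul_zero x := by
    obtain ⟨x, rfl⟩ := I.cls_surjective x
    change I.cls (x * 0) = I.cls 0
    rw [mul_zero]

/-- The canonical homomorphism `A → A / I`. -/
def proj : A →ₙₐ[F] I.Quot where
  toFun := I.cls
  map_smul' _ _ := rfl
  map_zero' := rfl
  map_add' _ _ := rfl
  map_mul' _ _ := rfl

end AlgIdeal

end Quotient

section Uniform

variable (F : Type*) {A : Type*} [Field F] [NonUnitalNonAssocRing A] [Module F A]
  [IsScalarTower F A A] [SMulCommClass F A A]

/-- The structure of the algebra `B` generated by a set `S` of primitive axes of one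
type `(mu, nu)`. -/
structure UniformStructure (S : Set A) (B : NonUnitalSubalgebra F A) (mu nu : F) : Prop where
  /-- `B` is spanned by `S`. -/
  span_eq : Submodule.span F S = B.toSubmodule
  /-- If `S` is connected, then `B = U_T(mu)` for a basis `T ⊆ S` of `B`. -/
  of_conn : IsConn S → ∃ T ⊆ S, IsUAlg B T mu
  /-- If `S` is connected, then products of elements of `Cl(S)` are nonzero. -/
  mul_ne_zero : IsConn S → ∀ x ∈ Cl F S, ∀ y ∈ Cl F S, x * y ≠ 0
  /-- `S` contains a basis of `B`. -/
  exists_basis : ∃ T ⊆ S, IsBasisOf F T B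
  /-- Let `T ⊆ S` be a basis of `B`, with components `T_C`. Each `T_C` lies in one component
  `D C` of `Cl(S)`, and `B` is the direct product of the subalgebras generated by these `D C`,
  which are the algebras `U_{T_C}(mu)`. -/
  product : ∀ T ⊆ S, IsBasisOf F T B → ∃ D : Comp T → Comp (Cl F S),
    (∀ C, compSet C ⊆ compSet (D C)) ∧
    (∀ C, IsUAlg (NonUnitalAlgebra.adjoin F (compSet (D C))) (compSet C) mu) ∧
    IsDirectProduct F (fun C => NonUnitalAlgebra.adjoin F (compSet (D C))) B
  /-- A nonzero idempotent of `B` is a primitive axis of `B` iff it lies in the subalgebra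
  generated by one of the components of `Cl(S)`. -/
  primitive_iff : ∀ c : B, c ≠ 0 → c * c = c →
    (c ∈ chi F B ↔ ∃ D : Comp (Cl F S), (c : A) ∈ NonUnitalAlgebra.adjoin F (compSet D))
  /-- All axes of `B` are of type `(mu, nu)`. -/
  axis_type : ∀ c : B, (∃ m n : F, IsAxis F c m n) → IsAxis F c mu nu
  /-- All primitive axes of `B` are primitive axes of type `(mu, nu)`. -/
  primitive_type : ∀ c ∈ chi F B, IsPrimitiveAxis F c mu nu

end Uniform

end Axial

open Axial

set_option linter.unusedSectionVars false

namespace Axial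

/-! ### Primitive axes in elementwise form -/

section Elementwise

variable {F : Type*} {A : Type*} [Field F] [NonUnitalNonAssocRing A] [Module F A]
  [IsScalarTower F A A] [SMulCommClass F A A]

/-! Everything rests on the products of two primitive axes. Since `l ≠ d`, the grading of an axis
`a` of type `(l, d)` is visible in the commutator with `a`: the even part is the commutant of `a`,
and the odd projection is `(d - l)⁻¹ (R_a - L_a)`.

Two axes of the same type (`PAx.mul_cases`, `PAx.mul_ne_zero_trans`). Comparing the decomposition of
`b` along `a` with that of `a` along `b` leaves only `ab = ba = 0` or `ab = d a + l b`, `ba = l a +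
d b`. Having nonzero product is an equivalence relation on the axes of one type. Distinct classes
annihilate each other, the products inside a class are those of `U_E(l)`, and differences of axes of
one class multiply to zero.

Two distinct axes `a`, `b` of opposite types (`PAx.cross_spec`). Here `ab = l z` and `ba = d z`,
where `z = cross a b` is odd for both. The involution of `b` sends `a` to `a - 2z`, which is again
an axis and lies in the class of `a`. So `z` is half the difference of two axes of one class, and
its behaviour follows from the class relation: an axis of type `(l, d)` in the class of `a` acts on
`z` by the odd eigenvalues, any other annihilates `z`, and any two such elements `z` multiply to
zero. Hence the span `Z` of these elements is an ideal of square zero and `A = A' + A'' + Z`.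

The classes are affine spaces (`PAx.add_mem_classDiff`). As `A` is spanned by axes, the odd space of
`a` is spanned by the differences `y - a` within its class. For `a`, `b` in one class, the product
of the two involutions is `1 - 2N` with `N` a derivation, and `N` has images of product zero and
satisfies `N² = 0`. Such derivations can be added, and each `1 + N` is an automorphism. So `a + m`
is an axis for every odd `m`. This produces the axes `a + z`, and shows that a nonzero idempotent in
the span of one class is a primitive axis of `A`.

Quotients. The coefficient of `a` is an algebra homomorphism to `F` (`PAx.exists_character`). These
characters identify the quotients by the sums of odd spaces.

Faithfulness (`mem_of_forall_mul_mem`, `AxialGenerators.eq_zero_of_mul_eq_zero`). An element of the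
span of axes of one type is determined, modulo any subspace, by its products with those axes. Modulo
zero this separates the spans of different classes; modulo `Z` it shows that the images of `A'` and
`A''` meet trivially. Together with the analogous statement inside `Z`, it shows that no nonzero
element annihilates all generators, which makes the sum over the components of `Cl(X)` direct. -/

theorem mem_eigL {a y : A} {c : F} : y ∈ eigL F a c ↔ a * y = c • y := by
  simp [eigL]

theorem mem_eigR {a y : A} {c : F} : y ∈ eigR F a c ↔ y * a = c • y := by
  simp [eigR]

theorem mem_eig {a y : A} {c e : F} : y ∈ eig F c e a ↔ a * y = c • y ∧ y * a = e • y := by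
  simp [eig, mem_eigL, mem_eigR]

theorem mem_eig0 {a y : A} : y ∈ eig0 F a ↔ a * y = 0 ∧ y * a = 0 := by
  simp [eig0, mem_eig]

/-- The standing assumptions on a pair of eigenvalues `(l, d)`. -/
structure AxialPair (l d : F) : Prop where
  two : (2 : F) ≠ 0
  l0 : l ≠ 0
  d0 : d ≠ 0
  sum : l + d = 1
  ne : l ≠ d

namespace AxialPair

variable {l d : F}

theorem symm (h : AxialPair l d) : AxialPair d l :=
  ⟨h.two, h.d0, h.l0, by rw [add_comm]; exact h.sum, h.ne.symm⟩

theorem d_eq (h : AxialPair l d) : d = 1 - l := by rw [← h.sum]; ring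

theorem l1 (h : AxialPair l d) : l ≠ 1 := fun h1 => h.d0 (by rw [h.d_eq, h1]; ring)

theorem d1 (h : AxialPair l d) : d ≠ 1 := h.symm.l1

theorem sub_ne (h : AxialPair l d) : d - l ≠ 0 := sub_ne_zero.2 h.ne.symm

end AxialPair

/-- An elementwise form of `IsPrimitiveAxis`: the even part is the commutant of `a`, the odd part
consists of the `w` with `a * w = l • w`, `w * a = d • w`. -/
structure PAx (l d : F) (a : A) : Prop where
  ne : a ≠ 0
  idem : a * a = a
  dec : ∀ y : A, ∃ (k : F) (v w : A), y = k • a + v + w ∧ a * v = 0 ∧ v * a = 0 ∧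
    a * w = l • w ∧ w * a = d • w
  ee : ∀ p q : A, a * p = p * a → a * q = q * a → a * (p * q) = p * q * a
  eo : ∀ p w : A, a * p = p * a → a * w = l • w → w * a = d • w →
    a * (p * w) = l • (p * w) ∧ p * w * a = d • (p * w)
  oe : ∀ w p : A, a * w = l • w → w * a = d • w → a * p = p * a →
    a * (w * p) = l • (w * p) ∧ w * p * a = d • (w * p)
  oo : ∀ w v : A, a * w = l • w → w * a = d • w → a * v = l • v → v * a = d • v →
    a * (w * v) = w * v * a

/-- Applying `L_a` once and twice gives `s + l w = 0` and `s + l² w = 0`, and `l ≠ l²`. -/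
theorem indep_of_idem {l : F} (hl0 : l ≠ 0) (hl1 : l ≠ 1) {a s v w : A}
    (hs : a * s = s) (hv : a * v = 0) (hw : a * w = l • w) (h : s + v + w = 0) :
    s = 0 ∧ v = 0 ∧ w = 0 := by
  have h1 : s + l • w = 0 := by
    have := congrArg (a * ·) h
    simpa [mul_add, hs, hv, hw] using this
  have h2 : s + (l * l) • w = 0 := by
    have := congrArg (a * ·) h1
    simpa [mul_add, hs, hw, mul_smul_comm, smul_smul] using this
  have h3 : (l * (1 - l)) • w = 0 := by linear_combination (norm := module) h1 - h2
  have hw0 : w = 0 := (smul_eq_zero.1 h3).resolve_left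
    (mul_ne_zero hl0 (sub_ne_zero.2 (Ne.symm hl1)))
  subst hw0
  have hs0 : s = 0 := by simpa using h1
  subst hs0
  exact ⟨rfl, by simpa using h, rfl⟩

theorem indep_of_idem_right {l : F} (hl0 : l ≠ 0) (hl1 : l ≠ 1) {a s v w : A}
    (hs : s * a = s) (hv : v * a = 0) (hw : w * a = l • w) (h : s + v + w = 0) :
    s = 0 ∧ v = 0 ∧ w = 0 := by
  have h1 : s + l • w = 0 := by
    have := congrArg (· * a) h
    simpa [add_mul, hs, hv, hw] using this
  have h2 : s + (l * l) • w = 0 := by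
    have := congrArg (· * a) h1
    simpa [add_mul, hs, hw, smul_mul_assoc, smul_smul] using this
  have h3 : (l * (1 - l)) • w = 0 := by linear_combination (norm := module) h1 - h2
  have hw0 : w = 0 := (smul_eq_zero.1 h3).resolve_left
    (mul_ne_zero hl0 (sub_ne_zero.2 (Ne.symm hl1)))
  subst hw0
  have hs0 : s = 0 := by simpa using h1
  subst hs0
  exact ⟨rfl, by simpa using h, rfl⟩

namespace PAx

variable {l d : F} {a : A}

theorem indep (h : AxialPair l d) (ha : PAx l d a) {k : F} {v w : A} (hv : a * v = 0)
    (hw : a * w = l • w) (hs : k • a + v + w = 0) : k = 0 ∧ v = 0 ∧ w = 0 := by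
  obtain ⟨h1, h2, h3⟩ := indep_of_idem h.l0 h.l1 (by rw [mul_smul_comm, ha.idem]) hv hw hs
  exact ⟨(smul_eq_zero.1 h1).resolve_right ha.ne, h2, h3⟩

theorem indep_right (h : AxialPair l d) (ha : PAx l d a) {k : F} {v w : A} (hv : v * a = 0)
    (hw : w * a = d • w) (hs : k • a + v + w = 0) : k = 0 ∧ v = 0 ∧ w = 0 := by
  obtain ⟨h1, h2, h3⟩ := indep_of_idem_right h.d0 h.d1 (by rw [smul_mul_assoc, ha.idem]) hv hw hs
  exact ⟨(smul_eq_zero.1 h1).resolve_right ha.ne, h2, h3⟩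

theorem right_of_left_zero (h : AxialPair l d) (ha : PAx l d a) {u : A} (hu : a * u = 0) :
    u * a = 0 := by
  obtain ⟨k, v, w, rfl, h1, h2, h3, h4⟩ := ha.dec u
  have e : k • a + 0 + l • w = 0 := by
    simpa [mul_add, mul_smul_comm, ha.idem, h1, h3] using hu
  obtain ⟨r1, -, r2⟩ := ha.indep h (by simp) (by rw [mul_smul_comm, h3]) e
  have r3 : w = 0 := (smul_eq_zero.1 r2).resolve_left h.l0
  simp [r1, r3, h2]

theorem left_of_right_zero (h : AxialPair l d) (ha : PAx l d a) {u : A} (hu : u * a = 0) :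
    a * u = 0 := by
  obtain ⟨k, v, w, rfl, h1, h2, h3, h4⟩ := ha.dec u
  have e : k • a + 0 + d • w = 0 := by
    simpa [add_mul, smul_mul_assoc, ha.idem, h2, h4] using hu
  obtain ⟨r1, -, r2⟩ := ha.indep_right h (by simp) (by rw [smul_mul_assoc, h4]) e
  have r3 : w = 0 := (smul_eq_zero.1 r2).resolve_left h.d0
  simp [r1, r3, h1]

theorem right_of_left_odd (h : AxialPair l d) (ha : PAx l d a) {u : A} (hu : a * u = l • u) :
    u * a = d • u := by
  obtain ⟨k, v, w, rfl, h1, h2, h3, h4⟩ := ha.dec u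
  simp only [mul_add, mul_smul_comm, ha.idem, h1, h3] at hu
  have e : ((1 - l) * k) • a + (-l) • v + 0 = 0 := by linear_combination (norm := module) hu
  obtain ⟨r1, r2, -⟩ := ha.indep h (by rw [mul_smul_comm, h1, smul_zero]) (by simp) e
  have r3 : v = 0 := (smul_eq_zero.1 r2).resolve_left (neg_ne_zero.2 h.l0)
  have r4 : k = 0 := (mul_eq_zero.1 r1).resolve_left (sub_ne_zero.2 h.l1.symm)
  simp [r3, r4, h4]

theorem left_of_right_odd (h : AxialPair l d) (ha : PAx l d a) {u : A} (hu : u * a = d • u) :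
    a * u = l • u := by
  obtain ⟨k, v, w, rfl, h1, h2, h3, h4⟩ := ha.dec u
  simp only [add_mul, smul_mul_assoc, ha.idem, h2, h4] at hu
  have e : ((1 - d) * k) • a + (-d) • v + 0 = 0 := by linear_combination (norm := module) hu
  obtain ⟨r1, r2, -⟩ := ha.indep_right h (by rw [smul_mul_assoc, h2, smul_zero]) (by simp) e
  have r3 : v = 0 := (smul_eq_zero.1 r2).resolve_left (neg_ne_zero.2 h.d0)
  have r4 : k = 0 := (mul_eq_zero.1 r1).resolve_left (sub_ne_zero.2 h.d1.symm)
  simp [r3, r4, h3]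

theorem eq_smul_of_left (h : AxialPair l d) (ha : PAx l d a) {u : A} (hu : a * u = u) :
    ∃ k : F, u = k • a := by
  obtain ⟨k, v, w, rfl, h1, h2, h3, h4⟩ := ha.dec u
  simp only [mul_add, mul_smul_comm, ha.idem, h1, h3] at hu
  have e : (0 : F) • a + v + (1 - l) • w = 0 := by linear_combination (norm := module) -hu
  obtain ⟨-, r1, r2⟩ := ha.indep h h1 (by rw [mul_smul_comm, h3, smul_comm]) e
  have r3 : w = 0 := (smul_eq_zero.1 r2).resolve_left (sub_ne_zero.2 h.l1.symm)
  exact ⟨k, by simp [r1, r3]⟩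

theorem eq_smul_of_right (h : AxialPair l d) (ha : PAx l d a) {u : A} (hu : u * a = u) :
    ∃ k : F, u = k • a := by
  obtain ⟨k, v, w, rfl, h1, h2, h3, h4⟩ := ha.dec u
  simp only [add_mul, smul_mul_assoc, ha.idem, h2, h4] at hu
  have e : (0 : F) • a + v + (1 - d) • w = 0 := by linear_combination (norm := module) -hu
  obtain ⟨-, r1, r2⟩ := ha.indep_right h h2 (by rw [smul_mul_assoc, h4, smul_comm]) e
  have r3 : w = 0 := (smul_eq_zero.1 r2).resolve_left (sub_ne_zero.2 h.d1.symm)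
  exact ⟨k, by simp [r1, r3]⟩

theorem eq_zero_of_even_odd (h : AxialPair l d) {a u : A} (he : a * u = u * a)
    (h1 : a * u = l • u) (h2 : u * a = d • u) : u = 0 := by
  have : (d - l) • u = 0 := by linear_combination (norm := module) h1 - h2 - he
  exact (smul_eq_zero.1 this).resolve_left h.sub_ne

theorem exists_even (h : AxialPair l d) (ha : PAx l d a) {u : A} (hu : a * u = u * a) :
    ∃ (k : F) (v : A), u = k • a + v ∧ a * v = 0 ∧ v * a = 0 := by
  obtain ⟨k, v, w, rfl, h1, h2, h3, h4⟩ := ha.dec u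
  have e : a * w = w * a := by
    simpa [mul_add, add_mul, mul_smul_comm, smul_mul_assoc, h1, h2] using hu
  refine ⟨k, v, ?_, h1, h2⟩
  rw [eq_zero_of_even_odd h e h3 h4, add_zero]

theorem mem_even_left (h : AxialPair l d) (ha : PAx l d a) {u : A} :
    u ∈ eigL F a 1 ⊔ eigL F a 0 ↔ a * u = u * a := by
  constructor
  · intro hu
    obtain ⟨s, hs, v, hv, rfl⟩ := Submodule.mem_sup.1 hu
    rw [mem_eigL, one_smul] at hs
    rw [mem_eigL, zero_smul] at hv
    obtain ⟨k, rfl⟩ := ha.eq_smul_of_left h hs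
    simp [mul_add, add_mul, mul_smul_comm, smul_mul_assoc, hv, ha.right_of_left_zero h hv]
  · intro hu
    obtain ⟨k, v, rfl, h1, h2⟩ := ha.exists_even h hu
    refine Submodule.add_mem_sup ?_ ?_
    · rw [mem_eigL, one_smul, mul_smul_comm, ha.idem]
    · rw [mem_eigL, zero_smul, h1]

theorem mem_even_right (h : AxialPair l d) (ha : PAx l d a) {u : A} :
    u ∈ eigR F a 1 ⊔ eigR F a 0 ↔ a * u = u * a := by
  constructor
  · intro hu
    obtain ⟨s, hs, v, hv, rfl⟩ := Submodule.mem_sup.1 hu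
    rw [mem_eigR, one_smul] at hs
    rw [mem_eigR, zero_smul] at hv
    obtain ⟨k, rfl⟩ := ha.eq_smul_of_right h hs
    simp [mul_add, add_mul, mul_smul_comm, smul_mul_assoc, hv, ha.left_of_right_zero h hv]
  · intro hu
    obtain ⟨k, v, rfl, h1, h2⟩ := ha.exists_even h hu
    refine Submodule.add_mem_sup ?_ ?_
    · rw [mem_eigR, one_smul, smul_mul_assoc, ha.idem]
    · rw [mem_eigR, zero_smul, h2]

/-- The left and right gradings coincide, the even part being the commutant and the odd part the
common eigenspace. The same four product rules therefore serve both sides. -/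
theorem isPrimitiveAxis (h : AxialPair l d) (ha : PAx l d a) : IsPrimitiveAxis F a l d where
  left :=
    { ne_zero := h.l0
      ne_one := h.l1
      idem := ha.idem
      grading := by
        have hM : ∀ {u : A}, u ∈ eigL F a l ↔ a * u = l • u ∧ u * a = d • u := fun {u} =>
          ⟨fun hu => ⟨mem_eigL.1 hu, ha.right_of_left_odd h (mem_eigL.1 hu)⟩,
            fun hu => mem_eigL.2 hu.1⟩
        refine ⟨⟨?_, ?_⟩, ?_, ?_, ?_, ?_⟩
        · rw [Submodule.disjoint_def]
          intro u hu hu'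
          rw [ha.mem_even_left h] at hu
          rw [hM] at hu'
          exact eq_zero_of_even_odd h hu hu'.1 hu'.2
        · rw [codisjoint_iff, eq_top_iff]
          rintro y -
          obtain ⟨k, v, w, rfl, h1, h2, h3, h4⟩ := ha.dec y
          refine Submodule.add_mem_sup ((ha.mem_even_left h).2 ?_) (hM.2 ⟨h3, h4⟩)
          simp [mul_add, add_mul, mul_smul_comm, smul_mul_assoc, h1, h2]
        · intro x hx y hy
          rw [ha.mem_even_left h] at *
          exact ha.ee _ _ hx hy
        · intro x hx y hy
          rw [ha.mem_even_left h] at hx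
          rw [hM] at *
          exact ha.eo _ _ hx hy.1 hy.2
        · intro x hx y hy
          rw [ha.mem_even_left h] at hy
          rw [hM] at *
          exact ha.oe _ _ hx.1 hx.2 hy
        · intro x hx y hy
          rw [ha.mem_even_left h]
          rw [hM] at *
          exact ha.oo _ _ hx.1 hx.2 hy.1 hy.2 }
  right :=
    { ne_zero := h.d0
      ne_one := h.d1
      idem := ha.idem
      grading := by
        have hM : ∀ {u : A}, u ∈ eigR F a d ↔ a * u = l • u ∧ u * a = d • u := fun {u} =>
          ⟨fun hu => ⟨ha.left_of_right_odd h (mem_eigR.1 hu), mem_eigR.1 hu⟩,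
            fun hu => mem_eigR.2 hu.2⟩
        refine ⟨⟨?_, ?_⟩, ?_, ?_, ?_, ?_⟩
        · rw [Submodule.disjoint_def]
          intro u hu hu'
          rw [ha.mem_even_right h] at hu
          rw [hM] at hu'
          exact eq_zero_of_even_odd h hu hu'.1 hu'.2
        · rw [codisjoint_iff, eq_top_iff]
          rintro y -
          obtain ⟨k, v, w, rfl, h1, h2, h3, h4⟩ := ha.dec y
          refine Submodule.add_mem_sup ((ha.mem_even_right h).2 ?_) (hM.2 ⟨h3, h4⟩)
          simp [mul_add, add_mul, mul_smul_comm, smul_mul_assoc, h1, h2]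
        · intro x hx y hy
          rw [ha.mem_even_right h] at *
          exact ha.ee _ _ hx hy
        · intro x hx y hy
          rw [ha.mem_even_right h] at hx
          rw [hM] at *
          exact ha.eo _ _ hx hy.1 hy.2
        · intro x hx y hy
          rw [ha.mem_even_right h] at hy
          rw [hM] at *
          exact ha.oe _ _ hx.1 hx.2 hy
        · intro x hx y hy
          rw [ha.mem_even_right h]
          rw [hM] at *
          exact ha.oo _ _ hx.1 hx.2 hy.1 hy.2 }
  comm := by
    intro y
    obtain ⟨k, v, w, rfl, h1, h2, h3, h4⟩ := ha.dec y
    simp [mul_add, add_mul, mul_smul_comm, smul_mul_assoc, h1, h2, h3, h4, ha.idem, smul_smul,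
      mul_comm]
  ne_zero := ha.ne
  left_one := by
    ext u
    rw [mem_eigL, one_smul, Submodule.mem_span_singleton]
    constructor
    · intro hu
      obtain ⟨k, rfl⟩ := ha.eq_smul_of_left h hu
      exact ⟨k, rfl⟩
    · rintro ⟨k, rfl⟩
      rw [mul_smul_comm, ha.idem]
  right_one := by
    ext u
    rw [mem_eigR, one_smul, Submodule.mem_span_singleton]
    constructor
    · intro hu
      obtain ⟨k, rfl⟩ := ha.eq_smul_of_right h hu
      exact ⟨k, rfl⟩
    · rintro ⟨k, rfl⟩
      rw [smul_mul_assoc, ha.idem]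
  eig_lam_zero := by
    rw [eq_bot_iff]
    intro u hu
    rw [mem_eig, zero_smul] at hu
    have := ha.left_of_right_zero h hu.2
    rw [this] at hu
    exact (smul_eq_zero.1 hu.1.symm).resolve_left h.l0
  eig_zero_del := by
    rw [eq_bot_iff]
    intro u hu
    rw [mem_eig, zero_smul] at hu
    have := ha.right_of_left_zero h hu.1
    rw [this] at hu
    exact (smul_eq_zero.1 hu.2.symm).resolve_left h.d0

end PAx

namespace IsPrimitiveAxis

variable {l d : F} {a : A}

theorem exists_right (ha : IsPrimitiveAxis F a l d) (y : A) :
    ∃ (k : F) (v w : A), y = k • a + v + w ∧ v * a = 0 ∧ w * a = d • w := by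
  have : y ∈ (eigR F a 1 ⊔ eigR F a 0) ⊔ eigR F a d := by
    rw [codisjoint_iff.1 ha.right.grading.isCompl.codisjoint]; trivial
  obtain ⟨p, hp, w, hw, rfl⟩ := Submodule.mem_sup.1 this
  obtain ⟨s, hs, v, hv, rfl⟩ := Submodule.mem_sup.1 hp
  rw [ha.right_one, Submodule.mem_span_singleton] at hs
  obtain ⟨k, rfl⟩ := hs
  exact ⟨k, v, w, rfl, by simpa using mem_eigR.1 hv, mem_eigR.1 hw⟩

/-- As `L_a` and `R_a` commute, the `R_a`-components of an `L_a`-eigenvector are again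
`L_a`-eigenvectors. The vanishing of the mixed eigenspaces then lets a left eigenvalue `0` or `l`
determine the right one. -/
theorem right_of_left (ha : IsPrimitiveAxis F a l d) {c : F} (hc : c ≠ 1) {u : A}
    (hu : a * u = c • u) :
    ∃ v w : A, u = v + w ∧ a * v = c • v ∧ v * a = 0 ∧ a * w = c • w ∧ w * a = d • w := by
  obtain ⟨k, v, w, rfl, hv, hw⟩ := ha.exists_right u
  simp only [mul_add, mul_smul_comm, ha.left.idem] at hu
  have e : ((1 - c) * k) • a + (a * v - c • v) + (a * w - c • w) = 0 := by
    linear_combination (norm := module) hu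
  obtain ⟨h1, h2, h3⟩ := indep_of_idem_right ha.right.ne_zero ha.right.ne_one
    (by rw [smul_mul_assoc, ha.left.idem])
    (by rw [sub_mul, ← ha.comm, hv, smul_mul_assoc, hv]; simp)
    (by rw [sub_mul, ← ha.comm, hw, smul_mul_assoc, hw, mul_smul_comm, smul_sub, smul_comm c d])
    e
  have hk : k = 0 := by
    have := (smul_eq_zero.1 h1).resolve_right ha.ne_zero
    exact (mul_eq_zero.1 this).resolve_left (sub_ne_zero.2 hc.symm)
  exact ⟨v, w, by simp [hk], sub_eq_zero.1 h2, hv, sub_eq_zero.1 h3, hw⟩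

theorem right_of_left_zero (ha : IsPrimitiveAxis F a l d) {u : A} (hu : a * u = 0) :
    u * a = 0 := by
  obtain ⟨v, w, rfl, h1, h2, h3, h4⟩ :=
    ha.right_of_left (c := 0) (zero_ne_one) (u := u) (by rw [hu, zero_smul])
  have : w ∈ eig F 0 d a := mem_eig.2 ⟨h3, h4⟩
  rw [ha.eig_zero_del, Submodule.mem_bot] at this
  simp [this, h2]

theorem right_of_left_odd (ha : IsPrimitiveAxis F a l d) {u : A} (hu : a * u = l • u) :
    u * a = d • u := by
  obtain ⟨v, w, rfl, h1, h2, h3, h4⟩ := ha.right_of_left ha.left.ne_one hu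
  have : v ∈ eig F l 0 a := mem_eig.2 ⟨h1, by simp [h2]⟩
  rw [ha.eig_lam_zero, Submodule.mem_bot] at this
  simp [this, h4]

theorem dec (ha : IsPrimitiveAxis F a l d) (y : A) :
    ∃ (k : F) (v w : A), y = k • a + v + w ∧ a * v = 0 ∧ v * a = 0 ∧
      a * w = l • w ∧ w * a = d • w := by
  have : y ∈ (eigL F a 1 ⊔ eigL F a 0) ⊔ eigL F a l := by
    rw [codisjoint_iff.1 ha.left.grading.isCompl.codisjoint]; trivial
  obtain ⟨p, hp, w, hw, rfl⟩ := Submodule.mem_sup.1 this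
  obtain ⟨s, hs, v, hv, rfl⟩ := Submodule.mem_sup.1 hp
  rw [ha.left_one, Submodule.mem_span_singleton] at hs
  obtain ⟨k, rfl⟩ := hs
  rw [mem_eigL, zero_smul] at hv
  rw [mem_eigL] at hw
  exact ⟨k, v, w, rfl, hv, ha.right_of_left_zero hv, hw, ha.right_of_left_odd hw⟩

theorem pAx (h : AxialPair l d) (ha : IsPrimitiveAxis F a l d) : PAx l d a := by
  have hP : ∀ {u : A}, u ∈ eigL F a 1 ⊔ eigL F a 0 ↔ a * u = u * a := by
    intro u
    constructor
    · intro hu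
      obtain ⟨s, hs, v, hv, rfl⟩ := Submodule.mem_sup.1 hu
      rw [ha.left_one, Submodule.mem_span_singleton] at hs
      obtain ⟨k, rfl⟩ := hs
      rw [mem_eigL, zero_smul] at hv
      simp [mul_add, add_mul, mul_smul_comm, smul_mul_assoc, hv, ha.right_of_left_zero hv]
    · intro hu
      obtain ⟨k, v, w, rfl, h1, h2, h3, h4⟩ := ha.dec u
      have e : a * w = w * a := by
        simpa [mul_add, add_mul, mul_smul_comm, smul_mul_assoc, h1, h2] using hu
      rw [PAx.eq_zero_of_even_odd h e h3 h4, add_zero]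
      refine Submodule.add_mem_sup ?_ ?_
      · rw [mem_eigL, one_smul, mul_smul_comm, ha.left.idem]
      · rw [mem_eigL, zero_smul, h1]
  have hM : ∀ {u : A}, u ∈ eigL F a l ↔ a * u = l • u ∧ u * a = d • u := fun {u} =>
    ⟨fun hu => ⟨mem_eigL.1 hu, ha.right_of_left_odd (mem_eigL.1 hu)⟩, fun hu => mem_eigL.2 hu.1⟩
  have g := ha.left.grading
  exact
    { ne := ha.ne_zero
      idem := ha.left.idem
      dec := ha.dec
      ee := fun p q hp hq => hP.1 (g.even_even _ (hP.2 hp) _ (hP.2 hq))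
      eo := fun p w hp h1 h2 => hM.1 (g.even_odd _ (hP.2 hp) _ (hM.2 ⟨h1, h2⟩))
      oe := fun w p h1 h2 hp => hM.1 (g.odd_even _ (hM.2 ⟨h1, h2⟩) _ (hP.2 hp))
      oo := fun w v h1 h2 h3 h4 => hP.1 (g.odd_odd _ (hM.2 ⟨h1, h2⟩) _ (hM.2 ⟨h3, h4⟩)) }

end IsPrimitiveAxis

theorem isPrimitiveAxis_iff {l d : F} (h : AxialPair l d) {a : A} :
    IsPrimitiveAxis F a l d ↔ PAx l d a :=
  ⟨fun ha => ha.pAx h, fun ha => ha.isPrimitiveAxis h⟩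

end Elementwise

/-! ### Odd projections, involutions, and products of two primitive axes -/

section Pairs

variable {F : Type*} {A : Type*} [Field F] [NonUnitalNonAssocRing A] [Module F A]
  [IsScalarTower F A A] [SMulCommClass F A A]

/-- The projection to the odd part of a primitive axis `a` of type `(l, d)`. -/
noncomputable def oddPart (l d : F) (a : A) : A →ₗ[F] A :=
  (d - l)⁻¹ • (LinearMap.mulRight F a - LinearMap.mulLeft F a)

theorem oddPart_apply (l d : F) (a y : A) : oddPart l d a y = (d - l)⁻¹ • (y * a - a * y) := by
  simp [oddPart]

namespace PAx

variable {l d : F} {a b c : A}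

theorem oddPart_of_even {y : A} (hy : a * y = y * a) : oddPart l d a y = 0 := by
  rw [oddPart_apply, hy, sub_self, smul_zero]

theorem oddPart_of_odd (h : AxialPair l d) {w : A} (h1 : a * w = l • w) (h2 : w * a = d • w) :
    oddPart l d a w = w := by
  rw [oddPart_apply, h1, h2, ← sub_smul, smul_smul, inv_mul_cancel₀ h.sub_ne, one_smul]

theorem exists_oddPart (h : AxialPair l d) (ha : PAx l d a) (y : A) :
    ∃ (k : F) (v : A), y = k • a + v + oddPart l d a y ∧ a * v = 0 ∧ v * a = 0 ∧
      a * oddPart l d a y = l • oddPart l d a y ∧ oddPart l d a y * a = d • oddPart l d a y := by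
  obtain ⟨k, v, w, rfl, h1, h2, h3, h4⟩ := ha.dec y
  have : oddPart l d a (k • a + v + w) = w := by
    rw [map_add, oddPart_of_odd h h3 h4, oddPart_of_even, zero_add]
    simp [mul_add, add_mul, mul_smul_comm, smul_mul_assoc, h1, h2]
  exact ⟨k, v, by rw [this], h1, h2, by rw [this, h3], by rw [this, h4]⟩

theorem mul_oddPart (h : AxialPair l d) (ha : PAx l d a) (y : A) :
    a * oddPart l d a y = l • oddPart l d a y := by
  obtain ⟨k, v, -, -, -, h3, -⟩ := ha.exists_oddPart h y
  exact h3

theorem oddPart_mul (h : AxialPair l d) (ha : PAx l d a) (y : A) :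
    oddPart l d a y * a = d • oddPart l d a y := by
  obtain ⟨k, v, -, -, -, -, h4⟩ := ha.exists_oddPart h y
  exact h4

theorem even_sub_oddPart (h : AxialPair l d) (ha : PAx l d a) (y : A) :
    a * (y - oddPart l d a y) = (y - oddPart l d a y) * a := by
  obtain ⟨k, v, hy, h1, h2, -, -⟩ := ha.exists_oddPart h y
  have : y - oddPart l d a y = k • a + v := by
    rw [sub_eq_iff_eq_add]; exact hy
  rw [this]
  simp [mul_add, add_mul, mul_smul_comm, smul_mul_assoc, h1, h2]

/-- Only the even-odd and odd-even products are odd. The multiplicativity of the involution is this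
identity together with bilinearity. -/
theorem oddPart_mul_eq (h : AxialPair l d) (ha : PAx l d a) (x y : A) :
    oddPart l d a (x * y) = (x - oddPart l d a x) * oddPart l d a y +
      oddPart l d a x * (y - oddPart l d a y) := by
  have hx := ha.even_sub_oddPart h x
  have hy := ha.even_sub_oddPart h y
  have hx1 := ha.mul_oddPart h x
  have hx2 := ha.oddPart_mul h x
  have hy1 := ha.mul_oddPart h y
  have hy2 := ha.oddPart_mul h y
  set w := oddPart l d a x with hw
  set v := oddPart l d a y with hv
  have e : x * y = ((x - w) * (y - v) + w * v) + ((x - w) * v + w * (y - v)) := by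
    simp only [mul_sub, sub_mul]; abel
  rw [e, map_add, oddPart_of_even, zero_add, map_add]
  · obtain ⟨e1, e2⟩ := ha.eo _ _ hx hy1 hy2
    obtain ⟨e3, e4⟩ := ha.oe _ _ hx1 hx2 hy
    rw [oddPart_of_odd h e1 e2, oddPart_of_odd h e3 e4]
  · rw [mul_add, add_mul, ha.ee _ _ hx hy, ha.oo _ _ hx1 hx2 hy1 hy2]

/-- The Miyamoto involution of a primitive axis of type `(l, d)`. -/
noncomputable def tau (h : AxialPair l d) (ha : PAx l d a) : A ≃ₗ[F] A :=
  LinearEquiv.ofInvolutive (LinearMap.id - (2 : F) • oddPart l d a) (by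
    intro y
    simp only [LinearMap.sub_apply, LinearMap.id_apply, LinearMap.smul_apply, map_sub, map_smul]
    rw [oddPart_of_odd h (ha.mul_oddPart h y) (ha.oddPart_mul h y)]
    module)

theorem tau_apply (h : AxialPair l d) (ha : PAx l d a) (y : A) :
    ha.tau h y = y - (2 : F) • oddPart l d a y := rfl

theorem tau_mul (h : AxialPair l d) (ha : PAx l d a) (x y : A) :
    ha.tau h (x * y) = ha.tau h x * ha.tau h y := by
  simp only [tau_apply, ha.oddPart_mul_eq h, mul_sub, sub_mul, mul_smul_comm, smul_mul_assoc]
  module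

theorem map (ha : PAx l d a) (e : A ≃ₗ[F] A) (he : ∀ x y, e (x * y) = e x * e y) :
    PAx l d (e a) := by
  refine ⟨?_, ?_, ?_, ?_, ?_, ?_, ?_⟩
  · simpa using ha.ne
  · rw [← he, ha.idem]
  · intro y
    obtain ⟨k, v, w, hy, h1, h2, h3, h4⟩ := ha.dec (e.symm y)
    refine ⟨k, e v, e w, ?_, ?_, ?_, ?_, ?_⟩
    · rw [← map_smul, ← map_add, ← map_add, ← hy, e.apply_symm_apply]
    · rw [← he, h1, map_zero]
    · rw [← he, h2, map_zero]
    · rw [← he, h3, map_smul]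
    · rw [← he, h4, map_smul]
  all_goals
    intro p q
    obtain ⟨p, rfl⟩ := e.surjective p
    obtain ⟨q, rfl⟩ := e.surjective q
    simp only [← he, ← map_smul, e.injective.eq_iff]
  · exact ha.ee _ _
  · exact ha.eo _ _
  · exact ha.oe _ _
  · exact ha.oo _ _

/-- The odd part of an element of `B` is a combination of its products with `a`, so the
decomposition along `a` does not leave `B`. -/
theorem of_coe (h : AxialPair l d) {B : NonUnitalSubalgebra F A} {a : B} (ha : PAx l d (a : A)) :
    PAx l d a where
  ne h0 := ha.ne (by rw [h0]; rfl)
  idem := Subtype.ext ha.idem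
  dec y := by
    obtain ⟨k, v, hy, h1, h2, h3, h4⟩ := ha.exists_oddPart h (y : A)
    set w := oddPart l d (a : A) (y : A) with hw
    let w' : B := (d - l)⁻¹ • (y * a - a * y)
    have hww : (w' : A) = w := by rw [hw, oddPart_apply]; rfl
    let v' : B := y - k • a - w'
    have hvv : (v' : A) = v := by
      change (y : A) - k • (a : A) - (w' : A) = v
      rw [hww]; nth_rw 1 [hy]; abel
    refine ⟨k, v', w', ?_, ?_, ?_, ?_, ?_⟩
    · simp only [v']; abel
    · apply Subtype.ext; change (a : A) * (v' : A) = 0; rw [hvv, h1]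
    · apply Subtype.ext; change (v' : A) * (a : A) = 0; rw [hvv, h2]
    · apply Subtype.ext; change (a : A) * (w' : A) = l • (w' : A); rw [hww, h3]
    · apply Subtype.ext; change (w' : A) * (a : A) = d • (w' : A); rw [hww, h4]
  ee p q hp hq := Subtype.ext
    (ha.ee p q (congrArg Subtype.val hp) (congrArg Subtype.val hq))
  eo p q hp h1 h2 :=
    have := ha.eo p q (congrArg Subtype.val hp) (congrArg Subtype.val h1) (congrArg Subtype.val h2)
    ⟨Subtype.ext this.1, Subtype.ext this.2⟩
  oe p q h1 h2 hp :=
    have := ha.oe p q (congrArg Subtype.val h1) (congrArg Subtype.val h2) (congrArg Subtype.val hp)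
    ⟨Subtype.ext this.1, Subtype.ext this.2⟩
  oo p q h1 h2 h3 h4 := Subtype.ext (ha.oo p q (congrArg Subtype.val h1)
    (congrArg Subtype.val h2) (congrArg Subtype.val h3) (congrArg Subtype.val h4))

/-- The type witnessing `IsMiyamoto` need not be `(l, d)` a priori. An `l`-eigenvector of `L_a`
nevertheless has only an odd component for the witnessing type, so `t` negates it in every case. -/
theorem eq_sub_two_oddPart_of_isMiyamoto (h : AxialPair l d) (ha : PAx l d a) {t : A ≃ₗ[F] A}
    (ht : IsMiyamoto F a t) (y : A) : t y = y - (2 : F) • oddPart l d a y := by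
  obtain ⟨m, n, hp, h1, h2⟩ := ht
  have key : ∀ w : A, a * w = l • w → t w = -w := by
    intro w hw
    obtain ⟨k, v, u, rfl, e1, e2, e3, e4⟩ := hp.dec w
    simp only [mul_add, mul_smul_comm, hp.left.idem, e1, e3] at hw
    have e : ((1 - l) * k) • a + (-l) • v + (m - l) • u = 0 := by
      linear_combination (norm := module) hw
    obtain ⟨r1, r2, -⟩ := indep_of_idem hp.left.ne_zero hp.left.ne_one
      (by rw [mul_smul_comm, hp.left.idem]) (by rw [mul_smul_comm, e1, smul_zero])
      (by rw [mul_smul_comm, e3, smul_comm]) e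
    have r3 : v = 0 := (smul_eq_zero.1 r2).resolve_left (neg_ne_zero.2 h.l0)
    have r4 : k • a = 0 := by
      rw [mul_smul] at r1
      exact (smul_eq_zero.1 r1).resolve_left (sub_ne_zero.2 h.l1.symm)
    rw [r3, r4, add_zero, zero_add]
    exact h2 _ (mem_eig.2 ⟨e3, e4⟩)
  obtain ⟨k, v, hy, e1, e2, e3, e4⟩ := ha.exists_oddPart h y
  set w := oddPart l d a y
  have : t (k • a + v) = k • a + v := h1 _ (Submodule.add_mem_sup
    (Submodule.smul_mem _ _ (Submodule.mem_span_singleton_self a)) (mem_eig0.2 ⟨e1, e2⟩))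
  rw [hy, map_add, this, key w e3]
  module

/-! ### Two primitive axes of the same type -/

theorem mul_coeff (h : AxialPair l d) (ha : PAx l d a) (y : A) :
    ∃ (k : F) (v : A), y = k • a + v + oddPart l d a y ∧ a * v = 0 ∧
      a * oddPart l d a y = l • oddPart l d a y ∧ a * y = k • a + l • oddPart l d a y ∧
      y * a = k • a + d • oddPart l d a y := by
  obtain ⟨k, v, hy, h1, h2, h3, h4⟩ := ha.exists_oddPart h y
  refine ⟨k, v, hy, h1, h3, ?_, ?_⟩
  · nth_rw 1 [hy]
    simp [mul_add, mul_smul_comm, ha.idem, h1, h3]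
  · nth_rw 1 [hy]
    simp [add_mul, smul_mul_assoc, ha.idem, h2, h4]

/-- Let `x` be the coefficient of `a` in `b`, and `y` that of `b` in `a`. Independence of the
components along `a` forces `x (y - 1) = 0`, and by symmetry `y (x - 1) = 0`. So `x` and `y` are
both `0` or both `1`. -/
theorem mul_cases (h : AxialPair l d) (ha : PAx l d a) (hb : PAx l d b) :
    (a * b = 0 ∧ b * a = 0) ∨ (a * b = d • a + l • b ∧ b * a = l • a + d • b) := by
  have key : ∀ a b : A, PAx l d a → PAx l d b → ∃ x y : F, x * (y - 1) = 0 ∧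
      a * b = (d * x) • a + (l * y) • b ∧ ((d - l) * x) • a = d • (a * b) - l • (b * a) ∧
      ((d - l) * y) • b = d • (b * a) - l • (a * b) := by
    intro a b ha hb
    obtain ⟨x, v, hy, h1, h3, e1, e2⟩ := ha.mul_coeff h b
    obtain ⟨y, v', hy', h1', h3', e1', e2'⟩ := hb.mul_coeff h a
    set w := oddPart l d a b
    set w' := oddPart l d b a
    have g1 : ((d - l) * x) • a = d • (a * b) - l • (b * a) := by
      rw [e1, e2]; module
    have g2 : ((d - l) * y) • b = d • (b * a) - l • (a * b) := by
      rw [e1', e2']; module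
    -- Solving the two preceding equations for `ab` gives the factor `d² - l²`, which equals `d - l`
    -- because `l + d = 1`.
    have g3 : a * b = (d * x) • a + (l * y) • b := by
      have : (d - l) • (a * b - ((d * x) • a + (l * y) • b)) = 0 := by
        have e : (d - l) • (a * b) = (d * d - l * l) • (a * b) := by
          congr 1; rw [h.d_eq]; ring
        rw [smul_sub, e]
        linear_combination (norm := module) -d • g1 - l • g2
      exact sub_eq_zero.1 ((smul_eq_zero.1 this).resolve_left h.sub_ne)
    refine ⟨x, y, ?_, g3, g1, g2⟩
    have g4 : l • (w - (y • b - x • a)) = 0 := by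
      have hd : d = 1 - l := h.d_eq
      rw [hd] at g3
      linear_combination (norm := module) g3 - e1
    have g5 : w = y • b - x • a :=
      sub_eq_zero.1 ((smul_eq_zero.1 g4).resolve_left h.l0)
    -- Substituting `b = x a + v + w` into `w = y b - x a` gives a relation among the components
    -- along `a`.
    have g6 : (x * (y - 1)) • a + y • v + (y - 1) • w = 0 := by
      linear_combination (norm := module) -g5 - y • hy
    exact (ha.indep h (by rw [mul_smul_comm, h1, smul_zero])
      (by rw [mul_smul_comm, h3, smul_comm]) g6).1
  obtain ⟨x, y, r1, r2, r3, r4⟩ := key a b ha hb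
  obtain ⟨y', x', s1, s2, s3, s4⟩ := key b a hb ha
  have hx : x' = x := by
    have : ((d - l) * (x' - x)) • a = 0 := by linear_combination (norm := module) s4 - r3
    have := (smul_eq_zero.1 this).resolve_right ha.ne
    exact sub_eq_zero.1 ((mul_eq_zero.1 this).resolve_left h.sub_ne)
  have hy : y' = y := by
    have : ((d - l) * (y' - y)) • b = 0 := by linear_combination (norm := module) s3 - r4
    have := (smul_eq_zero.1 this).resolve_right hb.ne
    exact sub_eq_zero.1 ((mul_eq_zero.1 this).resolve_left h.sub_ne)
  subst hx hy
  by_cases hx : x' = 0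
  · subst hx
    have : y' = 0 := by simpa using s1
    subst this
    left
    exact ⟨by rw [r2]; simp, by rw [s2]; simp⟩
  · have hy : y' = 1 := sub_eq_zero.1 ((mul_eq_zero.1 r1).resolve_left hx)
    subst hy
    have hx1 : x' = 1 := by simpa [sub_eq_zero] using s1
    subst hx1
    right
    exact ⟨by rw [r2]; simp, by rw [s2]; simp [add_comm]⟩

theorem mul_eq_zero_comm (h : AxialPair l d) (ha : PAx l d a) (hab : a * b = 0) : b * a = 0 :=
  ha.right_of_left_zero h hab

theorem mul_ne_zero_comm (h : AxialPair l d) (hb : PAx l d b) (hab : a * b ≠ 0) : b * a ≠ 0 :=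
  fun h0 => hab (hb.right_of_left_zero h h0)

theorem mul_eq (h : AxialPair l d) (ha : PAx l d a) (hb : PAx l d b) (hab : a * b ≠ 0) :
    a * b = d • a + l • b := by
  rcases ha.mul_cases h hb with h1 | h1
  · exact absurd h1.1 hab
  · exact h1.1

theorem mul_self_ne (ha : PAx l d a) : a * a ≠ 0 := by rw [ha.idem]; exact ha.ne

/-- Relative to `b`, the vectors `a - b` and `c - b` are odd, so their product is even. If `ac = 0`,
this product is `-b` minus the odd vector `d (a - b) + l (c - b)`, which must vanish. The reversed
product gives the same relation with `l` and `d` exchanged, and subtracting yields `a = c`, against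
`a² ≠ 0`. -/
theorem mul_ne_zero_trans (h : AxialPair l d) (ha : PAx l d a) (hb : PAx l d b) (hc : PAx l d c)
    (hab : a * b ≠ 0) (hbc : b * c ≠ 0) : a * c ≠ 0 := by
  intro hac
  have hca := ha.mul_eq_zero_comm h hac
  have e1 := ha.mul_eq h hb hab
  have e2 := hb.mul_eq h ha (hb.mul_ne_zero_comm h hab)
  have e3 := hb.mul_eq h hc hbc
  have e4 := hc.mul_eq h hb (hc.mul_ne_zero_comm h hbc)
  have hd := h.d_eq
  have odd : ∀ x y : A, b * x = d • b + l • x → x * b = d • x + l • b →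
      b * y = d • b + l • y → y * b = d • y + l • b → x * y = 0 →
      d • (x - b) + l • (y - b) = 0 := by
    intro x y hx hx' hy hy' hxy
    have ox : b * (x - b) = l • (x - b) := by rw [mul_sub, hx, hb.idem, hd]; module
    have ox' : (x - b) * b = d • (x - b) := by rw [sub_mul, hx', hb.idem, hd]; module
    have oy : b * (y - b) = l • (y - b) := by rw [mul_sub, hy, hb.idem, hd]; module
    have oy' : (y - b) * b = d • (y - b) := by rw [sub_mul, hy', hb.idem, hd]; module
    have g := hb.oo _ _ ox ox' oy oy'
    have hz : b + (x - b) * (y - b) + (d • (x - b) + l • (y - b)) = 0 := by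
      rw [mul_sub, sub_mul, sub_mul, hxy, hx', hy, hb.idem, hd]; module
    have hz' : d • (x - b) + l • (y - b) = -(b + (x - b) * (y - b)) := by
      rw [eq_neg_iff_add_eq_zero, add_comm]; exact hz
    refine eq_zero_of_even_odd h (a := b) ?_ ?_ ?_
    · rw [hz', mul_neg, neg_mul, mul_add, add_mul, g]
    · simp only [mul_add, mul_smul_comm, ox, oy]; module
    · simp only [add_mul, smul_mul_assoc, ox', oy']; module
  have o1 := odd a c e2 e1 e3 e4 hac
  have o2 := odd c a e3 e4 e2 e1 hca
  have s : a - b + (c - b) = 0 := by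
    rw [hd] at o1 o2
    linear_combination (norm := module) o1 + o2
  have t : (d - l) • (a - c) = 0 := by linear_combination (norm := module) o1 - o2
  have t' : a = c := sub_eq_zero.1 ((smul_eq_zero.1 t).resolve_left h.sub_ne)
  subst t'
  exact ha.mul_self_ne hac

theorem sub_odd (h : AxialPair l d) (ha : PAx l d a) (hb : PAx l d b) (hab : a * b ≠ 0) :
    a * (b - a) = l • (b - a) ∧ (b - a) * a = d • (b - a) := by
  rw [mul_sub, sub_mul, ha.mul_eq h hb hab, hb.mul_eq h ha (hb.mul_ne_zero_comm h hab), ha.idem,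
    h.d_eq]
  constructor <;> module

/-- By transitivity `bc ≠ 0` as well, so all four products are those of `U_E(l)` and the
coefficients cancel. -/
theorem sub_mul_sub (h : AxialPair l d) (ha : PAx l d a) (hb : PAx l d b) (hc : PAx l d c)
    (hab : a * b ≠ 0) (hac : a * c ≠ 0) : (b - a) * (c - a) = 0 := by
  have hba := hb.mul_ne_zero_comm h hab
  rw [mul_sub, sub_mul, sub_mul, hb.mul_eq h hc (hb.mul_ne_zero_trans h ha hc hba hac),
    ha.mul_eq h hc hac, hb.mul_eq h ha hba, ha.idem, h.d_eq]
  module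

theorem oddPart_of_ne (h : AxialPair l d) (ha : PAx l d a) (hb : PAx l d b) (hab : a * b ≠ 0) :
    oddPart l d a b = b - a := by
  obtain ⟨h1, h2⟩ := ha.sub_odd h hb hab
  have : oddPart l d a (b - a) = b - a := oddPart_of_odd h h1 h2
  rwa [map_sub, oddPart_of_even rfl, sub_zero] at this

theorem oddPart_of_mul_eq_zero (h : AxialPair l d) (ha : PAx l d a) (hab : a * b = 0) :
    oddPart l d a b = 0 :=
  oddPart_of_even (by rw [hab, ha.mul_eq_zero_comm h hab])

end PAx

/-! ### Two primitive axes of opposite types -/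

/-- The common odd part `z` of two primitive axes of opposite types. -/
def cross (a b : A) : A := a * b + b * a

namespace PAx

variable {l d : F} {a b a' b' : A}

/-- The combination `d (ab) - l (ba)` equals `d - l` times the component of `b` in `F a`, and also
`d - l` times the component of `a` in `F b`. If this were nonzero, `a` and `b` would be proportional
idempotents, hence equal. So both coefficients are zero and only the odd parts enter the products.
-/
theorem cross_spec (h : AxialPair l d) (ha : PAx l d a) (hb : PAx d l b) (hab : a ≠ b) :
    a * b = l • cross a b ∧ b * a = d • cross a b ∧ oddPart l d a b = cross a b ∧
      oddPart d l b a = cross a b := by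
  obtain ⟨x, v, hy, h1, h3, e1, e2⟩ := ha.mul_coeff h b
  obtain ⟨y, v', hy', h1', h3', e1', e2'⟩ := hb.mul_coeff h.symm a
  set w := oddPart l d a b
  set w' := oddPart d l b a
  have g : (d - l) • (x • a - y • b) = 0 := by
    linear_combination (norm := module) d • e2' - l • e1' - d • e1 + l • e2
  have g' : x • a = y • b := sub_eq_zero.1 ((smul_eq_zero.1 g).resolve_left h.sub_ne)
  have hx : x = 0 := by
    by_contra hx
    apply hab
    have ea : a = (x⁻¹ * y) • b := by
      rw [mul_smul, ← g', smul_smul, inv_mul_cancel₀ hx, one_smul]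
    set c := x⁻¹ * y
    have : a * a = c • a := by
      nth_rw 1 [ea]; nth_rw 1 [ea]
      rw [smul_mul_assoc, mul_smul_comm, hb.idem, ← ea]
    rw [ha.idem] at this
    have h5 : (1 - c) • a = 0 := by linear_combination (norm := module) this
    have h6 : c = 1 := (sub_eq_zero.1 ((smul_eq_zero.1 h5).resolve_right ha.ne)).symm
    rw [ea, h6, one_smul]
  have hy0 : y = 0 := by
    rw [hx, zero_smul] at g'
    exact (smul_eq_zero.1 g'.symm).resolve_right hb.ne
  subst hx hy0
  rw [zero_smul, zero_add] at e1 e2 e1' e2'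
  have hw : w = cross a b := by
    rw [cross, e1, e2, h.d_eq]; module
  have hw' : w' = cross a b := by
    rw [cross, e1', e2', h.d_eq]; module
  exact ⟨by rw [← hw, e1], by rw [← hw, e2], hw, hw'⟩

variable (h : AxialPair l d) (ha : PAx l d a) (hb : PAx d l b) (hab : a ≠ b)

include h ha hb hab

theorem mul_cross : a * cross a b = l • cross a b ∧ cross a b * a = d • cross a b := by
  rw [← (ha.cross_spec h hb hab).2.2.1]
  exact ⟨ha.mul_oddPart h b, ha.oddPart_mul h b⟩

theorem tau_cross : hb.tau h.symm a = a - (2 : F) • cross a b := by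
  rw [tau_apply, (ha.cross_spec h hb hab).2.2.2]

theorem pAx_sub_cross : PAx l d (a - (2 : F) • cross a b) := by
  rw [← ha.tau_cross h hb hab]
  exact ha.map _ (hb.tau_mul h.symm)

/-- The reflection of `a` in `b` stays in the class of `a`: the product has coefficient `1` at `a`.
This is the bridge from opposite types to the equivalence relation on axes of one type. -/
theorem mul_sub_cross_ne : a * (a - (2 : F) • cross a b) ≠ 0 := by
  intro h0
  have h1 := ha.mul_cross h hb hab
  rw [mul_sub, mul_smul_comm, h1.1, ha.idem] at h0
  have : (1 : F) • a + 0 + (-2 * l) • cross a b = 0 := by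
    linear_combination (norm := module) h0
  exact one_ne_zero (ha.indep h (by simp) (by rw [mul_smul_comm, h1.1, smul_comm]) this).1

/-- Both `a` and its reflection are in the class of `a'`. Subtracting the formulas for their
products with `a'` leaves twice the product with `cross a b`; this is the first place where
characteristic `2` is excluded. -/
theorem cross_odd (ha' : PAx l d a') (haa : a * a' ≠ 0) :
    a' * cross a b = l • cross a b ∧ cross a b * a' = d • cross a b := by
  have hc := ha.pAx_sub_cross h hb hab
  have hac := ha.mul_sub_cross_ne h hb hab
  have ha'c := ha'.mul_ne_zero_trans h ha hc (ha'.mul_ne_zero_comm h haa) hac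
  have e1 := ha'.mul_eq h hc ha'c
  have e2 := hc.mul_eq h ha' (hc.mul_ne_zero_comm h ha'c)
  rw [mul_sub, ha'.mul_eq h ha (ha'.mul_ne_zero_comm h haa)] at e1
  rw [sub_mul, ha.mul_eq h ha' haa] at e2
  rw [mul_smul_comm] at e1
  rw [smul_mul_assoc] at e2
  constructor
  · have : (2 : F) • (a' * cross a b - l • cross a b) = 0 := by
      linear_combination (norm := module) -e1
    exact sub_eq_zero.1 ((smul_eq_zero.1 this).resolve_left h.two)
  · have : (2 : F) • (cross a b * a' - d • cross a b) = 0 := by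
      linear_combination (norm := module) -e2
    exact sub_eq_zero.1 ((smul_eq_zero.1 this).resolve_left h.two)

/-- By transitivity `a'` annihilates the reflection of `a` together with `a`, hence also their
difference. -/
theorem cross_even (ha' : PAx l d a') (haa : a * a' = 0) :
    a' * cross a b = 0 ∧ cross a b * a' = 0 := by
  have hc := ha.pAx_sub_cross h hb hab
  have hac := ha.mul_sub_cross_ne h hb hab
  have hca' : (a - (2 : F) • cross a b) * a' = 0 := by
    by_contra h0
    exact ha.mul_ne_zero_trans h hc ha' hac h0 haa
  have : (2 : F) • (cross a b * a') = 0 := by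
    rw [sub_mul, haa, smul_mul_assoc] at hca'
    linear_combination (norm := module) -hca'
  have h1 := (smul_eq_zero.1 this).resolve_left h.two
  exact ⟨ha'.left_of_right_zero h h1, h1⟩

/-- The action of an axis on `cross a' b'` depends only on the class of the axis. So `a` and its
reflection in `b` act alike, and their difference `2 cross a b` acts as zero. -/
theorem cross_mul_cross (ha' : PAx l d a') (hb' : PAx d l b') (hab' : a' ≠ b') :
    cross a b * cross a' b' = 0 := by
  have hc := ha.pAx_sub_cross h hb hab
  have hac := ha.mul_sub_cross_ne h hb hab
  have key : a * cross a' b' = (a - (2 : F) • cross a b) * cross a' b' := by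
    by_cases haa : a' * a = 0
    · rw [(ha'.cross_even h hb' hab' ha haa).1]
      refine ((ha'.cross_even h hb' hab' hc ?_).1).symm
      by_contra h0
      exact ha'.mul_ne_zero_trans h hc ha h0 (hc.mul_ne_zero_comm h hac) haa
    · rw [(ha'.cross_odd h hb' hab' ha haa).1,
        (ha'.cross_odd h hb' hab' hc (ha'.mul_ne_zero_trans h ha hc haa hac)).1]
  have : (2 : F) • (cross a b * cross a' b') = 0 := by
    rw [sub_mul, smul_mul_assoc] at key
    linear_combination (norm := module) key
  exact (smul_eq_zero.1 this).resolve_left h.two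

end PAx

end Pairs

/-! ### Spanning by axes, odd spaces as difference spaces, and derivations -/

section Spanning

variable {F : Type*} {A : Type*} [Field F] [NonUnitalNonAssocRing A] [Module F A]
  [IsScalarTower F A A] [SMulCommClass F A A]

theorem mul_mem_of_mem_span {S T : Set A} {P : Submodule F A}
    (hP : ∀ x ∈ S, ∀ y ∈ T, x * y ∈ P) {u v : A} (hu : u ∈ Submodule.span F S)
    (hv : v ∈ Submodule.span F T) : u * v ∈ P :=
  LinearMap.BilinMap.apply_apply_mem_of_mem_span P S T (LinearMap.mul F A) hP u v hu hv

theorem mul_eq_zero_of_mem_span {S T : Set A} (hP : ∀ x ∈ S, ∀ y ∈ T, x * y = 0) {u v : A}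
    (hu : u ∈ Submodule.span F S) (hv : v ∈ Submodule.span F T) : u * v = 0 := by
  rw [← Submodule.mem_bot (R := F)]
  exact mul_mem_of_mem_span (fun x hx y hy => (Submodule.mem_bot F).2 (hP x hx y hy)) hu hv

theorem adjoin_le_of_mul_mem {S : Set A} {P : Submodule F A} (hS : S ⊆ P)
    (hP : ∀ x ∈ P, ∀ y ∈ P, x * y ∈ P) :
    (NonUnitalAlgebra.adjoin F S).toSubmodule ≤ P := by
  have : NonUnitalAlgebra.adjoin F S ≤ P.toNonUnitalSubalgebra fun x y hx hy => hP x hx y hy :=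
    NonUnitalAlgebra.adjoin_le hS
  exact fun x hx => this hx

theorem adjoin_toSubmodule_eq_span {S : Set A}
    (hS : ∀ x ∈ S, ∀ y ∈ S, x * y ∈ Submodule.span F S) :
    (NonUnitalAlgebra.adjoin F S).toSubmodule = Submodule.span F S := by
  apply le_antisymm
  · exact adjoin_le_of_mul_mem Submodule.subset_span fun x hx y hy => mul_mem_of_mem_span hS hx hy
  · exact Submodule.span_le.2 (NonUnitalAlgebra.subset_adjoin F)

/-- The primitive axes of type `(l, d)`, and those of type `(d, l)` that are not of type
`(l, d)`. -/
def axesOf (l d : F) : Set A := {y | PAx l d y} ∪ {y | PAx d l y ∧ ¬ PAx l d y}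

theorem mem_axesOf {l d : F} {y : A} (hy : PAx l d y ∨ PAx d l y) : y ∈ axesOf l d := by
  by_cases h : PAx l d y
  · exact Or.inl h
  · exact Or.inr ⟨hy.resolve_left h, h⟩

/-- Products of axes of opposite types are differences of axes. -/
theorem PAx.mul_eq_of_opposite {l d : F} (h : AxialPair l d) {a b : A} (ha : PAx l d a)
    (hb : PAx d l b) (hab : a ≠ b) :
    a * b = (l / 2) • (a - (a - (2 : F) • cross a b)) ∧
    b * a = (d / 2) • (a - (a - (2 : F) • cross a b)) := by
  obtain ⟨e1, e2, -, -⟩ := ha.cross_spec h hb hab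
  rw [e1, e2, sub_sub_cancel, smul_smul, smul_smul, div_mul_cancel₀ _ h.two,
    div_mul_cancel₀ _ h.two]
  exact ⟨rfl, rfl⟩

/-- Closure under reflecting the axes of type `(l, d)` is enough, because products of opposite axes
in either order are multiples of `a` minus its reflection. The case of a subset `E` is needed for
the axes annihilating a given set. -/
theorem mul_mem_span_of_subset_axesOf {l d : F} (h : AxialPair l d) {E : Set A}
    (hE : E ⊆ axesOf l d)
    (hc : ∀ a ∈ E, ∀ b ∈ E, PAx l d a → PAx d l b → a ≠ b → a - (2 : F) • cross a b ∈ E) :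
    ∀ x ∈ E, ∀ y ∈ E, x * y ∈ Submodule.span F E := by
  have same : ∀ {l d : F}, AxialPair l d → ∀ x ∈ E, ∀ y ∈ E, PAx l d x → PAx l d y →
      x * y ∈ Submodule.span F E := by
    intro l d h x hx y hy px py
    rcases px.mul_cases h py with h1 | h1
    · rw [h1.1]; exact Submodule.zero_mem _
    · rw [h1.1]
      exact Submodule.add_mem _ (Submodule.smul_mem _ _ (Submodule.subset_span hx))
        (Submodule.smul_mem _ _ (Submodule.subset_span hy))
  intro x hx y hy
  rcases hE hx with px | ⟨px, px'⟩ <;> rcases hE hy with py | ⟨py, py'⟩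
  · exact same h x hx y hy px py
  · have hne : x ≠ y := fun e => py' (e ▸ px)
    rw [(px.mul_eq_of_opposite h py hne).1]
    exact Submodule.smul_mem _ _ (Submodule.sub_mem _ (Submodule.subset_span hx)
      (Submodule.subset_span (hc x hx y hy px py hne)))
  · have hne : y ≠ x := fun e => px' (e ▸ py)
    rw [(py.mul_eq_of_opposite h px hne).2]
    exact Submodule.smul_mem _ _ (Submodule.sub_mem _ (Submodule.subset_span hy)
      (Submodule.subset_span (hc y hy x hx py px hne)))
  · exact same h.symm x hx y hy px py

theorem span_axesOf_eq_top {l d : F} (h : AxialPair l d) {X : Set A}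
    (hX : ∀ x ∈ X, PAx l d x ∨ PAx d l x) (hgen : NonUnitalAlgebra.adjoin F X = ⊤) :
    Submodule.span F (axesOf l d : Set A) = ⊤ := by
  rw [eq_top_iff]
  have := mul_mem_span_of_subset_axesOf h (E := (axesOf l d : Set A)) subset_rfl
    fun a _ b _ pa pb hab => Or.inl (pa.pAx_sub_cross h pb hab)
  rw [← adjoin_toSubmodule_eq_span this]
  intro u _
  have hu : u ∈ NonUnitalAlgebra.adjoin F X := by rw [hgen]; trivial
  exact NonUnitalAlgebra.adjoin_mono (fun x hx => mem_axesOf (hX x hx)) hu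

/-- The span of all differences `y - a`, for `y` a primitive axis with `a * y ≠ 0` of the
type of `a`. -/
def classDiff (l d : F) (a : A) : Submodule F A :=
  Submodule.span F {m | ∃ y, PAx l d y ∧ a * y ≠ 0 ∧ m = y - a}

namespace PAx

variable {l d : F} {a b : A}

theorem sub_mem_classDiff (hb : PAx l d b) (hab : a * b ≠ 0) : b - a ∈ classDiff l d a :=
  Submodule.subset_span ⟨b, hb, hab, rfl⟩

theorem classDiff_eq (h : AxialPair l d) (ha : PAx l d a) (hb : PAx l d b) (hab : a * b ≠ 0) :
    classDiff l d a = classDiff l d b := by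
  have key : ∀ a b : A, PAx l d a → PAx l d b → a * b ≠ 0 →
      classDiff l d a ≤ classDiff l d b := by
    intro a b ha hb hab
    refine Submodule.span_le.2 ?_
    rintro _ ⟨y, hy, hay, rfl⟩
    have hba := hb.mul_ne_zero_comm h hab
    have : y - a = (y - b) - (a - b) := by abel
    rw [this]
    exact Submodule.sub_mem _ (hy.sub_mem_classDiff (hb.mul_ne_zero_trans h ha hy hba hay))
      (ha.sub_mem_classDiff hba)
  exact le_antisymm (key a b ha hb hab) (key b a hb ha (hb.mul_ne_zero_comm h hab))

theorem mul_eq_zero_of_mem_classDiff (h : AxialPair l d) (ha : PAx l d a) {m n : A}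
    (hm : m ∈ classDiff l d a) (hn : n ∈ classDiff l d a) : m * n = 0 := by
  refine mul_eq_zero_of_mem_span ?_ hm hn
  rintro _ ⟨y, hy, hay, rfl⟩ _ ⟨z, hz, haz, rfl⟩
  exact ha.sub_mul_sub h hy hz hay haz

theorem cross_mem_classDiff (h : AxialPair l d) (ha : PAx l d a) (hb : PAx d l b) (hab : a ≠ b) :
    cross a b ∈ classDiff l d a := by
  have h1 := (ha.pAx_sub_cross h hb hab).sub_mem_classDiff (ha.mul_sub_cross_ne h hb hab)
  have : cross a b = (-(2 : F)⁻¹) • (a - (2 : F) • cross a b - a) := by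
    have h2 := h.two
    match_scalars <;> field_simp
    ring
  rw [this]
  exact Submodule.smul_mem _ _ h1

theorem classDiff_le_eig (h : AxialPair l d) (ha : PAx l d a) :
    classDiff l d a ≤ eig F l d a := by
  refine Submodule.span_le.2 ?_
  rintro _ ⟨y, hy, hay, rfl⟩
  exact mem_eig.2 (ha.sub_odd h hy hay)

theorem oddPart_mem_classDiff_of_axis (h : AxialPair l d) (ha : PAx l d a) {y : A}
    (hy : PAx l d y ∨ PAx d l y) : oddPart l d a y ∈ classDiff l d a := by
  rcases hy with hy | hy
  · by_cases h0 : a * y = 0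
    · rw [ha.oddPart_of_mul_eq_zero h h0]; exact Submodule.zero_mem _
    · rw [ha.oddPart_of_ne h hy h0]; exact hy.sub_mem_classDiff h0
  · by_cases hay : a = y
    · rw [← hay, oddPart_of_even rfl]; exact Submodule.zero_mem _
    · rw [(ha.cross_spec h hy hay).2.2.1]
      exact ha.cross_mem_classDiff h hy hay

theorem oddPart_mem_classDiff (h : AxialPair l d) (ha : PAx l d a)
    (hspan : Submodule.span F (axesOf l d : Set A) = ⊤) (u : A) :
    oddPart l d a u ∈ classDiff l d a := by
  have hu : u ∈ Submodule.span F (axesOf l d : Set A) := by rw [hspan]; trivial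
  have : Submodule.span F (axesOf l d : Set A) ≤ (classDiff l d a).comap (oddPart l d a) := by
    refine Submodule.span_le.2 ?_
    rintro y (hy | hy)
    · exact ha.oddPart_mem_classDiff_of_axis h (Or.inl hy)
    · exact ha.oddPart_mem_classDiff_of_axis h (Or.inr hy.1)
  exact this hu

theorem eig_eq_classDiff (h : AxialPair l d) (ha : PAx l d a)
    (hspan : Submodule.span F (axesOf l d : Set A) = ⊤) :
    eig F l d a = classDiff l d a := by
  refine le_antisymm ?_ (ha.classDiff_le_eig h)
  intro w hw
  rw [mem_eig] at hw
  rw [← oddPart_of_odd h hw.1 hw.2]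
  exact ha.oddPart_mem_classDiff h hspan w

/-- For primitive axes `a`, `b` of the same type with nonzero product, the difference of the
odd projections is a derivation. -/
theorem oddPart_sub_derivation (h : AxialPair l d) (ha : PAx l d a) (hb : PAx l d b)
    (hspan : Submodule.span F (axesOf l d : Set A) = ⊤) (hab : a * b ≠ 0) (p q : A) :
    oddPart l d a (p * q) - oddPart l d b (p * q) =
      (oddPart l d a p - oddPart l d b p) * q + p * (oddPart l d a q - oddPart l d b q) := by
  have hcd := ha.classDiff_eq h hb hab
  -- The two odd spaces coincide, so the odd projection of `a` fixes that of `b` and the quadratic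
  -- term collapses.
  have t : ∀ p, ha.tau h (hb.tau h p) = p - (2 : F) • (oddPart l d a p - oddPart l d b p) := by
    intro p
    rw [tau_apply, tau_apply, map_sub, map_smul]
    have h1 : oddPart l d b p ∈ eig F l d a := by
      rw [ha.eig_eq_classDiff h hspan, hcd]
      exact hb.oddPart_mem_classDiff h hspan p
    rw [mem_eig] at h1
    rw [oddPart_of_odd h h1.1 h1.2]
    module
  have t1 := t (p * q)
  rw [tau_mul, tau_mul, t, t] at t1
  -- Both factors lie in one difference space, which multiplies to zero. Without this term,
  -- multiplicativity of the automorphism becomes the Leibniz rule.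
  have hz : (oddPart l d a p - oddPart l d b p) * (oddPart l d a q - oddPart l d b q) = 0 := by
    have mem : ∀ p, oddPart l d a p - oddPart l d b p ∈ classDiff l d a := fun p =>
      Submodule.sub_mem _ (ha.oddPart_mem_classDiff h hspan p)
        (hcd ▸ hb.oddPart_mem_classDiff h hspan p)
    exact ha.mul_eq_zero_of_mem_classDiff h (mem p) (mem q)
  set P := oddPart l d a p - oddPart l d b p
  set Q := oddPart l d a q - oddPart l d b q
  set R := oddPart l d a (p * q) - oddPart l d b (p * q)
  simp only [sub_mul, mul_sub, smul_mul_assoc, mul_smul_comm, hz, smul_zero, sub_zero] at t1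
  have : (2 : F) • (R - (P * q + p * Q)) = 0 := by
    linear_combination (norm := module) t1
  exact sub_eq_zero.1 ((smul_eq_zero.1 this).resolve_left h.two)

/-- For `m = y - a` the derivation is the difference of the odd projections of `a` and `y`. All four
properties are preserved by linear combinations, so sums of differences need no further
construction. -/
theorem exists_derivation (h : AxialPair l d) (ha : PAx l d a)
    (hspan : Submodule.span F (axesOf l d : Set A) = ⊤) {m : A} (hm : m ∈ classDiff l d a) :
    ∃ N : A →ₗ[F] A, N a = m ∧ (∀ p, N p ∈ classDiff l d a) ∧ (∀ w ∈ classDiff l d a, N w = 0) ∧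
      ∀ p q, N (p * q) = N p * q + p * N q := by
  refine Submodule.span_induction ?_ ?_ ?_ ?_ hm
  · rintro _ ⟨y, hy, hay, rfl⟩
    have hcd := ha.classDiff_eq h hy hay
    refine ⟨oddPart l d a - oddPart l d y, ?_, ?_, ?_, ?_⟩
    · rw [LinearMap.sub_apply, oddPart_of_even rfl,
        hy.oddPart_of_ne h ha (hy.mul_ne_zero_comm h hay)]
      abel
    · intro p
      exact Submodule.sub_mem _ (ha.oddPart_mem_classDiff h hspan p)
        (hcd ▸ hy.oddPart_mem_classDiff h hspan p)
    · intro w hw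
      have h1 := mem_eig.1 (ha.classDiff_le_eig h hw)
      have h2 := mem_eig.1 (hy.classDiff_le_eig h (hcd ▸ hw))
      rw [LinearMap.sub_apply, oddPart_of_odd h h1.1 h1.2, oddPart_of_odd h h2.1 h2.2, sub_self]
    · exact ha.oddPart_sub_derivation h hy hspan hay
  · exact ⟨0, by simp, by simp, by simp, by simp⟩
  · rintro x y - - ⟨N, h1, h2, h3, h4⟩ ⟨N', h1', h2', h3', h4'⟩
    refine ⟨N + N', by simp [h1, h1'], fun p => Submodule.add_mem _ (h2 p) (h2' p), ?_, ?_⟩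
    · intro w hw; simp [h3 w hw, h3' w hw]
    · intro p q; simp only [LinearMap.add_apply, h4, h4', add_mul, mul_add]; abel
  · rintro c x - ⟨N, h1, h2, h3, h4⟩
    refine ⟨c • N, by simp [h1], fun p => Submodule.smul_mem _ _ (h2 p), ?_, ?_⟩
    · intro w hw; simp [h3 w hw]
    · intro p q; simp only [LinearMap.smul_apply, h4, smul_mul_assoc, mul_smul_comm, smul_add]

/-- The primitive axes in the class of `a` form an affine space. -/
theorem add_mem_classDiff (h : AxialPair l d) (ha : PAx l d a)
    (hspan : Submodule.span F (axesOf l d : Set A) = ⊤) {m : A} (hm : m ∈ classDiff l d a) :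
    PAx l d (a + m) := by
  obtain ⟨N, h1, h2, h3, h4⟩ := ha.exists_derivation h hspan hm
  have hNN : ∀ p, N (N p) = 0 := fun p => h3 _ (h2 p)
  -- This is `exp N`, as `N² = 0`. It is multiplicative because `N` is a derivation whose values
  -- multiply to zero, and it sends `a` to `a + m`.
  let e : A ≃ₗ[F] A := LinearEquiv.ofLinearMap (LinearMap.id + N) (LinearMap.id - N)
    (by ext p; simp [hNN]) (by ext p; simp [hNN])
  have he : ∀ p, e p = p + N p := fun p => rfl
  have := ha.map e (fun p q => by
    rw [he, he, he, h4, add_mul, mul_add, mul_add,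
      ha.mul_eq_zero_of_mem_classDiff h (h2 p) (h2 q)]
    abel)
  rwa [he, h1] at this

theorem mul_add_ne_zero (h : AxialPair l d) (ha : PAx l d a) {m : A}
    (hm : m ∈ classDiff l d a) : a * (a + m) ≠ 0 := by
  have h1 := mem_eig.1 (ha.classDiff_le_eig h hm)
  intro h0
  rw [mul_add, ha.idem, h1.1] at h0
  have : (1 : F) • a + 0 + l • m = 0 := by linear_combination (norm := module) h0
  exact one_ne_zero (ha.indep h (by simp) (by rw [mul_smul_comm, h1.1]) this).1

theorem exists_smul_add_classDiff {u : A}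
    (hu : u ∈ Submodule.span F {y | PAx l d y ∧ a * y ≠ 0}) :
    ∃ k : F, ∃ m ∈ classDiff l d a, u = k • a + m := by
  refine Submodule.span_induction ?_ ?_ ?_ ?_ hu
  · rintro y ⟨hy, hay⟩
    exact ⟨1, _, hy.sub_mem_classDiff hay, by module⟩
  · exact ⟨0, 0, Submodule.zero_mem _, by simp⟩
  · rintro _ _ - - ⟨k, m, hm, rfl⟩ ⟨k', m', hm', rfl⟩
    exact ⟨k + k', _, Submodule.add_mem _ hm hm', by module⟩
  · rintro c _ - ⟨k, m, hm, rfl⟩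
    exact ⟨c * k, _, Submodule.smul_mem _ c hm, by module⟩

/-- Writing `c = k a + m` with `m` in the difference space gives `c² = k c`, so `k = 1`. -/
theorem idempotent_in_class (h : AxialPair l d) (ha : PAx l d a) {c : A}
    (hc : c ∈ Submodule.span F {y | PAx l d y ∧ a * y ≠ 0}) (hc0 : c ≠ 0) (hcc : c * c = c) :
    c - a ∈ classDiff l d a := by
  obtain ⟨k, m, hm, rfl⟩ := exists_smul_add_classDiff hc
  have h1 := mem_eig.1 (ha.classDiff_le_eig h hm)
  have hmm := ha.mul_eq_zero_of_mem_classDiff h hm hm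
  have e : (k * k) • a + k • m = k • a + m := by
    rw [← hcc]
    simp only [mul_add, add_mul, smul_mul_assoc, mul_smul_comm, ha.idem, h1.1, h1.2, hmm, h.d_eq]
    module
  have e' : (k - 1) • (k • a + m) = 0 := by linear_combination (norm := module) e
  have hk : k = 1 := sub_eq_zero.1 ((smul_eq_zero.1 e').resolve_right hc0)
  rw [hk, one_smul, add_sub_cancel_left]
  exact hm

theorem of_idempotent_in_class (h : AxialPair l d) (ha : PAx l d a)
    (hspan : Submodule.span F (axesOf l d : Set A) = ⊤) {c : A}
    (hc : c ∈ Submodule.span F {y | PAx l d y ∧ a * y ≠ 0}) (hc0 : c ≠ 0) (hcc : c * c = c) :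
    PAx l d c ∧ a * c ≠ 0 := by
  have hm := ha.idempotent_in_class h hc hc0 hcc
  have h1 := ha.add_mem_classDiff h hspan hm
  have h2 := ha.mul_add_ne_zero h hm
  rw [add_sub_cancel] at h1 h2
  exact ⟨h1, h2⟩

/-! ### The character of a primitive axis -/

theorem exists_coeff (h : AxialPair l d) (ha : PAx l d a) :
    ∃ f : A →ₗ[F] F, ∀ (k : F) (v w : A), a * v = 0 → a * w = l • w →
      f (k • a + v + w) = k := by
  -- The operator `d L_a - l R_a` kills the odd and the null part, and multiplies `a` by `d - l`.
  have hr : ∀ y, (d - l)⁻¹ • (d • (a * y) - l • (y * a)) ∈ Submodule.span F {a} := by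
    intro y
    obtain ⟨k, v, hy, h1, h3, e1, e2⟩ := ha.mul_coeff h y
    rw [Submodule.mem_span_singleton]
    refine ⟨k, ?_⟩
    rw [e1, e2]
    have : d • (k • a + l • oddPart l d a y) - l • (k • a + d • oddPart l d a y) =
      (d - l) • k • a := by module
    rw [this, smul_smul, inv_mul_cancel₀ h.sub_ne, one_smul]
  let T : A →ₗ[F] Submodule.span F {a} := LinearMap.codRestrict _
    ((d - l)⁻¹ • (d • LinearMap.mulLeft F a - l • LinearMap.mulRight F a))
    (fun y => by simpa using hr y)
  refine ⟨(LinearEquiv.toSpanNonzeroSingleton F A a ha.ne).symm.toLinearMap ∘ₗ T, ?_⟩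
  intro k v w hv hw
  have hv' := ha.right_of_left_zero h hv
  have hw' := ha.right_of_left_odd h hw
  rw [LinearMap.comp_apply, LinearEquiv.coe_coe, LinearEquiv.symm_apply_eq]
  apply Subtype.ext
  change (d - l)⁻¹ • (d • (a * (k • a + v + w)) - l • ((k • a + v + w) * a)) = k • a
  simp only [mul_add, add_mul, mul_smul_comm, smul_mul_assoc, ha.idem, hv, hv', hw, hw']
  have : d • (k • a + 0 + l • w) - l • (k • a + 0 + d • w) = (d - l) • k • a := by module
  rw [this, smul_smul, inv_mul_cancel₀ h.sub_ne, one_smul]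

/-- The projection of `A` to `F a` is a homomorphism of algebras to `F`. -/
theorem exists_character (h : AxialPair l d) (ha : PAx l d a)
    (hspan : Submodule.span F (axesOf l d : Set A) = ⊤) :
    ∃ f : A →ₙₐ[F] F, (∀ v, a * v = 0 → f v = 0) ∧ (∀ y, PAx l d y → a * y ≠ 0 → f y = 1) ∧
      (∀ b, PAx d l b → a ≠ b → f b = 0) ∧ ∀ w, a * w = l • w → f w = 0 := by
  obtain ⟨f, hf⟩ := ha.exists_coeff h
  have f0 : ∀ v, a * v = 0 → f v = 0 := fun v hv => by
    simpa using hf 0 v 0 hv (by simp)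
  have fl : ∀ v, a * v = l • v → f v = 0 := fun v hv => by
    simpa using hf 0 0 v (by simp) hv
  have fa : f a = 1 := by simpa using hf 1 0 0 (by simp) (by simp)
  have f1 : ∀ y, PAx l d y → a * y ≠ 0 → f y = 1 := by
    intro y hy hay
    have := fl _ (ha.sub_odd h hy hay).1
    rw [map_sub, fa] at this
    exact sub_eq_zero.1 this
  have fb : ∀ b, PAx d l b → a ≠ b → f b = 0 := by
    intro b hb hab
    obtain ⟨e1, -, e3, -⟩ := ha.cross_spec h hb hab
    have hz := (ha.mul_cross h hb hab).1
    have : a * (b - cross a b) = 0 := by rw [mul_sub, e1, hz, sub_self]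
    have h1 := f0 _ this
    rw [map_sub, fl _ hz, sub_zero] at h1
    exact h1
  have fo : ∀ b, PAx d l b → ¬ PAx l d b → f b = 0 := fun b hb hb' =>
    fb b hb (fun e => hb' (e ▸ ha))
  -- The values of `f` on axes of type `(l, d)` depend only on the class, and a reflection preserves
  -- the class. Hence `f` vanishes on products of opposite axes, being multiples of `x` minus its
  -- reflection.
  have fc : ∀ x b, PAx l d x → PAx d l b → x ≠ b → f x = f (x - (2 : F) • cross x b) := by
    intro x b hx hb hxb
    have hc := hx.pAx_sub_cross h hb hxb
    have hxc := hx.mul_sub_cross_ne h hb hxb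
    by_cases h0 : a * x = 0
    · rw [f0 _ h0, f0]
      by_contra h1
      exact ha.mul_ne_zero_trans h hc hx h1 (hc.mul_ne_zero_comm h hxc) h0
    · rw [f1 _ hx h0, f1 _ hc (ha.mul_ne_zero_trans h hx hc h0 hxc)]
  have hmul : ∀ x y, f (x * y) = f x * f y := by
    have e : (LinearMap.mul F A).compr₂ f = (LinearMap.mul F F).compl₁₂ f f := by
      refine LinearMap.ext_on hspan fun x hx => LinearMap.ext_on hspan fun y hy => ?_
      simp only [LinearMap.compr₂_apply, LinearMap.mul_apply', LinearMap.compl₁₂_apply]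
      rcases hx with hx | ⟨hx, hx'⟩ <;> rcases hy with hy | ⟨hy, hy'⟩
      · simp only [Set.mem_ofPred_eq] at hx hy
        by_cases h0 : x * y = 0
        · rw [h0, map_zero]
          by_cases h1 : a * x = 0
          · rw [f0 _ h1, zero_mul]
          · rw [f0 y, mul_zero]
            by_contra h2
            exact hx.mul_ne_zero_trans h ha hy (hx.mul_ne_zero_comm h h1) h2 h0
        · rw [hx.mul_eq h hy h0, map_add, map_smul, map_smul]
          by_cases h1 : a * x = 0
          · rw [f0 _ h1, f0 y]
            · simp
            · by_contra h2
              exact ha.mul_ne_zero_trans h hy hx h2 (hy.mul_ne_zero_comm h h0) h1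
          · rw [f1 _ hx h1, f1 _ hy (ha.mul_ne_zero_trans h hx hy h1 h0), h.d_eq]
            simp
      · have hxy : x ≠ y := fun e => hy' (e ▸ hx)
        rw [(hx.mul_eq_of_opposite h hy hxy).1, map_smul, map_sub, ← fc x y hx hy hxy,
          fo y hy hy']
        simp
      · have hxy : y ≠ x := fun e => hx' (e ▸ hy)
        rw [(hy.mul_eq_of_opposite h hx hxy).2, map_smul, map_sub, ← fc y x hy hx hxy,
          fo x hx hx']
        simp
      · rw [fo x hx hx', zero_mul]
        by_cases h0 : x * y = 0
        · rw [h0, map_zero]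
        · rw [hx.mul_eq h.symm hy h0, map_add, map_smul, map_smul, fo x hx hx', fo y hy hy']
          simp
    intro x y
    exact LinearMap.congr_fun₂ e x y
  let g : A →ₙₐ[F] F := { f with
    map_smul' := fun c x => by simp
    map_zero' := map_zero f
    map_mul' := hmul }
  exact ⟨g, f0, f1, fb, fl⟩

end PAx

end Spanning

/-! ### The algebra generated by axes of the two types, and the ideal `Z` -/

section Generated

variable {F : Type*} {A : Type*} [Field F] [NonUnitalNonAssocRing A] [Module F A]
  [IsScalarTower F A A] [SMulCommClass F A A] {l d : F}

theorem exists_finset_of_mem_span_image2 {S T : Set A} {f : A → A → A} {u : A}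
    (hu : u ∈ Submodule.span F (Set.image2 f S T)) :
    ∃ t : Finset A, ↑t ⊆ S ∧ u ∈ Submodule.span F (Set.image2 f t T) := by
  classical
  refine Submodule.span_induction ?_ ?_ ?_ ?_ hu
  · rintro _ ⟨x, hx, y, hy, rfl⟩
    exact ⟨{x}, by simpa using hx, Submodule.subset_span ⟨x, by simp, y, hy, rfl⟩⟩
  · exact ⟨∅, by simp, Submodule.zero_mem _⟩
  · rintro x y - - ⟨t, ht, hx⟩ ⟨t', ht', hy⟩
    refine ⟨t ∪ t', by simp [ht, ht'], Submodule.add_mem _ ?_ ?_⟩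
    · exact Submodule.span_mono (Set.image2_subset (by simp) subset_rfl) hx
    · exact Submodule.span_mono (Set.image2_subset (by simp) subset_rfl) hy
  · rintro c x - ⟨t, ht, hx⟩
    exact ⟨t, ht, Submodule.smul_mem _ c hx⟩

theorem exists_split {S : Set A} (p : A → Prop) {u : A} (hu : u ∈ Submodule.span F S) :
    ∃ u₁ ∈ Submodule.span F {y ∈ S | p y}, ∃ u₂ ∈ Submodule.span F {y ∈ S | ¬ p y},
      u = u₁ + u₂ := by
  have : S = {y ∈ S | p y} ∪ {y ∈ S | ¬ p y} := by
    ext y; by_cases h : p y <;> simp [h]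
  rw [this, Submodule.span_union, Submodule.mem_sup] at hu
  obtain ⟨u₁, h1, u₂, h2, h3⟩ := hu
  exact ⟨u₁, h1, u₂, h2, h3.symm⟩

/-- For `u = k a + m` the commutator with `a` isolates `(d - l) m`, so `m` lies in `Z`, and then so
does `k a`. -/
theorem PAx.mem_of_mul_mem (h : AxialPair l d) {a : A} (ha : PAx l d a) {Z : Submodule F A}
    {u : A} (hu : u ∈ Submodule.span F {y | PAx l d y ∧ a * y ≠ 0}) (h1 : a * u ∈ Z)
    (h2 : u * a ∈ Z) : u ∈ Z := by
  obtain ⟨k, m, hm, rfl⟩ := PAx.exists_smul_add_classDiff hu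
  obtain ⟨e1, e2⟩ := mem_eig.1 (ha.classDiff_le_eig h hm)
  simp only [mul_add, add_mul, mul_smul_comm, smul_mul_assoc, ha.idem, e1, e2] at h1 h2
  have : k • a + m = (k • a + l • m) + (k • a + d • m) - k • a := by
    rw [h.d_eq]; module
  have hmZ : m ∈ Z := by
    have h3 : (d - l) • m ∈ Z := by
      have : (d - l) • m = (k • a + d • m) - (k • a + l • m) := by module
      rw [this]; exact Z.sub_mem h2 h1
    exact (Z.smul_mem_iff h.sub_ne).1 h3
  exact Z.add_mem ((Z.add_mem_iff_left (Z.smul_mem l hmZ)).1 h1) hmZ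

theorem mul_span_eq_zero {a : A} {S : Set A} (hS : ∀ y ∈ S, a * y = 0 ∧ y * a = 0) {u : A}
    (hu : u ∈ Submodule.span F S) : a * u = 0 ∧ u * a = 0 :=
  ⟨mul_eq_zero_of_mem_span (S := {a}) (by rintro _ rfl y hy; exact (hS y hy).1)
    (Submodule.mem_span_singleton_self (R := F) a) hu,
   mul_eq_zero_of_mem_span (T := {a}) (by rintro y hy _ rfl; exact (hS y hy).2)
    hu (Submodule.mem_span_singleton_self (R := F) a)⟩

/-- Induction by removing one class at a time. The part of `u` in the class of a chosen `x` is
tested by `x` alone. Axes outside the class annihilate that part, so the remaining part inherits the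
hypothesis over a smaller set. -/
theorem mem_of_forall_mul_mem_finset (h : AxialPair l d) (Z : Submodule F A) (n : ℕ) :
    ∀ t : Finset A, t.card = n → (∀ x ∈ t, PAx l d x) → ∀ u ∈ Submodule.span F (t : Set A),
      (∀ x ∈ t, x * u ∈ Z ∧ u * x ∈ Z) → u ∈ Z := by
  classical
  induction n using Nat.strong_induction_on with
  | _ n ih =>
    intro t hn ht u hu hZ
    rcases t.eq_empty_or_nonempty with rfl | ⟨x, hx⟩
    · have : u = 0 := by simpa using hu
      rw [this]; exact Z.zero_mem
    · have px := ht x hx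
      obtain ⟨u₁, h1, u₂, h2, rfl⟩ := exists_split (fun y => x * y ≠ 0) hu
      have key : ∀ y ∈ t, x * y = 0 → y * u₁ = 0 ∧ u₁ * y = 0 := by
        intro y hy hxy
        refine mul_span_eq_zero (F := F) (a := y) ?_ h1
        rintro v ⟨hv, hxv⟩
        have h0 : v * y = 0 := by
          by_contra h0
          exact px.mul_ne_zero_trans h (ht v hv) (ht y hy) hxv h0 hxy
        exact ⟨(ht v hv).mul_eq_zero_comm h h0, h0⟩
      have h20 : x * u₂ = 0 ∧ u₂ * x = 0 := by
        refine mul_span_eq_zero (F := F) ?_ h2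
        rintro v ⟨hv, hxv⟩
        have hxv' := not_not.1 hxv
        exact ⟨hxv', px.mul_eq_zero_comm h hxv'⟩
      have h1Z : u₁ ∈ Z := by
        have := hZ x hx
        rw [mul_add, add_mul, h20.1, h20.2, add_zero, add_zero] at this
        refine px.mem_of_mul_mem h ?_ this.1 this.2
        have hsub : {y ∈ (t : Set A) | x * y ≠ 0} ⊆ {y | PAx l d y ∧ x * y ≠ 0} :=
          fun y hy => ⟨ht y hy.1, hy.2⟩
        exact Submodule.span_mono hsub h1
      refine Z.add_mem h1Z ?_
      have hlt : (t.filter fun y => ¬ x * y ≠ 0).card < n := by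
        rw [← hn]
        refine Finset.card_lt_card (Finset.filter_ssubset.2 ⟨x, hx, ?_⟩)
        rw [not_not]; exact px.mul_self_ne
      refine ih _ hlt _ rfl (fun y hy => ht y (Finset.mem_filter.1 hy).1) u₂ ?_ ?_
      · rwa [Finset.coe_filter]
      · intro y hy
        obtain ⟨hy, hxy⟩ := Finset.mem_filter.1 hy
        have e := key y hy (not_not.1 hxy)
        have := hZ y hy
        rwa [mul_add, add_mul, e.1, e.2, zero_add, zero_add] at this

/-- An element of the span of a set `S` of primitive axes of one type is determined, modulo any
subspace, by its products with the elements of `S`. -/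
theorem mem_of_forall_mul_mem (h : AxialPair l d) {Z : Submodule F A} {S : Set A}
    (hS : ∀ x ∈ S, PAx l d x) {u : A} (hu : u ∈ Submodule.span F S)
    (hZ : ∀ x ∈ S, x * u ∈ Z ∧ u * x ∈ Z) : u ∈ Z := by
  obtain ⟨t, ht, hut⟩ := Submodule.mem_span_finite_of_mem_span hu
  exact mem_of_forall_mul_mem_finset h Z _ t rfl (fun x hx => hS x (ht hx)) u hut
    fun x hx => hZ x (ht hx)

/-- Such a `u` is annihilated by every axis of `S`: those outside the class of `a` annihilate the
first span, those inside the second. -/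
theorem span_class_disjoint (h : AxialPair l d) {S : Set A} (hS : ∀ x ∈ S, PAx l d x) {a : A}
    (ha : PAx l d a) {u : A} (h1 : u ∈ Submodule.span F {y ∈ S | a * y ≠ 0})
    (h2 : u ∈ Submodule.span F {y ∈ S | ¬ a * y ≠ 0}) : u = 0 := by
  rw [← Submodule.mem_bot (R := F)]
  refine mem_of_forall_mul_mem h hS (Submodule.span_mono (Set.sep_subset _ _) h1) ?_
  intro x hx
  simp only [Submodule.mem_bot]
  by_cases hax : a * x = 0
  · refine mul_span_eq_zero ?_ h1
    rintro y ⟨hy, hay⟩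
    have : y * x = 0 := by
      by_contra h0
      exact ha.mul_ne_zero_trans h (hS y hy) (hS x hx) hay h0 hax
    exact ⟨(hS y hy).mul_eq_zero_comm h this, this⟩
  · refine mul_span_eq_zero ?_ h2
    rintro y ⟨hy, hay⟩
    have : x * y = 0 := by
      by_contra h0
      exact hay (ha.mul_ne_zero_trans h (hS x hx) (hS y hy) hax h0)
    exact ⟨this, (hS x hx).mul_eq_zero_comm h this⟩

theorem mul_mem_span_of_sameType (h : AxialPair l d) {S : Set A} (hS : ∀ x ∈ S, PAx l d x) :
    ∀ x ∈ S, ∀ y ∈ S, x * y ∈ Submodule.span F S := by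
  intro x hx y hy
  rcases (hS x hx).mul_cases h (hS y hy) with h1 | h1
  · rw [h1.1]; exact Submodule.zero_mem _
  · rw [h1.1]
    exact Submodule.add_mem _ (Submodule.smul_mem _ _ (Submodule.subset_span hx))
      (Submodule.smul_mem _ _ (Submodule.subset_span hy))

theorem adjoin_eq_span_of_sameType (h : AxialPair l d) {S : Set A} (hS : ∀ x ∈ S, PAx l d x) :
    (NonUnitalAlgebra.adjoin F S).toSubmodule = Submodule.span F S :=
  adjoin_toSubmodule_eq_span (mul_mem_span_of_sameType h hS)

theorem cross_comm (a b : A) : cross a b = cross b a := by rw [cross, cross, add_comm]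

/-- The generating sets `X'` of primitive axes of type `(l, d)` and `X''` of primitive axes of
type `(d, l)`. -/
structure AxialGenerators (l d : F) (X' X'' : Set A) : Prop where
  pair : AxialPair l d
  ne : ∀ x ∈ X', ∀ y ∈ X'', x ≠ y
  left : ∀ x ∈ X', PAx l d x
  right : ∀ x ∈ X'', PAx d l x
  gen : NonUnitalAlgebra.adjoin F (X' ∪ X'') = ⊤

namespace AxialGenerators

variable {X' X'' : Set A}

theorem symm (G : AxialGenerators l d X' X'') : AxialGenerators d l X'' X' :=
  ⟨G.pair.symm, fun x hx y hy e => G.ne y hy x hx e.symm, G.right, G.left, by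
    rw [Set.union_comm]; exact G.gen⟩

theorem span_axesOf (G : AxialGenerators l d X' X'') :
    Submodule.span F (axesOf l d : Set A) = ⊤ :=
  span_axesOf_eq_top G.pair (X := X' ∪ X'')
    (fun x hx => hx.elim (fun hx => Or.inl (G.left x hx)) fun hx => Or.inr (G.right x hx)) G.gen

/-- Each product is `l` times the corresponding `cross`, which is symmetric in its arguments. This
makes `Z` independent of the order of the two types. -/
theorem crossSpan_eq (G : AxialGenerators l d X' X'') {S : Set A} (hS : S ⊆ X') :
    crossSpan F S X'' = Submodule.span F (Set.image2 cross S X'') := by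
  apply le_antisymm
  · refine Submodule.span_le.2 ?_
    rintro _ ⟨x, hx, y, hy, rfl⟩
    have := ((G.left x (hS hx)).cross_spec G.pair (G.right y hy) (G.ne x (hS hx) y hy)).1
    change x * y ∈ _
    rw [this]
    exact Submodule.smul_mem _ _ (Submodule.subset_span ⟨x, hx, y, hy, rfl⟩)
  · refine Submodule.span_le.2 ?_
    rintro _ ⟨x, hx, y, hy, rfl⟩
    have := ((G.left x (hS hx)).cross_spec G.pair (G.right y hy) (G.ne x (hS hx) y hy)).1
    change cross x y ∈ _
    refine (Submodule.smul_mem_iff _ G.pair.l0).1 ?_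
    rw [← this]
    exact Submodule.subset_span ⟨x, hx, y, hy, rfl⟩

theorem crossSpan_swap (G : AxialGenerators l d X' X'') :
    crossSpan F X'' X' = crossSpan F X' X'' := by
  rw [G.crossSpan_eq subset_rfl, G.symm.crossSpan_eq subset_rfl, Set.image2_swap]
  congr 1
  exact Set.image2_congr fun a _ b _ => cross_comm b a

theorem cross_mem (G : AxialGenerators l d X' X'') {x y : A} (hx : x ∈ X') (hy : y ∈ X'') :
    cross x y ∈ crossSpan F X' X'' := by
  rw [G.crossSpan_eq subset_rfl]
  exact Submodule.subset_span ⟨x, hx, y, hy, rfl⟩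

theorem mul_mem_crossSpan (G : AxialGenerators l d X' X'') {x y : A} (hx : x ∈ X')
    (hy : y ∈ X'') : x * y ∈ crossSpan F X' X'' ∧ y * x ∈ crossSpan F X' X'' := by
  obtain ⟨e1, e2, -⟩ := (G.left x hx).cross_spec G.pair (G.right y hy) (G.ne x hx y hy)
  rw [e1, e2]
  exact ⟨Submodule.smul_mem _ _ (G.cross_mem hx hy), Submodule.smul_mem _ _ (G.cross_mem hx hy)⟩

theorem crossSpan_le_eig (G : AxialGenerators l d X' X'') {a : A} (ha : PAx l d a) {S : Set A}
    (hS : S ⊆ X') (haS : ∀ x ∈ S, a * x ≠ 0) : crossSpan F S X'' ≤ eig F l d a := by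
  rw [G.crossSpan_eq hS]
  refine Submodule.span_le.2 ?_
  rintro _ ⟨x, hx, y, hy, rfl⟩
  exact mem_eig.2 ((G.left x (hS hx)).cross_odd G.pair (G.right y hy) (G.ne x (hS hx) y hy) ha
    ((G.left x (hS hx)).mul_ne_zero_comm G.pair (haS x hx)))

theorem crossSpan_le_eig0 (G : AxialGenerators l d X' X'') {a : A} (ha : PAx l d a) {S : Set A}
    (hS : S ⊆ X') (haS : ∀ x ∈ S, a * x = 0) : crossSpan F S X'' ≤ eig0 F a := by
  rw [G.crossSpan_eq hS]
  refine Submodule.span_le.2 ?_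
  rintro _ ⟨x, hx, y, hy, rfl⟩
  exact mem_eig0.2 ((G.left x (hS hx)).cross_even G.pair (G.right y hy) (G.ne x (hS hx) y hy) ha
    (ha.mul_eq_zero_comm G.pair (haS x hx)))

theorem exists_crossSpan_split {S : Set A} (p : A → Prop) {z : A}
    (hz : z ∈ crossSpan F S X'') :
    ∃ z₁ ∈ crossSpan F {y ∈ S | p y} X'', ∃ z₂ ∈ crossSpan F {y ∈ S | ¬ p y} X'',
      z = z₁ + z₂ := by
  have : S = {y ∈ S | p y} ∪ {y ∈ S | ¬ p y} := by
    ext y; by_cases h : p y <;> simp [h]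
  rw [this, crossSpan, Set.image2_union_left, Submodule.span_union, Submodule.mem_sup] at hz
  obtain ⟨u₁, h1, u₂, h2, h3⟩ := hz
  exact ⟨u₁, h1, u₂, h2, h3.symm⟩

theorem crossSpan_mono {S T U : Set A} (h : S ⊆ T) : crossSpan F S U ≤ crossSpan F T U :=
  Submodule.span_mono (Set.image2_subset h subset_rfl)

/-- The elements `cross x y` with `x` in the class of `a` are odd for `a`, and the others are
annihilated by `a`. So `Z` is stable under `a` and has no component in `F a`. -/
theorem crossSpan_split (G : AxialGenerators l d X' X'') {a : A} (ha : PAx l d a) {z : A}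
    (hz : z ∈ crossSpan F X' X'') :
    ∃ z₁ ∈ crossSpan F {x ∈ X' | a * x ≠ 0} X'', ∃ z₂ ∈ crossSpan F {x ∈ X' | ¬ a * x ≠ 0} X'',
      z = z₁ + z₂ ∧ z₁ ∈ crossSpan F X' X'' ⊓ eig F l d a ∧
      z₂ ∈ crossSpan F X' X'' ⊓ eig0 F a := by
  obtain ⟨z₁, h1, z₂, h2, e⟩ := exists_crossSpan_split (fun x => a * x ≠ 0) hz
  exact ⟨z₁, h1, z₂, h2, e,
    ⟨crossSpan_mono (Set.sep_subset _ _) h1,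
      G.crossSpan_le_eig ha (Set.sep_subset _ _) (fun x hx => hx.2) h1⟩,
    ⟨crossSpan_mono (Set.sep_subset _ _) h2,
      G.crossSpan_le_eig0 ha (Set.sep_subset _ _) (fun x hx => not_not.1 hx.2) h2⟩⟩

theorem axis_mul_crossSpan (G : AxialGenerators l d X' X'') {a : A} (ha : PAx l d a) {z : A}
    (hz : z ∈ crossSpan F X' X'') :
    a * z ∈ crossSpan F X' X'' ∧ z * a ∈ crossSpan F X' X'' := by
  obtain ⟨z₁, -, z₂, -, rfl, h1, h2⟩ := G.crossSpan_split ha hz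
  have e1 := mem_eig.1 h1.2
  have e2 := mem_eig0.1 h2.2
  rw [mul_add, add_mul, e1.1, e1.2, e2.1, e2.2, add_zero, add_zero]
  exact ⟨Submodule.smul_mem _ _ h1.1, Submodule.smul_mem _ _ h1.1⟩

theorem cross_mul_crossSpan (G : AxialGenerators l d X' X'') {a b z : A} (ha : PAx l d a)
    (hb : PAx d l b) (hab : a ≠ b) (hz : z ∈ crossSpan F X' X'') :
    cross a b * z = 0 ∧ z * cross a b = 0 := by
  rw [G.crossSpan_eq subset_rfl] at hz
  refine mul_span_eq_zero ?_ hz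
  rintro _ ⟨x, hx, y, hy, rfl⟩
  exact ⟨ha.cross_mul_cross G.pair hb hab (G.left x hx) (G.right y hy) (G.ne x hx y hy),
    (G.left x hx).cross_mul_cross G.pair (G.right y hy) (G.ne x hx y hy) ha hb hab⟩

theorem crossSpan_mul_crossSpan (G : AxialGenerators l d X' X'') {z w : A}
    (hz : z ∈ crossSpan F X' X'') (hw : w ∈ crossSpan F X' X'') : z * w = 0 := by
  rw [G.crossSpan_eq subset_rfl] at hz
  refine (mul_span_eq_zero ?_ hz).2
  rintro _ ⟨x, hx, y, hy, rfl⟩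
  exact (G.cross_mul_crossSpan (G.left x hx) (G.right y hy) (G.ne x hx y hy) hw).symm

theorem span_mul_crossSpan (G : AxialGenerators l d X' X'') {u z : A}
    (hu : u ∈ Submodule.span F X') (hz : z ∈ crossSpan F X' X'') :
    u * z ∈ crossSpan F X' X'' ∧ z * u ∈ crossSpan F X' X'' := by
  have hz' : z ∈ Submodule.span F {z} := Submodule.mem_span_singleton_self z
  constructor
  · refine mul_mem_of_mem_span ?_ hu hz'
    rintro x hx _ rfl
    exact (G.axis_mul_crossSpan (G.left x hx) hz).1
  · refine mul_mem_of_mem_span ?_ hz' hu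
    rintro _ rfl x hx
    exact (G.axis_mul_crossSpan (G.left x hx) hz).2

theorem span_mul_crossSpan' (G : AxialGenerators l d X' X'') {u z : A}
    (hu : u ∈ Submodule.span F X'') (hz : z ∈ crossSpan F X' X'') :
    u * z ∈ crossSpan F X' X'' ∧ z * u ∈ crossSpan F X' X'' := by
  rw [← G.crossSpan_swap] at *
  exact G.symm.span_mul_crossSpan hu hz

theorem span_mul_span (G : AxialGenerators l d X' X'') {u v : A}
    (hu : u ∈ Submodule.span F X') (hv : v ∈ Submodule.span F X'') :
    u * v ∈ crossSpan F X' X'' ∧ v * u ∈ crossSpan F X' X'' :=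
  ⟨mul_mem_of_mem_span (fun _ hx _ hy => (G.mul_mem_crossSpan hx hy).1) hu hv,
    mul_mem_of_mem_span (fun _ hy _ hx => (G.mul_mem_crossSpan hx hy).2) hv hu⟩

theorem left_mul_mem (G : AxialGenerators l d X' X'') {u v : A}
    (hu : u ∈ Submodule.span F X') (hv : v ∈ Submodule.span F X') :
    u * v ∈ Submodule.span F X' :=
  mul_mem_of_mem_span (mul_mem_span_of_sameType G.pair G.left) hu hv

/-- `A` is spanned by `X'`, `X''` and the products of their elements. -/
theorem span_sup_eq_top (G : AxialGenerators l d X' X'') :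
    Submodule.span F X' ⊔ Submodule.span F X'' ⊔ crossSpan F X' X'' = ⊤ := by
  rw [eq_top_iff]
  set P := Submodule.span F X' ⊔ Submodule.span F X'' ⊔ crossSpan F X' X'' with hP
  have l1 : Submodule.span F X' ≤ P := le_sup_left.trans le_sup_left
  have l2 : Submodule.span F X'' ≤ P := le_sup_right.trans le_sup_left
  have l3 : crossSpan F X' X'' ≤ P := le_sup_right
  have : (NonUnitalAlgebra.adjoin F (X' ∪ X'')).toSubmodule ≤ P := by
    refine adjoin_le_of_mul_mem ?_ ?_
    · exact Set.union_subset (Submodule.subset_span.trans l1) (Submodule.subset_span.trans l2)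
    · intro x hx y hy
      obtain ⟨p, hp, z, hz, rfl⟩ := Submodule.mem_sup.1 hx
      obtain ⟨u, hu, v, hv, rfl⟩ := Submodule.mem_sup.1 hp
      obtain ⟨p', hp', z', hz', rfl⟩ := Submodule.mem_sup.1 hy
      obtain ⟨u', hu', v', hv', rfl⟩ := Submodule.mem_sup.1 hp'
      simp only [add_mul, mul_add]
      repeat' apply Submodule.add_mem
      · exact l1 (G.left_mul_mem hu hu')
      · exact l3 (G.span_mul_span hu' hv).2
      · exact l3 (G.span_mul_crossSpan hu' hz).2
      · exact l3 (G.span_mul_span hu hv').1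
      · exact l2 (G.symm.left_mul_mem hv hv')
      · exact l3 (G.span_mul_crossSpan' hv' hz).2
      · exact l3 (G.span_mul_crossSpan hu hz').1
      · exact l3 (G.span_mul_crossSpan' hv hz').1
      · rw [G.crossSpan_mul_crossSpan hz hz']; exact Submodule.zero_mem _
  intro u _
  exact this (by rw [G.gen]; trivial)

theorem exists_decomp (G : AxialGenerators l d X' X'') (u : A) :
    ∃ v ∈ Submodule.span F X', ∃ w ∈ Submodule.span F X'', ∃ z ∈ crossSpan F X' X'',
      u = v + w + z := by
  have : u ∈ Submodule.span F X' ⊔ Submodule.span F X'' ⊔ crossSpan F X' X'' := by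
    rw [G.span_sup_eq_top]; trivial
  obtain ⟨p, hp, z, hz, rfl⟩ := Submodule.mem_sup.1 this
  obtain ⟨u, hu, v, hv, rfl⟩ := Submodule.mem_sup.1 hp
  exact ⟨u, hu, v, hv, z, hz, rfl⟩

theorem mul_crossSpan_mem (G : AxialGenerators l d X' X'') (u : A) {z : A}
    (hz : z ∈ crossSpan F X' X'') :
    u * z ∈ crossSpan F X' X'' ∧ z * u ∈ crossSpan F X' X'' := by
  obtain ⟨v, hv, w, hw, z', hz', rfl⟩ := G.exists_decomp u
  simp only [add_mul, mul_add, G.crossSpan_mul_crossSpan hz hz', G.crossSpan_mul_crossSpan hz' hz,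
    add_zero]
  have h1 := G.span_mul_crossSpan hv hz
  have h2 := G.span_mul_crossSpan' hw hz
  exact ⟨Submodule.add_mem _ h1.1 h2.1, Submodule.add_mem _ h1.2 h2.2⟩

/-- The ideal spanned by the products of elements of `X'` with elements of `X''`. -/
def crossIdeal (G : AxialGenerators l d X' X'') : AlgIdeal F A where
  __ := crossSpan F X' X''
  mul_mem_left x _ hy := (G.mul_crossSpan_mem x hy).1
  mul_mem_right x _ hy := (G.mul_crossSpan_mem x hy).2

/-- Products of `w` with `X'` lie in `Z` anyway, so the hypothesis concerns `v` alone, and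
`mem_of_forall_mul_mem` applies modulo `Z`. -/
theorem left_mem_crossSpan (G : AxialGenerators l d X' X'') {v w : A}
    (hv : v ∈ Submodule.span F X') (hw : w ∈ Submodule.span F X'')
    (hx : ∀ x ∈ X', x * (v + w) ∈ crossSpan F X' X'' ∧ (v + w) * x ∈ crossSpan F X' X'') :
    v ∈ crossSpan F X' X'' := by
  refine mem_of_forall_mul_mem G.pair G.left hv fun x hxX => ?_
  have h1 := hx x hxX
  have h2 := G.span_mul_span (Submodule.subset_span hxX) hw
  rw [mul_add, add_mul] at h1
  exact ⟨(Submodule.add_mem_iff_left _ h2.1).1 h1.1, (Submodule.add_mem_iff_left _ h2.2).1 h1.2⟩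

theorem right_mem_crossSpan (G : AxialGenerators l d X' X'') {v w : A}
    (hv : v ∈ Submodule.span F X') (hw : w ∈ Submodule.span F X'')
    (hx : ∀ x ∈ X'', x * (v + w) ∈ crossSpan F X' X'' ∧ (v + w) * x ∈ crossSpan F X' X'') :
    w ∈ crossSpan F X' X'' := by
  rw [← G.crossSpan_swap] at *
  rw [add_comm] at hx
  exact G.symm.left_mem_crossSpan hw hv hx

/-- The images of `A'` and `A''` in the quotient by `Z` meet trivially. -/
theorem mem_crossSpan_of_add_mem (G : AxialGenerators l d X' X'') {v w : A}
    (hv : v ∈ Submodule.span F X') (hw : w ∈ Submodule.span F X'')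
    (hvw : v + w ∈ crossSpan F X' X'') :
    v ∈ crossSpan F X' X'' ∧ w ∈ crossSpan F X' X'' :=
  ⟨G.left_mem_crossSpan hv hw fun x _ => G.mul_crossSpan_mem x hvw,
    G.right_mem_crossSpan hv hw fun x _ => G.mul_crossSpan_mem x hvw⟩

/-- The same removal of classes as in `mem_of_forall_mul_mem_finset`. On the part belonging to the
class of `x`, the axis `x` acts as the nonzero scalar `l`. -/
theorem eq_zero_of_mem_crossSpan_finset (G : AxialGenerators l d X' X'') (n : ℕ) :
    ∀ t : Finset A, t.card = n → ↑t ⊆ X' → ∀ u ∈ crossSpan F (t : Set A) X'',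
      (∀ x ∈ t, x * u = 0) → u = 0 := by
  classical
  induction n using Nat.strong_induction_on with
  | _ n ih =>
    intro t hn ht u hu hZ
    rcases t.eq_empty_or_nonempty with rfl | ⟨x, hx⟩
    · simpa [crossSpan] using hu
    · have px := G.left x (ht hx)
      obtain ⟨u₁, h1, u₂, h2, rfl⟩ := exists_crossSpan_split (fun y => x * y ≠ 0) hu
      have e1 := mem_eig.1 (G.crossSpan_le_eig px ((Set.sep_subset _ _).trans ht)
        (fun x hx => hx.2) h1)
      have e2 := mem_eig0.1 (G.crossSpan_le_eig0 px ((Set.sep_subset _ _).trans ht)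
        (fun x hx => not_not.1 hx.2) h2)
      have h10 : u₁ = 0 := by
        have := hZ x hx
        rw [mul_add, e1.1, e2.1, add_zero] at this
        exact (smul_eq_zero.1 this).resolve_left G.pair.l0
      subst h10
      rw [zero_add] at hZ ⊢
      have hlt : (t.filter fun y => ¬ x * y ≠ 0).card < n := by
        rw [← hn]
        refine Finset.card_lt_card (Finset.filter_ssubset.2 ⟨x, hx, ?_⟩)
        rw [not_not]; exact px.mul_self_ne
      refine ih _ hlt _ rfl ?_ u₂ ?_ fun y hy => hZ y (Finset.mem_filter.1 hy).1
      · rw [Finset.coe_filter]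
        exact fun y hy => ht hy.1
      · rwa [Finset.coe_filter]

theorem eq_zero_of_mem_crossSpan (G : AxialGenerators l d X' X'') {u : A}
    (hu : u ∈ crossSpan F X' X'') (hx : ∀ x ∈ X', x * u = 0) : u = 0 := by
  obtain ⟨t, ht, hut⟩ := exists_finset_of_mem_span_image2 hu
  exact G.eq_zero_of_mem_crossSpan_finset _ t rfl ht u hut fun x hxt => hx x (ht hxt)

theorem eq_zero_of_mul_eq_zero (G : AxialGenerators l d X' X'') {u : A}
    (hx : ∀ x ∈ X' ∪ X'', x * u = 0 ∧ u * x = 0) : u = 0 := by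
  obtain ⟨v, hv, w, hw, z, hz, rfl⟩ := G.exists_decomp u
  have key : ∀ x ∈ X' ∪ X'', x * (v + w) ∈ crossSpan F X' X'' ∧
      (v + w) * x ∈ crossSpan F X' X'' := by
    intro x hxX
    have h1 := hx x hxX
    have h2 := G.mul_crossSpan_mem x hz
    rw [mul_add, add_mul] at h1
    rw [eq_neg_of_add_eq_zero_left h1.1, eq_neg_of_add_eq_zero_left h1.2]
    exact ⟨Submodule.neg_mem _ h2.1, Submodule.neg_mem _ h2.2⟩
  have hvZ := G.left_mem_crossSpan hv hw fun x hx => key x (Or.inl hx)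
  have hwZ := G.right_mem_crossSpan hv hw fun x hx => key x (Or.inr hx)
  exact G.eq_zero_of_mem_crossSpan (Submodule.add_mem _ (Submodule.add_mem _ hvZ hwZ) hz)
    fun x hxX => (hx x (Or.inl hxX)).1

theorem eq_zero_of_forall_mul_eq_zero (G : AxialGenerators l d X' X'') {u : A}
    (hu : (∀ x : A, x * u = 0) ∨ (∀ x : A, u * x = 0)) : u = 0 := by
  refine G.eq_zero_of_mul_eq_zero fun x hx => ?_
  rcases hu with hu | hu <;> rcases hx with hx | hx
  · exact ⟨hu x, (G.left x hx).right_of_left_zero G.pair (hu x)⟩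
  · exact ⟨hu x, (G.right x hx).right_of_left_zero G.pair.symm (hu x)⟩
  · exact ⟨(G.left x hx).left_of_right_zero G.pair (hu x), hu x⟩
  · exact ⟨(G.right x hx).left_of_right_zero G.pair.symm (hu x), hu x⟩

/-- The point is that `a` need not belong to `X'`. Either `a` shares a class with some generator,
and then it lies in `A' + Z`; or it annihilates `X'`, and then `cross a b` is zero. -/
theorem cross_mem_crossSpan (G : AxialGenerators l d X' X'') {a b : A} (ha : PAx l d a)
    (hb : b ∈ X'') (hab : a ≠ b) : cross a b ∈ crossSpan F X' X'' := by
  have h := G.pair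
  have pb := G.right b hb
  obtain ⟨v, hv, w, hw, z, hz, e⟩ := G.exists_decomp a
  by_cases hX : ∃ x ∈ X', a * x ≠ 0
  · obtain ⟨x, hx, hax⟩ := hX
    have e1 := ha.mul_eq h (G.left x hx) hax
    have hxs : x ∈ Submodule.span F X' := Submodule.subset_span hx
    -- The formula `ax = d a + l x` recovers `a` from `ax`. The first bracket is in the span of
    -- `X'`, the second in `Z`.
    have e2 : d • a = (v * x - l • x) + (w * x + z * x) := by
      rw [← sub_eq_iff_eq_add.2 e1]
      nth_rw 1 [e]
      rw [add_mul, add_mul]; abel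
    have m1 : v * x - l • x ∈ Submodule.span F X' :=
      Submodule.sub_mem _ (G.left_mul_mem hv hxs) (Submodule.smul_mem _ _ hxs)
    have m2 : w * x + z * x ∈ crossSpan F X' X'' :=
      Submodule.add_mem _ (G.span_mul_span hxs hw).2 (G.span_mul_crossSpan hxs hz).2
    have hbs : b ∈ Submodule.span F X'' := Submodule.subset_span hb
    have h1 := G.span_mul_span m1 hbs
    have h2 := G.mul_crossSpan_mem b m2
    rw [cross, ← Submodule.smul_mem_iff _ h.d0, smul_add, ← smul_mul_assoc, ← mul_smul_comm, e2,
      add_mul, mul_add]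
    exact Submodule.add_mem _ (Submodule.add_mem _ h1.1 h2.2) (Submodule.add_mem _ h1.2 h2.1)
  · push Not at hX
    have hvZ : v ∈ crossSpan F X' X'' := by
      refine G.left_mem_crossSpan hv hw fun x hx => ?_
      have h1 := hX x hx
      have h2 := ha.right_of_left_zero h h1
      have h3 := G.mul_crossSpan_mem x hz
      rw [e, add_mul] at h1
      rw [e, mul_add] at h2
      rw [eq_neg_of_add_eq_zero_left h1, eq_neg_of_add_eq_zero_left h2]
      exact ⟨Submodule.neg_mem _ h3.1, Submodule.neg_mem _ h3.2⟩
    -- Modulo `Z`, which annihilates `cross a b`, the axis `a` equals `w`. But `a` acts on `cross a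
    -- b` by `l` and `d` from the two sides, while `w` in the span of `X''` acts by `k d` and `k l`.
    -- Eliminating `k` gives the factor `d² - l² = d - l`.
    have hk : ∃ k : F, w * cross a b = (k * d) • cross a b ∧
        cross a b * w = (k * l) • cross a b := by
      refine Submodule.span_induction ?_ ?_ ?_ ?_ hw
      · intro y hy
        by_cases hby : b * y = 0
        · have := pb.cross_even h.symm ha hab.symm (G.right y hy) hby
          rw [cross_comm] at this
          exact ⟨0, by simp [this.1], by simp [this.2]⟩
        · have := pb.cross_odd h.symm ha hab.symm (G.right y hy) hby
          rw [cross_comm] at this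
          exact ⟨1, by simp [this.1], by simp [this.2]⟩
      · exact ⟨0, by simp, by simp⟩
      · rintro x y - - ⟨k, h1, h2⟩ ⟨k', h1', h2'⟩
        exact ⟨k + k', by rw [add_mul, h1, h1']; module, by rw [mul_add, h2, h2']; module⟩
      · rintro c x - ⟨k, h1, h2⟩
        exact ⟨c * k, by rw [smul_mul_assoc, h1]; module, by rw [mul_smul_comm, h2]; module⟩
    obtain ⟨k, k1, k2⟩ := hk
    obtain ⟨c1, c2⟩ := ha.mul_cross h pb hab
    have z1 := G.cross_mul_crossSpan ha pb hab hvZ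
    have z2 := G.cross_mul_crossSpan ha pb hab hz
    have d1 : l • cross a b = (k * d) • cross a b := by
      rw [← c1, ← k1]
      nth_rw 1 [e]
      rw [add_mul, add_mul, z1.2, z2.2, zero_add, add_zero]
    have d2 : d • cross a b = (k * l) • cross a b := by
      have e' : cross a b * a = cross a b * (v + w + z) := congrArg _ e
      rw [← c2, ← k2, e', mul_add, mul_add, z1.1, z2.1, zero_add, add_zero]
    have : (d - l) • cross a b = 0 := by
      have : (d * d - l * l) • cross a b = 0 := by
        linear_combination (norm := module) d • d2 - l • d1
      have e : d - l = d * d - l * l := by rw [h.d_eq]; ring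
      rw [e, this]
    rw [(smul_eq_zero.1 this).resolve_left h.sub_ne]
    exact Submodule.zero_mem _

/-- The odd part of a primitive axis of type `(l, d)`. -/
theorem eig_eq (G : AxialGenerators l d X' X'') {a : A} (ha : PAx l d a) :
    eig F l d a = Submodule.span F {m | ∃ x ∈ X', a * x ≠ 0 ∧ m = x - a} ⊔
      (crossSpan F X' X'' ⊓ eig F l d a) := by
  have h := G.pair
  apply le_antisymm
  · intro w hw
    rw [mem_eig] at hw
    rw [← PAx.oddPart_of_odd h hw.1 hw.2]
    set P := Submodule.span F {m | ∃ x ∈ X', a * x ≠ 0 ∧ m = x - a} ⊔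
      (crossSpan F X' X'' ⊓ eig F l d a)
    have hodd : ∀ u, oddPart l d a u ∈ eig F l d a := fun u =>
      mem_eig.2 ⟨ha.mul_oddPart h u, ha.oddPart_mul h u⟩
    -- The odd projection is onto, so it suffices to project the generators of `A`. Projections from
    -- `X'` give differences or zero, all others land in `Z`.
    have : Submodule.span F X' ⊔ Submodule.span F X'' ⊔ crossSpan F X' X'' ≤
        P.comap (oddPart l d a) := by
      refine sup_le (sup_le (Submodule.span_le.2 ?_) (Submodule.span_le.2 ?_)) ?_
      · intro x hx
        change oddPart l d a x ∈ P
        by_cases hax : a * x = 0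
        · rw [ha.oddPart_of_mul_eq_zero h hax]; exact P.zero_mem
        · rw [ha.oddPart_of_ne h (G.left x hx) hax]
          exact Submodule.mem_sup_left (Submodule.subset_span ⟨x, hx, hax, rfl⟩)
      · intro b hb
        change oddPart l d a b ∈ P
        by_cases hab : a = b
        · rw [← hab, PAx.oddPart_of_even rfl]; exact P.zero_mem
        · refine Submodule.mem_sup_right ⟨?_, hodd b⟩
          rw [(ha.cross_spec h (G.right b hb) hab).2.2.1]
          exact G.cross_mem_crossSpan ha hb hab
      · intro z hz
        refine Submodule.mem_sup_right ⟨?_, hodd z⟩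
        rw [oddPart_apply]
        have := G.axis_mul_crossSpan ha hz
        exact Submodule.smul_mem _ _ (Submodule.sub_mem _ this.2 this.1)
    exact this (by rw [G.span_sup_eq_top]; trivial)
  · refine sup_le (Submodule.span_le.2 ?_) inf_le_right
    rintro _ ⟨x, hx, hax, rfl⟩
    exact mem_eig.2 (ha.sub_odd h (G.left x hx) hax)

end AxialGenerators

end Generated

/-! ### Idempotents in the span of axes of one type -/

section Idempotents

variable {F : Type*} {A : Type*} [Field F] [NonUnitalNonAssocRing A] [Module F A]
  [IsScalarTower F A A] [SMulCommClass F A A] {l d : F}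

theorem span_axesOf_of_span (h : ∀ x ∈ (S : Set A), PAx l d x) (hS : Submodule.span F S = ⊤) :
    Submodule.span F (axesOf l d : Set A) = ⊤ := by
  rw [eq_top_iff, ← hS]
  exact Submodule.span_mono fun x hx => Or.inl (h x hx)

/-- An idempotent of the span of a set of primitive axes of one type is the sum of two orthogonal
idempotents, one of them in the span of the class of a given axis. -/
theorem exists_idempotent_split (h : AxialPair l d) {S : Set A} (hS : ∀ x ∈ S, PAx l d x) {a : A}
    (ha : PAx l d a) {c : A} (hc : c ∈ Submodule.span F S) (hcc : c * c = c) :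
    ∃ c₁ ∈ Submodule.span F {y ∈ S | a * y ≠ 0}, ∃ c₂ ∈ Submodule.span F {y ∈ S | ¬ a * y ≠ 0},
      c = c₁ + c₂ ∧ c₁ * c₁ = c₁ ∧ c₁ * c₂ = 0 ∧ c₂ * c₁ = 0 := by
  obtain ⟨c₁, h1, c₂, h2, rfl⟩ := exists_split (fun y => a * y ≠ 0) hc
  have orth : ∀ x ∈ S, a * x ≠ 0 → ∀ y ∈ S, ¬ a * y ≠ 0 → x * y = 0 := by
    intro x hx hax y hy hay
    by_contra h0
    exact hay (ha.mul_ne_zero_trans h (hS x hx) (hS y hy) hax h0)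
  have h12 : c₁ * c₂ = 0 :=
    mul_eq_zero_of_mem_span (fun x hx y hy => orth x hx.1 hx.2 y hy.1 hy.2) h1 h2
  have h21 : c₂ * c₁ = 0 :=
    mul_eq_zero_of_mem_span
      (fun y hy x hx => (hS x hx.1).mul_eq_zero_comm h (orth x hx.1 hx.2 y hy.1 hy.2)) h2 h1
  refine ⟨c₁, h1, c₂, h2, rfl, ?_, h12, h21⟩
  -- The two sides lie in the span of the class and in the span of its complement, which meet only
  -- in zero.
  have e : c₁ * c₁ - c₁ = c₂ - c₂ * c₂ := by
    rw [mul_add, add_mul, add_mul, h12, h21] at hcc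
    linear_combination (norm := module) hcc
  have m1 : c₁ * c₁ - c₁ ∈ Submodule.span F {y ∈ S | a * y ≠ 0} :=
    Submodule.sub_mem _ (mul_mem_of_mem_span
      (mul_mem_span_of_sameType h fun x hx => hS x hx.1) h1 h1) h1
  have m2 : c₂ - c₂ * c₂ ∈ Submodule.span F {y ∈ S | ¬ a * y ≠ 0} :=
    Submodule.sub_mem _ h2 (mul_mem_of_mem_span
      (mul_mem_span_of_sameType h fun x hx => hS x hx.1) h2 h2)
  exact sub_eq_zero.1 (span_class_disjoint h hS ha m1 (e ▸ m2))

/-- Some `x` fails to annihilate `c`. The component of `c` in the class of `x` is then nonzero and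
fixed by `c`, hence proportional to `c`. -/
theorem exists_class_of_primitive (h : AxialPair l d) {S : Set A} (hS : ∀ x ∈ S, PAx l d x)
    {c : A} (hc : c ∈ Submodule.span F S) (hc0 : c ≠ 0) (hcc : c * c = c)
    (hp : ∀ u ∈ Submodule.span F S, c * u = u → ∃ k : F, u = k • c) :
    ∃ x ∈ S, c ∈ Submodule.span F {y ∈ S | x * y ≠ 0} := by
  have : ∃ x ∈ S, ¬ (x * c = 0 ∧ c * x = 0) := by
    by_contra! h0
    refine hc0 ?_
    rw [← Submodule.mem_bot (R := F)]
    exact mem_of_forall_mul_mem h hS hc fun x hx => by simpa using h0 x hx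
  obtain ⟨x, hx, hxc⟩ := this
  obtain ⟨c₁, h1, c₂, h2, e, e11, e12, e21⟩ := exists_idempotent_split h hS (hS x hx) hc hcc
  obtain ⟨k, hk⟩ := hp c₁ (Submodule.span_mono (Set.sep_subset _ _) h1)
    (by rw [e, add_mul, e11, e21, add_zero])
  have hk0 : k ≠ 0 := by
    rintro rfl
    rw [zero_smul] at hk
    rw [hk, zero_add] at e
    refine hxc (mul_span_eq_zero (F := F) ?_ (e ▸ h2))
    rintro y ⟨hy, hxy⟩
    have := not_not.1 hxy
    exact ⟨this, (hS x hx).mul_eq_zero_comm h this⟩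
  refine ⟨x, hx, ?_⟩
  rw [hk] at h1
  exact (Submodule.smul_mem_iff _ hk0).1 h1

/-- Subspaces of the eigenspaces for distinct eigenvalues that together span `A` must exhaust those
eigenspaces. This turns explicit spanning sets into the grading of an axis. -/
theorem eig_eq_of_decomposition {c : A} {l : F} (hl0 : l ≠ 0) (hl1 : l ≠ 1)
    {V₁ V₀ V : Submodule F A} (h1 : V₁ ≤ eigL F c 1) (h0 : V₀ ≤ eigL F c 0) (hl : V ≤ eigL F c l)
    (htop : V₁ ⊔ V₀ ⊔ V = ⊤) :
    IsCompl (V₁ ⊔ V₀) V ∧ eigL F c 1 ⊔ eigL F c 0 = V₁ ⊔ V₀ ∧ eigL F c l = V := by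
  have m1 : ∀ v ∈ V₁, c * v = v := fun v hv => by simpa using mem_eigL.1 (h1 hv)
  have m0 : ∀ v ∈ V₀, c * v = 0 := fun v hv => by simpa using mem_eigL.1 (h0 hv)
  have ml : ∀ v ∈ V, c * v = l • v := fun v hv => by simpa using mem_eigL.1 (hl hv)
  have dec : ∀ u, ∃ v₁ ∈ V₁, ∃ v₀ ∈ V₀, ∃ v ∈ V, u = v₁ + v₀ + v := by
    intro u
    have : u ∈ V₁ ⊔ V₀ ⊔ V := by rw [htop]; trivial
    obtain ⟨p, hp, v, hv, rfl⟩ := Submodule.mem_sup.1 this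
    obtain ⟨v₁, hv₁, v₀, hv₀, rfl⟩ := Submodule.mem_sup.1 hp
    exact ⟨v₁, hv₁, v₀, hv₀, v, hv, rfl⟩
  have ind : ∀ v₁ ∈ V₁, ∀ v₀ ∈ V₀, ∀ v ∈ V, v₁ + v₀ + v = 0 → v₁ = 0 ∧ v₀ = 0 ∧ v = 0 :=
    fun v₁ hv₁ v₀ hv₀ v hv e => indep_of_idem hl0 hl1 (m1 _ hv₁) (m0 _ hv₀) (ml _ hv) e
  refine ⟨⟨?_, codisjoint_iff.2 htop⟩, ?_, ?_⟩
  · rw [Submodule.disjoint_def]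
    intro u hu hu'
    obtain ⟨v₁, hv₁, v₀, hv₀, rfl⟩ := Submodule.mem_sup.1 hu
    have := ind v₁ hv₁ v₀ hv₀ _ (V.neg_mem hu') (by abel)
    exact neg_eq_zero.1 this.2.2
  · refine le_antisymm (sup_le ?_ ?_) (sup_le_sup h1 h0)
    · intro u hu
      obtain ⟨v₁, hv₁, v₀, hv₀, v, hv, rfl⟩ := dec u
      rw [mem_eigL, one_smul, mul_add, mul_add, m1 _ hv₁, m0 _ hv₀, ml _ hv] at hu
      have := ind 0 V₁.zero_mem v₀ hv₀ ((1 - l) • v) (V.smul_mem _ hv)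
        (by linear_combination (norm := module) -hu)
      have h3 : v = 0 := (smul_eq_zero.1 this.2.2).resolve_left (sub_ne_zero.2 hl1.symm)
      rw [h3, this.2.1, add_zero, add_zero]
      exact Submodule.mem_sup_left hv₁
    · intro u hu
      obtain ⟨v₁, hv₁, v₀, hv₀, v, hv, rfl⟩ := dec u
      rw [mem_eigL, zero_smul, mul_add, mul_add, m1 _ hv₁, m0 _ hv₀, ml _ hv] at hu
      have := ind v₁ hv₁ 0 V₀.zero_mem (l • v) (V.smul_mem _ hv)
        (by linear_combination (norm := module) hu)
      have h3 : v = 0 := (smul_eq_zero.1 this.2.2).resolve_left hl0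
      rw [h3, this.1, add_zero, zero_add]
      exact Submodule.mem_sup_right hv₀
  · refine le_antisymm ?_ hl
    intro u hu
    obtain ⟨v₁, hv₁, v₀, hv₀, v, hv, rfl⟩ := dec u
    rw [mem_eigL, mul_add, mul_add, m1 _ hv₁, m0 _ hv₀, ml _ hv] at hu
    have := ind ((1 - l) • v₁) (V₁.smul_mem _ hv₁) (-l • v₀) (V₀.smul_mem _ hv₀) 0 V.zero_mem
      (by linear_combination (norm := module) hu)
    have h3 : v₁ = 0 := (smul_eq_zero.1 this.1).resolve_left (sub_ne_zero.2 hl1.symm)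
    have h4 : v₀ = 0 := (smul_eq_zero.1 this.2.1).resolve_left (neg_ne_zero.2 hl0)
    rw [h3, h4, add_zero, zero_add]
    exact hv

theorem eigR_eq_of_decomposition {c : A} {l : F} (hl0 : l ≠ 0) (hl1 : l ≠ 1)
    {V₁ V₀ V : Submodule F A} (h1 : V₁ ≤ eigR F c 1) (h0 : V₀ ≤ eigR F c 0) (hl : V ≤ eigR F c l)
    (htop : V₁ ⊔ V₀ ⊔ V = ⊤) :
    eigR F c 1 ⊔ eigR F c 0 = V₁ ⊔ V₀ ∧ eigR F c l = V := by
  have m1 : ∀ v ∈ V₁, v * c = v := fun v hv => by simpa using mem_eigR.1 (h1 hv)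
  have m0 : ∀ v ∈ V₀, v * c = 0 := fun v hv => by simpa using mem_eigR.1 (h0 hv)
  have ml : ∀ v ∈ V, v * c = l • v := fun v hv => by simpa using mem_eigR.1 (hl hv)
  have dec : ∀ u, ∃ v₁ ∈ V₁, ∃ v₀ ∈ V₀, ∃ v ∈ V, u = v₁ + v₀ + v := by
    intro u
    have : u ∈ V₁ ⊔ V₀ ⊔ V := by rw [htop]; trivial
    obtain ⟨p, hp, v, hv, rfl⟩ := Submodule.mem_sup.1 this
    obtain ⟨v₁, hv₁, v₀, hv₀, rfl⟩ := Submodule.mem_sup.1 hp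
    exact ⟨v₁, hv₁, v₀, hv₀, v, hv, rfl⟩
  have ind : ∀ v₁ ∈ V₁, ∀ v₀ ∈ V₀, ∀ v ∈ V, v₁ + v₀ + v = 0 → v₁ = 0 ∧ v₀ = 0 ∧ v = 0 :=
    fun v₁ hv₁ v₀ hv₀ v hv e => indep_of_idem_right hl0 hl1 (m1 _ hv₁) (m0 _ hv₀) (ml _ hv) e
  refine ⟨?_, ?_⟩
  · refine le_antisymm (sup_le ?_ ?_) (sup_le_sup h1 h0)
    · intro u hu
      obtain ⟨v₁, hv₁, v₀, hv₀, v, hv, rfl⟩ := dec u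
      rw [mem_eigR, one_smul, add_mul, add_mul, m1 _ hv₁, m0 _ hv₀, ml _ hv] at hu
      have := ind 0 V₁.zero_mem v₀ hv₀ ((1 - l) • v) (V.smul_mem _ hv)
        (by linear_combination (norm := module) -hu)
      have h3 : v = 0 := (smul_eq_zero.1 this.2.2).resolve_left (sub_ne_zero.2 hl1.symm)
      rw [h3, this.2.1, add_zero, add_zero]
      exact Submodule.mem_sup_left hv₁
    · intro u hu
      obtain ⟨v₁, hv₁, v₀, hv₀, v, hv, rfl⟩ := dec u
      rw [mem_eigR, zero_smul, add_mul, add_mul, m1 _ hv₁, m0 _ hv₀, ml _ hv] at hu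
      have := ind v₁ hv₁ 0 V₀.zero_mem (l • v) (V.smul_mem _ hv)
        (by linear_combination (norm := module) hu)
      have h3 : v = 0 := (smul_eq_zero.1 this.2.2).resolve_left hl0
      rw [h3, this.1, add_zero, zero_add]
      exact Submodule.mem_sup_right hv₀
  · refine le_antisymm ?_ hl
    intro u hu
    obtain ⟨v₁, hv₁, v₀, hv₀, v, hv, rfl⟩ := dec u
    rw [mem_eigR, add_mul, add_mul, m1 _ hv₁, m0 _ hv₀, ml _ hv] at hu
    have := ind ((1 - l) • v₁) (V₁.smul_mem _ hv₁) (-l • v₀) (V₀.smul_mem _ hv₀) 0 V.zero_mem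
      (by linear_combination (norm := module) hu)
    have h3 : v₁ = 0 := (smul_eq_zero.1 this.1).resolve_left (sub_ne_zero.2 hl1.symm)
    have h4 : v₀ = 0 := (smul_eq_zero.1 this.2.1).resolve_left (neg_ne_zero.2 hl0)
    rw [h3, h4, add_zero, zero_add]
    exact hv

/-- The component `c₁` of `c` in the class of `p` is itself an axis of that class. Comparing `c₁ p =
p` with `c₁ p = d c₁ + l p` gives `c₁ = p`, and the other component annihilates the class. -/
theorem mul_eq_of_component (h : AxialPair l d) {S : Set A} (hS : ∀ x ∈ S, PAx l d x)
    (hspan : Submodule.span F S = ⊤) {c p y : A} (hcc : c * c = c) (hp : PAx l d p)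
    (hcp : c * p = p) (hy : PAx l d y) (hpy : p * y ≠ 0) : c * y = p * y ∧ y * c = y * p := by
  have hcS : c ∈ Submodule.span F S := by rw [hspan]; trivial
  obtain ⟨c₁, h1, c₂, h2, e, e11, -, -⟩ := exists_idempotent_split h hS hp hcS hcc
  have h2' : ∀ z, PAx l d z → p * z ≠ 0 → z * c₂ = 0 ∧ c₂ * z = 0 := by
    intro z hz hpz
    refine mul_span_eq_zero (F := F) ?_ h2
    rintro v ⟨hv, hpv⟩
    have hzv : z * v = 0 := by
      by_contra h0
      exact hpv (hp.mul_ne_zero_trans h hz (hS v hv) hpz h0)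
    exact ⟨hzv, hz.mul_eq_zero_comm h hzv⟩
  have k1 : c₁ * p = p := by
    have := hcp
    rwa [e, add_mul, (h2' p hp hp.mul_self_ne).2, add_zero] at this
  have hc1 : c₁ ≠ 0 := by
    rintro rfl
    rw [zero_mul] at k1
    exact hp.ne k1.symm
  have hsub : {z ∈ S | p * z ≠ 0} ⊆ {z | PAx l d z ∧ p * z ≠ 0} := fun z hz => ⟨hS z hz.1, hz.2⟩
  obtain ⟨p1, p2⟩ := hp.of_idempotent_in_class h (span_axesOf_of_span hS hspan)
    (Submodule.span_mono hsub h1) hc1 e11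
  have k2 : d • (c₁ - p) = 0 := by
    have := p1.mul_eq h hp (p1.mul_ne_zero_comm h p2)
    rw [k1, h.d_eq] at this
    rw [h.d_eq]
    linear_combination (norm := module) -this
  have k3 : c₁ = p := sub_eq_zero.1 ((smul_eq_zero.1 k2).resolve_left h.d0)
  have := h2' y hy hpy
  rw [e, add_mul, mul_add, this.1, this.2, k3, add_zero, add_zero]
  exact ⟨rfl, rfl⟩

/-- In an algebra spanned by primitive axes of type `(l, d)`, every idempotent is an axis of
type `(l, d)`. -/
theorem isAxis_of_idempotent (h : AxialPair l d) {S : Set A} (hS : ∀ x ∈ S, PAx l d x)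
    (hspan : Submodule.span F S = ⊤) {c : A} (hcc : c * c = c) : IsAxis F c l d := by
  have hcS : c ∈ Submodule.span F S := by rw [hspan]; trivial
  have hd := h.d_eq
  have comp := fun p y (hp : PAx l d p) (hcp : c * p = p) (hy : PAx l d y) (hpy : p * y ≠ 0) =>
    mul_eq_of_component h hS hspan hcc hp hcp hy hpy
  -- In each class `c` fixes at most one axis, namely its own component there. So `c` is a sum of
  -- pairwise orthogonal axes, one from each of finitely many classes.
  have uniq : ∀ p q, PAx l d p → PAx l d q → c * p = p → c * q = q → p * q ≠ 0 → p = q := by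
    intro p q hp hq hcp hcq hpq
    have e := (comp p q hp hcp hq hpq).1
    rw [hp.mul_eq h hq hpq, hcq, hd] at e
    have k2 : d • (p - q) = 0 := by
      rw [hd]; linear_combination (norm := module) -e
    exact sub_eq_zero.1 ((smul_eq_zero.1 k2).resolve_left h.d0)
  have comm : ∀ p, PAx l d p → c * p = p → p * c = p := by
    intro p hp hcp
    rw [(comp p p hp hcp hp hp.mul_self_ne).2, hp.idem]
  set E₁ : Set A := {p | PAx l d p ∧ c * p = p}
  set E₀ : Set A := {y | PAx l d y ∧ c * y = 0 ∧ y * c = 0}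
  set E : Set A := {m | ∃ y p, PAx l d y ∧ p ∈ E₁ ∧ p * y ≠ 0 ∧ m = y - p}
  set V₁ := Submodule.span F E₁
  set V₀ := Submodule.span F E₀
  set V := Submodule.span F E
  -- If the component of `c` in the class of `y` is zero, then `c` annihilates `y`. Otherwise that
  -- component is an axis `p` fixed by `c`, and `y = p + (y - p)`.
  have htop : V₁ ⊔ V₀ ⊔ V = ⊤ := by
    rw [eq_top_iff, ← hspan]
    refine Submodule.span_le.2 fun y hyS => ?_
    have hy := hS y hyS
    obtain ⟨c₁, h1, c₂, h2, e, e11, e12, e21⟩ := exists_idempotent_split h hS hy hcS hcc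
    have h20 : y * c₂ = 0 ∧ c₂ * y = 0 := by
      refine mul_span_eq_zero (F := F) ?_ h2
      rintro v ⟨hv, hyv⟩
      have hyv' := not_not.1 hyv
      exact ⟨hyv', hy.mul_eq_zero_comm h hyv'⟩
    by_cases hc1 : c₁ = 0
    · refine Submodule.mem_sup_left (Submodule.mem_sup_right (Submodule.subset_span ⟨hy, ?_⟩))
      rw [e, hc1, zero_add]
      exact ⟨h20.2, h20.1⟩
    · have hsub : {z ∈ S | y * z ≠ 0} ⊆ {z | PAx l d z ∧ y * z ≠ 0} :=
        fun z hz => ⟨hS z hz.1, hz.2⟩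
      obtain ⟨p1, p2⟩ := hy.of_idempotent_in_class h (span_axesOf_of_span hS hspan)
        (Submodule.span_mono hsub h1) hc1 e11
      have hp : c₁ ∈ E₁ := ⟨p1, by rw [e, add_mul, e11, e21, add_zero]⟩
      have : y = c₁ + (y - c₁) := by abel
      rw [this]
      exact Submodule.add_mem _
        (Submodule.mem_sup_left (Submodule.mem_sup_left (Submodule.subset_span hp)))
        (Submodule.mem_sup_right
          (Submodule.subset_span ⟨y, c₁, hy, hp, p1.mul_ne_zero_comm h p2, rfl⟩))
  have hE : ∀ m ∈ E, c * m = l • m ∧ m * c = d • m := by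
    rintro _ ⟨y, p, hy, hp, hpy, rfl⟩
    have e := comp p y hp.1 hp.2 hy hpy
    rw [mul_sub, sub_mul, e.1, e.2, hp.2, comm p hp.1 hp.2, hp.1.mul_eq h hy hpy,
      hy.mul_eq h hp.1 (hy.mul_ne_zero_comm h hpy), hd]
    constructor <;> module
  have L := eig_eq_of_decomposition (c := c) h.l0 h.l1 (V₁ := V₁) (V₀ := V₀) (V := V)
    (Submodule.span_le.2 fun p hp => mem_eigL.2 (by rw [one_smul, hp.2]))
    (Submodule.span_le.2 fun p hp => mem_eigL.2 (by rw [zero_smul, hp.2.1]))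
    (Submodule.span_le.2 fun p hp => mem_eigL.2 (hE p hp).1) htop
  have R := eigR_eq_of_decomposition (c := c) h.d0 h.d1 (V₁ := V₁) (V₀ := V₀) (V := V)
    (Submodule.span_le.2 fun p hp => mem_eigR.2 (by rw [one_smul, comm p hp.1 hp.2]))
    (Submodule.span_le.2 fun p hp => mem_eigR.2 (by rw [zero_smul, hp.2.2]))
    (Submodule.span_le.2 fun p hp => mem_eigR.2 (hE p hp).2) htop
  have sup : V₁ ⊔ V₀ = Submodule.span F (E₁ ∪ E₀) := (Submodule.span_union _ _).symm
  -- products of the spanning elements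
  have p10 : ∀ p ∈ E₁, ∀ y ∈ E₀, p * y = 0 := by
    intro p hp y hy
    by_contra h0
    have := (comp p y hp.1 hp.2 hy.1 h0).1
    rw [hy.2.1] at this
    exact h0 this.symm
  have p1E : ∀ q ∈ E₁, ∀ m ∈ E, q * m ∈ V ∧ m * q ∈ V := by
    rintro q hq _ ⟨y, p, hy, hp, hpy, rfl⟩
    by_cases h0 : p * q = 0
    · have h1 : q * p = 0 := hp.1.mul_eq_zero_comm h h0
      have h2 : q * y = 0 := by
        by_contra h2
        exact hq.1.mul_ne_zero_trans h hy hp.1 h2 (hy.mul_ne_zero_comm h hpy) h1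
      rw [mul_sub, sub_mul, h0, h1, h2, hq.1.mul_eq_zero_comm h h2, sub_self]
      exact ⟨V.zero_mem, V.zero_mem⟩
    · obtain rfl := uniq p q hp.1 hq.1 hp.2 hq.2 h0
      have := hp.1.sub_odd h hy hpy
      rw [this.1, this.2]
      have hm : y - p ∈ V := Submodule.subset_span ⟨y, p, hy, hp, hpy, rfl⟩
      exact ⟨V.smul_mem _ hm, V.smul_mem _ hm⟩
  have p0E : ∀ q ∈ E₀, ∀ m ∈ E, q * m = 0 ∧ m * q = 0 := by
    rintro q hq _ ⟨y, p, hy, hp, hpy, rfl⟩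
    have h0 := p10 p hp q hq
    have h1 : q * p = 0 := hp.1.mul_eq_zero_comm h h0
    have h2 : q * y = 0 := by
      by_contra h2
      exact hq.1.mul_ne_zero_trans h hy hp.1 h2 (hy.mul_ne_zero_comm h hpy) h1
    rw [mul_sub, sub_mul, h0, h1, h2, hq.1.mul_eq_zero_comm h h2, sub_self]
    exact ⟨rfl, rfl⟩
  have pEE : ∀ m ∈ E, ∀ n ∈ E, m * n = 0 := by
    rintro _ ⟨y, p, hy, hp, hpy, rfl⟩ _ ⟨y', p', hy', hp', hpy', rfl⟩
    by_cases h0 : p * p' = 0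
    · have a1 : y * p' = 0 := by
        by_contra h2
        exact hp.1.mul_ne_zero_trans h hy hp'.1 hpy h2 h0
      have a2 : p * y' = 0 := by
        by_contra h2
        exact hp.1.mul_ne_zero_trans h hy' hp'.1 h2 (hy'.mul_ne_zero_comm h hpy') h0
      have a3 : y * y' = 0 := by
        by_contra h2
        exact hp.1.mul_ne_zero_trans h hy hy' hpy h2 a2
      simp [mul_sub, sub_mul, h0, a1, a2, a3]
    · obtain rfl := uniq p p' hp.1 hp'.1 hp.2 hp'.2 h0
      exact hp.1.sub_mul_sub h hy hy' hpy hpy'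
  have ee : ∀ x ∈ V₁ ⊔ V₀, ∀ y ∈ V₁ ⊔ V₀, x * y ∈ V₁ ⊔ V₀ := by
    rw [sup]
    intro x hx y hy
    refine mul_mem_of_mem_span ?_ hx hy
    have m1 : E₁ ⊆ Submodule.span F (E₁ ∪ E₀) := fun p hp => Submodule.subset_span (Or.inl hp)
    have m0 : E₀ ⊆ Submodule.span F (E₁ ∪ E₀) := fun p hp => Submodule.subset_span (Or.inr hp)
    rintro p (hp | hp) q (hq | hq)
    · by_cases h0 : p * q = 0
      · rw [h0]; exact Submodule.zero_mem _
      · rw [← uniq p q hp.1 hq.1 hp.2 hq.2 h0, hp.1.idem]; exact m1 hp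
    · rw [p10 p hp q hq]; exact Submodule.zero_mem _
    · rw [hq.1.mul_eq_zero_comm h (p10 q hq p hp)]; exact Submodule.zero_mem _
    · by_cases h0 : p * q = 0
      · rw [h0]; exact Submodule.zero_mem _
      · rw [hp.1.mul_eq h hq.1 h0]
        exact Submodule.add_mem _ (Submodule.smul_mem _ _ (m0 hp)) (Submodule.smul_mem _ _ (m0 hq))
  have eo : ∀ x ∈ V₁ ⊔ V₀, ∀ y ∈ V, x * y ∈ V := by
    rw [sup]
    intro x hx y hy
    refine mul_mem_of_mem_span ?_ hx hy
    rintro p (hp | hp) m hm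
    · exact (p1E p hp m hm).1
    · rw [(p0E p hp m hm).1]; exact V.zero_mem
  have oe : ∀ x ∈ V, ∀ y ∈ V₁ ⊔ V₀, x * y ∈ V := by
    rw [sup]
    intro x hx y hy
    refine mul_mem_of_mem_span ?_ hx hy
    rintro m hm p (hp | hp)
    · exact (p1E p hp m hm).2
    · rw [(p0E p hp m hm).2]; exact V.zero_mem
  have oo : ∀ x ∈ V, ∀ y ∈ V, x * y ∈ V₁ ⊔ V₀ := by
    intro x hx y hy
    rw [mul_eq_zero_of_mem_span pEE hx hy]
    exact Submodule.zero_mem _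
  have G : IsZ2Grading F (V₁ ⊔ V₀) V := ⟨L.1, ee, eo, oe, oo⟩
  refine ⟨⟨h.l0, h.l1, hcc, by rw [L.2.1, L.2.2]; exact G⟩,
    ⟨h.d0, h.d1, hcc, by rw [R.1, R.2]; exact G⟩, ?_⟩
  intro u
  have hu : u ∈ Submodule.span F (E₁ ∪ E₀ ∪ E) := by
    rw [Submodule.span_union, Submodule.span_union, htop]; trivial
  refine Submodule.span_induction ?_ ?_ ?_ ?_ hu
  · rintro p ((hp | hp) | hp)
    · rw [hp.2, comm p hp.1 hp.2, hp.2]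
    · rw [hp.2.1, hp.2.2, mul_zero, zero_mul]
    · rw [(hE p hp).1, (hE p hp).2, mul_smul_comm, smul_mul_assoc, (hE p hp).1, (hE p hp).2,
        smul_comm]
  · simp
  · intro x y _ _ hx hy
    rw [add_mul, mul_add, mul_add, add_mul, hx, hy]
  · intro k x _ hx
    rw [smul_mul_assoc, mul_smul_comm, mul_smul_comm, smul_mul_assoc, hx]

end Idempotents

/-! ### Miyamoto groups, closures, components and the algebras `U_T(l)` -/

section Miyamoto

variable {F : Type*} {A : Type*} [Field F] [NonUnitalNonAssocRing A] [Module F A]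
  [IsScalarTower F A A] [SMulCommClass F A A] {l d : F}

theorem isMiyamoto_eq_tau (h : AxialPair l d) {a : A} (ha : PAx l d a) {t : A ≃ₗ[F] A}
    (ht : IsMiyamoto F a t) : t = ha.tau h := by
  ext y
  rw [ha.eq_sub_two_oddPart_of_isMiyamoto h ht, PAx.tau_apply]

/-- Either `ax = 0` and `x` is fixed, or the automorphism fixes `a` and so keeps `x` in the class of
`a`. -/
theorem mul_tau_ne_zero (h : AxialPair l d) {a x : A} (ha : PAx l d a) (hx : PAx l d x) :
    x * ha.tau h x ≠ 0 := by
  by_cases hax : a * x = 0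
  · rw [PAx.tau_apply, ha.oddPart_of_mul_eq_zero h hax, smul_zero, sub_zero]
    exact hx.mul_self_ne
  · have h1 : ha.tau h a = a := by
      rw [PAx.tau_apply, PAx.oddPart_of_even rfl, smul_zero, sub_zero]
    have h2 : a * ha.tau h x ≠ 0 := by
      intro h0
      have : ha.tau h (a * x) = 0 := by rw [ha.tau_mul h, h1, h0]
      exact hax ((LinearEquiv.map_eq_zero_iff _).1 this)
    exact hx.mul_ne_zero_trans h ha (hx.map _ (ha.tau_mul h)) (hx.mul_ne_zero_comm h hax) h2

theorem mul_tau_ne_zero_of_opposite (h : AxialPair l d) {a x : A} (ha : PAx d l a)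
    (hx : PAx l d x) : x * ha.tau h.symm x ≠ 0 := by
  by_cases hax : x = a
  · subst hax
    rw [PAx.tau_apply, PAx.oddPart_of_even rfl, smul_zero, sub_zero]
    exact hx.mul_self_ne
  · rw [hx.tau_cross h ha hax]
    exact hx.mul_sub_cross_ne h ha hax

/-- `g` is an automorphism that maps each primitive axis of type `(l, d)` or `(d, l)` to an axis
of its class. -/
structure PreservesClasses (l d : F) (g : A ≃ₗ[F] A) : Prop where
  map_mul : ∀ x y, g (x * y) = g x * g y
  left : ∀ x, PAx l d x → x * g x ≠ 0
  right : ∀ x, PAx d l x → x * g x ≠ 0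

theorem preservesClasses_of_mem (h : AxialPair l d) {X : Set A}
    (hX : ∀ x ∈ X, PAx l d x ∨ PAx d l x) {g : A ≃ₗ[F] A} (hg : g ∈ miyamotoGroup F X) :
    PreservesClasses l d g := by
  refine Subgroup.closure_induction (p := fun g _ => PreservesClasses l d g) ?_ ?_ ?_ ?_ hg
  · rintro t ⟨a, ha, ht⟩
    rcases hX a ha with pa | pa
    · rw [isMiyamoto_eq_tau h pa ht]
      exact ⟨pa.tau_mul h, fun x hx => mul_tau_ne_zero h pa hx,
        fun x hx => mul_tau_ne_zero_of_opposite h.symm pa hx⟩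
    · rw [isMiyamoto_eq_tau h.symm pa ht]
      exact ⟨pa.tau_mul h.symm, fun x hx => mul_tau_ne_zero_of_opposite h pa hx,
        fun x hx => mul_tau_ne_zero h.symm pa hx⟩
  · exact ⟨fun _ _ => rfl, fun x hx => hx.mul_self_ne, fun x hx => hx.mul_self_ne⟩
  · intro g k _ _ pg pk
    refine ⟨fun x y => ?_, fun x hx => ?_, fun x hx => ?_⟩
    · simp only [LinearEquiv.mul_apply, pk.map_mul, pg.map_mul]
    · have hkx := hx.map k pk.map_mul
      exact hx.mul_ne_zero_trans h hkx (hkx.map g pg.map_mul) (pk.left x hx) (pg.left _ hkx)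
    · have hkx := hx.map k pk.map_mul
      exact hx.mul_ne_zero_trans h.symm hkx (hkx.map g pg.map_mul) (pk.right x hx) (pg.right _ hkx)
  · intro g _ pg
    have hm : ∀ x y, g⁻¹ (x * y) = g⁻¹ x * g⁻¹ y := by
      intro x y
      apply g.injective
      rw [pg.map_mul]
      change g (g.symm _) = g (g.symm _) * g (g.symm _)
      simp
    have hgg : ∀ x, g (g⁻¹ x) = x := fun x => g.apply_symm_apply x
    refine ⟨hm, fun x hx => ?_, fun x hx => ?_⟩
    · have := pg.left _ (hx.map g⁻¹ hm)
      rw [hgg] at this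
      exact hx.mul_ne_zero_comm h this
    · have := pg.right _ (hx.map g⁻¹ hm)
      rw [hgg] at this
      exact hx.mul_ne_zero_comm h.symm this

theorem subset_Cl (X : Set A) : X ⊆ Cl F X := fun x hx =>
  ⟨1, Subgroup.one_mem _, x, hx, rfl⟩

theorem exists_of_mem_Cl (h : AxialPair l d) {X : Set A} (hX : ∀ x ∈ X, PAx l d x) {y : A}
    (hy : y ∈ Cl F X) : PAx l d y ∧ ∃ x ∈ X, x * y ≠ 0 := by
  obtain ⟨g, hg, x, hx, rfl⟩ := hy
  have := preservesClasses_of_mem h (fun x hx => Or.inl (hX x hx)) hg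
  exact ⟨(hX x hx).map g this.map_mul, x, hx, this.left x (hX x hx)⟩

theorem isPAx_of_mem_Cl (h : AxialPair l d) {X : Set A} (hX : ∀ x ∈ X, PAx l d x ∨ PAx d l x)
    {y : A} (hy : y ∈ Cl F X) : PAx l d y ∨ PAx d l y := by
  obtain ⟨g, hg, x, hx, rfl⟩ := hy
  have := preservesClasses_of_mem h hX hg
  exact (hX x hx).imp (fun hx => hx.map g this.map_mul) fun hx => hx.map g this.map_mul

theorem Cl_subset_span (h : AxialPair l d) {X : Set A} (hX : ∀ x ∈ X, PAx l d x) :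
    Cl F X ⊆ Submodule.span F X := by
  rintro _ ⟨g, hg, x, hx, rfl⟩
  -- Including `g⁻¹` makes the property pass to inverses in the induction over the generated group.
  have key : ∀ u ∈ Submodule.span F X, g u ∈ Submodule.span F X ∧ g⁻¹ u ∈ Submodule.span F X := by
    refine Subgroup.closure_induction (p := fun g _ => ∀ u ∈ Submodule.span F X,
      g u ∈ Submodule.span F X ∧ g⁻¹ u ∈ Submodule.span F X) ?_ ?_ ?_ ?_ hg
    · rintro t ⟨a, ha, ht⟩ u hu
      have e := isMiyamoto_eq_tau h (hX a ha) ht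
      have h1 : t u ∈ Submodule.span F X := by
        have hs := Submodule.subset_span (R := F) ha
        have hc := mul_mem_span_of_sameType h hX
        rw [e, PAx.tau_apply, oddPart_apply]
        exact Submodule.sub_mem _ hu (Submodule.smul_mem _ _ (Submodule.smul_mem _ _
          (Submodule.sub_mem _ (mul_mem_of_mem_span hc hu hs) (mul_mem_of_mem_span hc hs hu))))
      refine ⟨h1, ?_⟩
      have : t⁻¹ u = t u := by
        rw [e]; rfl
      rwa [this]
    · exact fun u hu => ⟨hu, hu⟩
    · intro g k _ _ hg hk u hu
      refine ⟨(hg _ (hk u hu).1).1, ?_⟩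
      rw [mul_inv_rev]
      exact (hk _ (hg u hu).2).2
    · intro g _ hg u hu
      rw [inv_inv]
      exact ⟨(hg u hu).2, (hg u hu).1⟩
  exact (key x (Submodule.subset_span hx)).1

/-! ### Components -/

theorem mem_compSet {S : Set A} {C : Comp S} {y : A} :
    y ∈ compSet C ↔ ∃ hy : y ∈ S, (axialGraph S).connectedComponentMk ⟨y, hy⟩ = C := by
  constructor
  · rintro ⟨⟨y, hy⟩, h, rfl⟩
    exact ⟨hy, h⟩
  · rintro ⟨hy, h⟩
    exact ⟨⟨y, hy⟩, h, rfl⟩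

theorem compSet_subset {S : Set A} (C : Comp S) : compSet C ⊆ S := by
  rintro _ ⟨y, -, rfl⟩
  exact y.2

theorem compSet_nonempty {S : Set A} (C : Comp S) : (compSet C).Nonempty := by
  obtain ⟨y, hy⟩ := C.nonempty_supp
  exact ⟨y, y, hy, rfl⟩

theorem exists_mem_compSet {S : Set A} {y : A} (hy : y ∈ S) : ∃ C : Comp S, y ∈ compSet C :=
  ⟨_, mem_compSet.2 ⟨hy, rfl⟩⟩

theorem compSet_eq_of_mem {S : Set A} {C D : Comp S} {y : A} (h1 : y ∈ compSet C)
    (h2 : y ∈ compSet D) : C = D := by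
  obtain ⟨hy, rfl⟩ := mem_compSet.1 h1
  obtain ⟨-, rfl⟩ := mem_compSet.1 h2
  rfl

theorem mem_compSet_of_mul_ne_zero {S : Set A} {C : Comp S} {x y : A} (hx : x ∈ compSet C)
    (hy : y ∈ S) (hxy : x * y ≠ 0) : y ∈ compSet C := by
  obtain ⟨hxS, rfl⟩ := mem_compSet.1 hx
  refine mem_compSet.2 ⟨hy, ?_⟩
  by_cases e : x = y
  · subst e; rfl
  · refine SimpleGraph.ConnectedComponent.sound (SimpleGraph.Adj.reachable ?_)
    rw [axialGraph, SimpleGraph.fromRel_adj]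
    exact ⟨fun e' => e (congrArg Subtype.val e').symm, Or.inr hxy⟩

/-- Transitivity collapses a path to an edge: the components of a set of axes of one type are its
intersections with classes. -/
theorem mul_ne_zero_of_reachable (h : AxialPair l d) {S : Set A} (hS : ∀ x ∈ S, PAx l d x)
    {x y : S} (hxy : (axialGraph S).Reachable x y) : (x : A) * y ≠ 0 := by
  obtain ⟨w⟩ := hxy
  induction w with
  | nil => exact (hS _ (Subtype.prop _)).mul_self_ne
  | @cons u v w huv p ih =>
    refine (hS u u.2).mul_ne_zero_trans h (hS v v.2) (hS w w.2) ?_ ih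
    rw [axialGraph, SimpleGraph.fromRel_adj] at huv
    rcases huv.2 with h1 | h1
    · exact h1
    · exact (hS u u.2).mul_ne_zero_comm h h1

theorem mul_ne_zero_of_mem_compSet (h : AxialPair l d) {S : Set A} (hS : ∀ x ∈ S, PAx l d x)
    {C : Comp S} {x y : A} (hx : x ∈ compSet C) (hy : y ∈ compSet C) : x * y ≠ 0 := by
  obtain ⟨hxS, e⟩ := mem_compSet.1 hx
  obtain ⟨hyS, e'⟩ := mem_compSet.1 hy
  exact mul_ne_zero_of_reachable h hS (x := ⟨x, hxS⟩) (y := ⟨y, hyS⟩)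
    (SimpleGraph.ConnectedComponent.exact (e.trans e'.symm))

theorem compSet_eq (h : AxialPair l d) {S : Set A} (hS : ∀ x ∈ S, PAx l d x)
    {C : Comp S} {x : A} (hx : x ∈ compSet C) : compSet C = {y ∈ S | x * y ≠ 0} := by
  ext y
  exact ⟨fun hy => ⟨compSet_subset C hy, mul_ne_zero_of_mem_compSet h hS hx hy⟩,
    fun hy => mem_compSet_of_mul_ne_zero hx hy.1 hy.2⟩

/-! ### The algebras `U_T(l)` -/

theorem UAlg.span_e {E : Type*} : Submodule.span F (Set.range (UAlg.e : E → UAlg F E l)) = ⊤ :=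
  (Finsupp.basisSingleOne (R := F) (ι := E)).span_eq ▸ by
    congr 1

theorem isUAlg_of_clique (h : AxialPair l d) {T : Set A} (hT : ∀ x ∈ T, PAx l d x)
    (hTT : ∀ x ∈ T, ∀ y ∈ T, x * y ≠ 0) (hind : LinearIndepOn F id T)
    {B : NonUnitalSubalgebra F A} (hB : Submodule.span F T = B.toSubmodule) :
    IsUAlg B T l := by
  let f : UAlg F T l →ₗ[F] A := (Finsupp.linearCombination F (Subtype.val : T → A) :
    (T →₀ F) →ₗ[F] A)
  have fe : ∀ t : T, f (UAlg.e t) = t := fun t => by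
    change Finsupp.linearCombination F (Subtype.val : T → A) (Finsupp.single t 1) = _
    simp
  have hmul : ∀ x y, f (x * y) = f x * f y := by
    have e : (LinearMap.mul F (UAlg F T l)).compr₂ f = (LinearMap.mul F A).compl₁₂ f f := by
      refine LinearMap.ext_on_range UAlg.span_e fun x =>
        LinearMap.ext_on_range UAlg.span_e fun y => ?_
      simp only [LinearMap.compr₂_apply, LinearMap.mul_apply', LinearMap.compl₁₂_apply,
        UAlg.e_mul_e, map_add, map_smul, fe]
      rw [(hT x x.2).mul_eq h (hT y y.2) (hTT x x.2 y y.2), h.d_eq]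
    exact fun x y => LinearMap.congr_fun₂ e x y
  let g : UAlg F T l →ₙₐ[F] A := { f with
    map_smul' := fun c x => map_smul f c x
    map_zero' := map_zero f
    map_mul' := hmul }
  refine ⟨g, hind, ?_, fe⟩
  ext y
  have : y ∈ LinearMap.range f ↔ y ∈ Submodule.span F T := by
    have := Finsupp.range_linearCombination (R := F) (v := (Subtype.val : T → A))
    rw [Subtype.range_coe] at this
    rw [← this]
    rfl
  rw [hB] at this
  exact this

end Miyamoto

/-! ### Structure of the algebra generated by axes of one type -/

section Uniform

variable {F : Type*} {A : Type*} [Field F] [NonUnitalNonAssocRing A] [Module F A]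
  [IsScalarTower F A A] [SMulCommClass F A A] {l d : F}

theorem exists_component_of_primitive (h : AxialPair l d) {S : Set A} (hS : ∀ x ∈ S, PAx l d x)
    {c : NonUnitalAlgebra.adjoin F S} (hc : c ∈ chi F (NonUnitalAlgebra.adjoin F S)) :
    ∃ x ∈ S, (c : A) ∈ Submodule.span F {y ∈ S | x * y ≠ 0} := by
  obtain ⟨m, n, hp⟩ := hc
  have hB := adjoin_eq_span_of_sameType h hS
  have hmem : ∀ {u : A}, u ∈ Submodule.span F S ↔ u ∈ NonUnitalAlgebra.adjoin F S := by
    intro u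
    rw [← hB]; rfl
  refine exists_class_of_primitive h hS (hmem.2 c.2) ?_ ?_ ?_
  · exact fun h0 => hp.ne_zero (Subtype.ext h0)
  · exact congrArg Subtype.val hp.left.idem
  · intro u hu hcu
    have : (⟨u, hmem.1 hu⟩ : NonUnitalAlgebra.adjoin F S) ∈ eigL F c 1 :=
      mem_eigL.2 (by rw [one_smul]; exact Subtype.ext hcu)
    rw [hp.left_one, Submodule.mem_span_singleton] at this
    obtain ⟨k, hk⟩ := this
    exact ⟨k, (congrArg Subtype.val hk).symm⟩

/-- Primitivity inside the subalgebra confines `c` to the span of one class. There every nonzero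
idempotent is an axis of `A`, because the class is an affine space. -/
theorem pAx_of_mem_chi_adjoin (h : AxialPair l d)
    (hspan : Submodule.span F (axesOf l d : Set A) = ⊤) {S : Set A} (hS : ∀ x ∈ S, PAx l d x)
    {c : NonUnitalAlgebra.adjoin F S} (hc : c ∈ chi F (NonUnitalAlgebra.adjoin F S)) :
    PAx l d (c : A) := by
  obtain ⟨x, hx, hxc⟩ := exists_component_of_primitive h hS hc
  obtain ⟨m, n, hp⟩ := hc
  have hsub : {z ∈ S | x * z ≠ 0} ⊆ {z | PAx l d z ∧ x * z ≠ 0} := fun z hz => ⟨hS z hz.1, hz.2⟩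
  exact ((hS x hx).of_idempotent_in_class h hspan (Submodule.span_mono hsub hxc)
    (fun h0 => hp.ne_zero (Subtype.ext h0)) (congrArg Subtype.val hp.left.idem)).1

theorem adjoin_compSet (h : AxialPair l d) {S : Set A} (hS : ∀ x ∈ S, PAx l d x) (C : Comp S) :
    (NonUnitalAlgebra.adjoin F (compSet C)).toSubmodule = Submodule.span F (compSet C) :=
  adjoin_eq_span_of_sameType h fun x hx => hS x (compSet_subset C hx)

theorem mem_adjoin_compSet (h : AxialPair l d) {S : Set A} (hS : ∀ x ∈ S, PAx l d x) {C : Comp S}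
    {u : A} : u ∈ NonUnitalAlgebra.adjoin F (compSet C) ↔ u ∈ Submodule.span F (compSet C) := by
  rw [← adjoin_compSet h hS C]; rfl

theorem span_preimage_eq_top {B : NonUnitalSubalgebra F A} {S : Set A}
    (hB : Submodule.span F S = B.toSubmodule) :
    Submodule.span F ((↑) ⁻¹' S : Set B) = ⊤ := by
  have hSB : S ⊆ B := fun x hx => by
    have : x ∈ B.toSubmodule := hB ▸ Submodule.subset_span hx
    exact this
  apply Submodule.map_injective_of_injective (f := B.toSubmodule.subtype)
    (Submodule.injective_subtype _)
  rw [Submodule.map_top, Submodule.range_subtype, Submodule.map_span]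
  refine Eq.trans ?_ hB
  congr 1
  ext x
  constructor
  · rintro ⟨y, hy, rfl⟩; exact hy
  · intro hx; exact ⟨⟨x, hSB hx⟩, hx, rfl⟩

theorem exists_component_map {S T : Set A} (hTS : T ⊆ S) :
    ∃ D : Comp T → Comp S, ∀ C, compSet C ⊆ compSet (D C) := by
  let f : axialGraph T →g axialGraph S :=
    { toFun := Set.inclusion hTS
      map_rel' := by
        intro a b hab
        rw [axialGraph, SimpleGraph.fromRel_adj] at hab ⊢
        exact ⟨fun e => hab.1 (Set.inclusion_injective hTS e), hab.2⟩ }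
  refine ⟨SimpleGraph.ConnectedComponent.map f, fun C y hy => ?_⟩
  obtain ⟨hyT, rfl⟩ := mem_compSet.1 hy
  exact mem_compSet.2 ⟨hTS hyT, rfl⟩

/-- The structure of the algebra generated by a set of primitive axes of one type. -/
theorem uniformStructure (h : AxialPair l d)
    (hspan : Submodule.span F (axesOf l d : Set A) = ⊤) {S : Set A} (hS : ∀ x ∈ S, PAx l d x) :
    UniformStructure F S (NonUnitalAlgebra.adjoin F S) l d := by
  have hB := adjoin_eq_span_of_sameType h hS
  have hC : ∀ y ∈ Cl F S, PAx l d y := fun y hy => (exists_of_mem_Cl h hS hy).1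
  have hconn : IsConn S → ∀ x ∈ S, ∀ y ∈ S, x * y ≠ 0 := fun hc x hx y hy =>
    mul_ne_zero_of_reachable h hS (hc ⟨x, hx⟩ ⟨y, hy⟩)
  have hbasis : ∃ T ⊆ S, IsBasisOf F T (NonUnitalAlgebra.adjoin F S) := by
    obtain ⟨T, hTS, hsp, hli⟩ := exists_linearIndependent F S
    exact ⟨T, hTS, hli, by rw [hsp, hB]⟩
  have hprim : ∀ c : NonUnitalAlgebra.adjoin F S, c ≠ 0 → c * c = c → ∀ D : Comp (Cl F S),
      (c : A) ∈ NonUnitalAlgebra.adjoin F (compSet D) → PAx l d (c : A) := by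
    intro c hc0 hcc D hcD
    obtain ⟨x, hx⟩ := compSet_nonempty D
    rw [mem_adjoin_compSet h hC, compSet_eq h hC hx] at hcD
    have hsub : {z ∈ Cl F S | x * z ≠ 0} ⊆ {z | PAx l d z ∧ x * z ≠ 0} :=
      fun z hz => ⟨hC z hz.1, hz.2⟩
    exact ((hC x (compSet_subset D hx)).of_idempotent_in_class h hspan
      (Submodule.span_mono hsub hcD) (fun h0 => hc0 (Subtype.ext h0))
      (congrArg Subtype.val hcc)).1
  refine ⟨hB.symm, ?_, ?_, hbasis, ?_, ?_, ?_, ?_⟩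
  · intro hc
    obtain ⟨T, hTS, hT⟩ := hbasis
    exact ⟨T, hTS, isUAlg_of_clique h (fun x hx => hS x (hTS hx))
      (fun x hx y hy => hconn hc x (hTS hx) y (hTS hy)) hT.1 hT.2⟩
  · intro hc x hx y hy
    obtain ⟨px, s, hs, hsx⟩ := exists_of_mem_Cl h hS hx
    obtain ⟨py, t, ht, hty⟩ := exists_of_mem_Cl h hS hy
    exact px.mul_ne_zero_trans h (hS s hs) py (px.mul_ne_zero_comm h hsx)
      ((hS s hs).mul_ne_zero_trans h (hS t ht) py (hconn hc s hs t ht) hty)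
  · intro T hTS hT
    have hTC : T ⊆ Cl F S := hTS.trans (subset_Cl S)
    have pT : ∀ x ∈ T, PAx l d x := fun x hx => hS x (hTS hx)
    obtain ⟨D, hD⟩ := exists_component_map hTC
    -- Passing to `Cl(S)` does not enlarge the span of a component: an axis of `Cl(S)` is a
    -- combination of `T`, and its part outside its own class vanishes by `span_class_disjoint`.
    have key : ∀ C, (NonUnitalAlgebra.adjoin F (compSet (D C))).toSubmodule =
        Submodule.span F (compSet C) := by
      intro C
      rw [adjoin_compSet h hC]
      refine le_antisymm (Submodule.span_le.2 ?_) (Submodule.span_mono (hD C))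
      obtain ⟨t, ht⟩ := compSet_nonempty C
      have htT := compSet_subset C ht
      have pt := pT t htT
      intro y hy
      rw [compSet_eq h hC (hD C ht)] at hy
      have hyT : y ∈ Submodule.span F T := by
        rw [hT.2, hB]; exact Cl_subset_span h hS hy.1
      obtain ⟨y₁, h1, y₂, h2, e⟩ := exists_split (fun s => t * s ≠ 0) hyT
      have h20 : y₂ = 0 := by
        have s1 : {s ∈ T | t * s ≠ 0} ⊆ {s ∈ Cl F S | t * s ≠ 0} := fun s hs => ⟨hTC hs.1, hs.2⟩
        have s2 : {s ∈ T | ¬ t * s ≠ 0} ⊆ {s ∈ Cl F S | ¬ t * s ≠ 0} :=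
          fun s hs => ⟨hTC hs.1, hs.2⟩
        refine span_class_disjoint h hC pt ?_ (Submodule.span_mono s2 h2)
        have : y₂ = y - y₁ := by rw [e]; abel
        rw [this]
        exact Submodule.sub_mem _ (Submodule.subset_span hy) (Submodule.span_mono s1 h1)
      rw [h20, add_zero] at e
      rw [compSet_eq h pT ht, e]
      exact h1
    refine ⟨D, hD, fun C => ?_, ?_, ?_, ?_⟩
    · exact isUAlg_of_clique h (fun x hx => pT x (compSet_subset C hx))
        (fun x hx y hy => mul_ne_zero_of_mem_compSet h pT hx hy)
        (hT.1.mono (compSet_subset C)) (key C).symm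
    · intro C
      rw [Submodule.disjoint_def]
      simp only [key]
      obtain ⟨t, ht⟩ := compSet_nonempty C
      intro u hu hu'
      rw [compSet_eq h pT ht] at hu
      refine span_class_disjoint h pT (pT t (compSet_subset C ht)) hu ?_
      refine (iSup_le fun C' => iSup_le fun hCC => Submodule.span_mono ?_ :
        (⨆ C', ⨆ (_ : C' ≠ C), Submodule.span F (compSet C')) ≤ _) hu'
      intro y hy
      exact ⟨compSet_subset C' hy, fun h0 => hCC
        (compSet_eq_of_mem hy (mem_compSet_of_mul_ne_zero ht (compSet_subset C' hy) h0))⟩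
    · simp only [key]
      rw [← Submodule.span_iUnion, ← hT.2]
      congr 1
      refine Set.Subset.antisymm (Set.iUnion_subset compSet_subset) fun y hy => ?_
      obtain ⟨C, hC⟩ := exists_mem_compSet hy
      exact Set.mem_iUnion.2 ⟨C, hC⟩
    · intro C C' hCC x hx y hy
      have hx' : x ∈ Submodule.span F (compSet C) := by rw [← key C]; exact hx
      have hy' : y ∈ Submodule.span F (compSet C') := by rw [← key C']; exact hy
      refine mul_eq_zero_of_mem_span ?_ hx' hy'
      intro s hs t ht
      by_contra h0
      exact hCC (compSet_eq_of_mem (mem_compSet_of_mul_ne_zero hs (compSet_subset C' ht) h0) ht)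
  · intro c hc0 hcc
    constructor
    · intro hc
      obtain ⟨x, hx, hxc⟩ := exists_component_of_primitive h hS hc
      obtain ⟨D, hD⟩ := exists_mem_compSet (subset_Cl (F := F) S hx)
      refine ⟨D, ?_⟩
      rw [mem_adjoin_compSet h hC, compSet_eq h hC hD]
      have hsub : {z ∈ S | x * z ≠ 0} ⊆ {z ∈ Cl F S | x * z ≠ 0} :=
        fun z hz => ⟨subset_Cl S hz.1, hz.2⟩
      exact Submodule.span_mono hsub hxc
    · rintro ⟨D, hD⟩
      exact ⟨l, d, (PAx.of_coe h (hprim c hc0 hcc D hD)).isPrimitiveAxis h⟩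
  · rintro c ⟨m, n, hc⟩
    have hS' : ∀ x ∈ ((↑) ⁻¹' S : Set (NonUnitalAlgebra.adjoin F S)), PAx l d x :=
      fun x hx => PAx.of_coe h (hS _ hx)
    exact isAxis_of_idempotent h hS' (span_preimage_eq_top hB.symm) hc.left.idem
  · intro c hc
    exact (PAx.of_coe h (pAx_of_mem_chi_adjoin h hspan hS hc)).isPrimitiveAxis h

end Uniform

/-! ### Quotients by kernels of homomorphisms -/

section Hom

variable {F : Type*} {A C : Type*} [Field F] [NonUnitalNonAssocRing A] [Module F A]
  [NonUnitalNonAssocRing C] [Module F C]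

theorem exists_inverse_hom (f : A →ₙₐ[F] C) (hf : Function.Bijective f) :
    ∃ g : C →ₙₐ[F] A, ∀ x, g (f x) = x := by
  let e := Equiv.ofBijective f hf
  have hg : ∀ y, f (e.symm y) = y := fun y => e.apply_symm_apply y
  refine ⟨{ toFun := e.symm
            map_smul' := fun c y => hf.1 (by
              rw [MonoidHom.id_apply, map_smul f, hg, hg])
            map_zero' := hf.1 (by rw [hg, map_zero f])
            map_add' := fun x y => hf.1 (by rw [map_add f, hg, hg, hg])
            map_mul' := fun x y => hf.1 (by rw [map_mul f, hg, hg, hg]) }, fun x => ?_⟩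
  exact e.symm_apply_apply x

theorem exists_quot_iso (f : A →ₙₐ[F] C) (hf : Function.Surjective f) {P : Submodule F A}
    (hP : ∀ u, u ∈ P ↔ f u = 0) :
    ∃ I : AlgIdeal F A, I.toSubmodule = P ∧ ∃ g : I.Quot →ₙₐ[F] C, Function.Bijective g := by
  let I : AlgIdeal F A :=
    { P with
      mul_mem_left := fun x y hy => (hP _).2 (by rw [map_mul, (hP y).1 hy, mul_zero])
      mul_mem_right := fun x y hy => (hP _).2 (by rw [map_mul, (hP y).1 hy, zero_mul]) }
  have hI : I.toSubmodule = P := rfl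
  let f' : A →ₗ[F] C := { toFun := f, map_add' := map_add f, map_smul' := map_smul f }
  let g₀ : I.Quot →ₗ[F] C := P.liftQ f' fun u hu => (hP u).1 hu
  have hg : ∀ u, g₀ (I.cls u) = f u := fun u => rfl
  refine ⟨I, hI, { toFun := g₀
                   map_smul' := fun c x => map_smul g₀ c x
                   map_zero' := map_zero g₀
                   map_add' := map_add g₀
                   map_mul' := fun x y => ?_ }, ?_, ?_⟩
  · obtain ⟨x, rfl⟩ := I.cls_surjective x
    obtain ⟨y, rfl⟩ := I.cls_surjective y
    change g₀ (I.cls x * I.cls y) = g₀ (I.cls x) * g₀ (I.cls y)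
    rw [← I.cls_mul, hg, hg, hg, map_mul]
  · intro x y hxy
    obtain ⟨x, rfl⟩ := I.cls_surjective x
    obtain ⟨y, rfl⟩ := I.cls_surjective y
    change f x = f y at hxy
    rw [I.cls_eq]
    exact (hP _).2 (by rw [map_sub, hxy, sub_self])
  · intro c
    obtain ⟨u, rfl⟩ := hf c
    exact ⟨I.cls u, rfl⟩

/-- Modulo `P` every `u` is a finite combination of the `r i`, and the coefficients must be `χ i u`.
So the family of characters takes finitely supported values and its common kernel is `P`. -/
theorem exists_quot_iso_finsupp {ι : Type*} (r : ι → A) (χ : ι → A →ₙₐ[F] F) {P : Submodule F A}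
    (h1 : ∀ i, χ i (r i) = 1) (h0 : ∀ i j, i ≠ j → χ i (r j) = 0)
    (hχ : ∀ i, ∀ u ∈ P, χ i u = 0)
    (hr : ∀ u, ∃ s : ι →₀ F, u - Finsupp.linearCombination F r s ∈ P) :
    ∃ I : AlgIdeal F A, I.toSubmodule = P ∧
      ∃ g : I.Quot →ₙₐ[F] (ι →₀ F), Function.Bijective g := by
  classical
  have hc : ∀ i s, χ i (Finsupp.linearCombination F r s) = s i := by
    intro i s
    induction s using Finsupp.induction_linear with
    | zero => simp
    | add s t hs ht => rw [map_add, map_add, hs, ht, Finsupp.add_apply]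
    | single j c =>
      rw [Finsupp.linearCombination_single, map_smul]
      by_cases hij : i = j
      · subst hij; simp [h1]
      · rw [h0 i j hij, Finsupp.single_eq_of_ne hij]; simp
  choose s hs using hr
  have hsi : ∀ u i, s u i = χ i u := by
    intro u i
    have := hχ i _ (hs u)
    rw [map_sub, hc] at this
    exact (sub_eq_zero.1 this).symm
  let f : A →ₙₐ[F] (ι →₀ F) :=
    { toFun := s
      map_smul' := fun c u => by ext i; simp [hsi]
      map_zero' := by ext i; simp [hsi]
      map_add' := fun u v => by ext i; simp [hsi]
      map_mul' := fun u v => by ext i; simp [hsi] }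
  refine exists_quot_iso f (fun t => ⟨Finsupp.linearCombination F r t, ?_⟩) fun u => ?_
  · change s _ = t
    ext i; rw [hsi, hc]
  · change _ ↔ s u = 0
    constructor
    · intro hu
      ext i; rw [hsi, hχ i u hu]; rfl
    · intro hu
      have := hs u
      rwa [hu, map_zero, sub_zero] at this

end Hom

/-! ### Assembly: eigenspaces, quotients, and the axial decomposition -/

section Structure

variable {F : Type*} {A : Type*} [Field F] [NonUnitalNonAssocRing A] [Module F A]
  [IsScalarTower F A A] [SMulCommClass F A A] {l d : F}

theorem PAx.mul_mem_eig (h : AxialPair l d) {a a' b : A} (ha : PAx l d a) (ha' : PAx l d a')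
    (hb : PAx d l b) (hab : a ≠ b) :
    (a * a' ≠ 0 → a * b ∈ eig F l d a' ∧ b * a ∈ eig F l d a') ∧
    (a * a' = 0 → a * b ∈ eig0 F a' ∧ b * a ∈ eig0 F a') := by
  obtain ⟨e1, e2, -⟩ := ha.cross_spec h hb hab
  rw [e1, e2]
  refine ⟨fun h0 => ?_, fun h0 => ?_⟩
  · have := mem_eig.2 (ha.cross_odd h hb hab ha' h0)
    exact ⟨Submodule.smul_mem _ _ this, Submodule.smul_mem _ _ this⟩
  · have := (mem_eig0 (F := F)).2 (ha.cross_even h hb hab ha' h0)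
    exact ⟨Submodule.smul_mem _ _ this, Submodule.smul_mem _ _ this⟩

/-- If `x ≠ c`, the same-type rule gives the odd part `c - x` and `xc = d x + l c`, while the
opposite-type rule gives `xc = l (c - x)`. Together they force `x = 0`. -/
theorem PAx.eq_of_both_types (h : AxialPair l d) {x c : A} (hx : PAx l d x) (hc : PAx l d c)
    (hc' : PAx d l c) (hxc : x * c ≠ 0) : x = c := by
  by_contra hne
  obtain ⟨e1, -, e3, -⟩ := hx.cross_spec h hc' hne
  rw [← e3, hx.oddPart_of_ne h hc hxc, hx.mul_eq h hc hxc, h.d_eq] at e1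
  exact hx.ne (by linear_combination (norm := module) e1)

/-- A homomorphism to `F` sends an idempotent to `0` or `1`, so it cannot see an eigenvector for
another eigenvalue. -/
theorem character_eq_zero {f : A →ₙₐ[F] F} {b w : A} {m : F} (hb : b * b = b) (hm0 : m ≠ 0)
    (hm1 : m ≠ 1) (hw : b * w = m • w) : f w = 0 := by
  have e1 : f b * f b = f b := by rw [← map_mul, hb]
  have e2 : f b * f w = m * f w := by rw [← map_mul, hw, map_smul, smul_eq_mul]
  by_contra hfw
  have e3 : f b = m := mul_right_cancel₀ hfw e2
  rw [e3] at e1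
  exact hm1 (mul_left_cancel₀ hm0 (by rw [e1, mul_one]))

namespace AxialGenerators

variable {X' X'' : Set A}

theorem eig_inf_crossSpan_le (G : AxialGenerators l d X' X'') {a x : A} (ha : PAx l d a)
    (hx : PAx l d x) (hax : a * x ≠ 0) :
    eig0 F a ⊓ crossSpan F X' X'' ≤ eig0 F x ⊓ crossSpan F X' X'' ∧
      eig F l d a ⊓ crossSpan F X' X'' ≤ eig F l d x ⊓ crossSpan F X' X'' := by
  have h := G.pair
  constructor
  · rintro z ⟨hz0, hz⟩
    refine ⟨?_, hz⟩
    obtain ⟨z₁, -, z₂, m2, rfl, m3, m4⟩ := G.crossSpan_split ha hz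
    have h1 := (mem_eig0.1 hz0).1
    rw [mul_add, (mem_eig.1 m3.2).1, (mem_eig0.1 m4.2).1, add_zero] at h1
    rw [(smul_eq_zero.1 h1).resolve_left h.l0, zero_add]
    refine G.crossSpan_le_eig0 hx (Set.sep_subset _ _) (fun y hy => ?_) m2
    by_contra h0
    exact hy.2 (ha.mul_ne_zero_trans h hx (G.left y hy.1) hax h0)
  · refine le_inf (inf_le_left.trans ?_) inf_le_right
    rw [ha.eig_eq_classDiff h G.span_axesOf, hx.eig_eq_classDiff h G.span_axesOf,
      ha.classDiff_eq h hx hax]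

theorem eig_inf_crossSpan_eq (G : AxialGenerators l d X' X'') {a x : A} (ha : PAx l d a)
    (hx : PAx l d x) (hax : a * x ≠ 0) :
    eig0 F a ⊓ crossSpan F X' X'' = eig0 F x ⊓ crossSpan F X' X'' ∧
      eig F l d a ⊓ crossSpan F X' X'' = eig F l d x ⊓ crossSpan F X' X'' := by
  have h1 := G.eig_inf_crossSpan_le ha hx hax
  have h2 := G.eig_inf_crossSpan_le hx ha (hx.mul_ne_zero_comm G.pair hax)
  exact ⟨le_antisymm h1.1 h2.1, le_antisymm h1.2 h2.2⟩

theorem eig_congr (G : AxialGenerators l d X' X'') {a x : A} (ha : PAx l d a)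
    (hx : PAx l d x) (hax : a * x ≠ 0) : eig F l d a = eig F l d x := by
  rw [ha.eig_eq_classDiff G.pair G.span_axesOf, hx.eig_eq_classDiff G.pair G.span_axesOf,
    ha.classDiff_eq G.pair hx hax]

theorem mem_adjoin_left (G : AxialGenerators l d X' X'') {u : A} :
    u ∈ NonUnitalAlgebra.adjoin F X' ↔ u ∈ Submodule.span F X' := by
  rw [← adjoin_eq_span_of_sameType G.pair G.left]; rfl

theorem adjoin_left (G : AxialGenerators l d X' X'') :
    (NonUnitalAlgebra.adjoin F X').toSubmodule = Submodule.span F X' :=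
  adjoin_eq_span_of_sameType G.pair G.left

/-- Multiplicativity holds because mixed products lie in `Z`, injectivity because of
`mem_crossSpan_of_add_mem`, and surjectivity because `A = A' + A'' + Z`. -/
theorem exists_prod_iso (G : AxialGenerators l d X' X'') :
    ∃ f : (NonUnitalAlgebra.adjoin F X').map G.crossIdeal.proj ×
        (NonUnitalAlgebra.adjoin F X'').map G.crossIdeal.proj →ₙₐ[F] G.crossIdeal.Quot,
      Function.Bijective f ∧ ∀ p, f p = (p.1 : G.crossIdeal.Quot) + p.2 := by
  set I := G.crossIdeal
  have rep : ∀ p : (NonUnitalAlgebra.adjoin F X').map I.proj ×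
      (NonUnitalAlgebra.adjoin F X'').map I.proj, ∃ v ∈ Submodule.span F X',
      ∃ w ∈ Submodule.span F X'', (p.1 : I.Quot) = I.cls v ∧ (p.2 : I.Quot) = I.cls w := by
    rintro ⟨⟨_, v, hv, rfl⟩, ⟨_, w, hw, rfl⟩⟩
    exact ⟨v, G.mem_adjoin_left.1 hv, w, G.symm.mem_adjoin_left.1 hw, rfl, rfl⟩
  have cls0 : ∀ {u : A}, I.cls u = 0 ↔ u ∈ crossSpan F X' X'' := by
    intro u
    have : I.cls u = I.cls 0 ↔ u - 0 ∈ crossSpan F X' X'' := I.cls_eq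
    rw [sub_zero] at this
    exact this
  refine ⟨{ toFun := fun p => (p.1 : I.Quot) + p.2
            map_smul' := fun c p => (smul_add c (p.1 : I.Quot) (p.2 : I.Quot)).symm
            map_zero' := add_zero _
            map_add' := fun p q => add_add_add_comm (p.1 : I.Quot) q.1 p.2 q.2
            map_mul' := fun p q => ?_ }, ⟨?_, ?_⟩, fun p => rfl⟩
  · obtain ⟨v, hv, w, hw, e1, e2⟩ := rep p
    obtain ⟨v', hv', w', hw', e1', e2'⟩ := rep q
    change (p.1 : I.Quot) * q.1 + (p.2 : I.Quot) * q.2 = (p.1 + p.2) * (q.1 + q.2)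
    have c1 : (p.1 : I.Quot) * q.2 = 0 := by
      rw [e1, e2', ← I.cls_mul, cls0]; exact (G.span_mul_span hv hw').1
    have c2 : (p.2 : I.Quot) * q.1 = 0 := by
      rw [e2, e1', ← I.cls_mul, cls0]; exact (G.span_mul_span hv' hw).2
    rw [mul_add, add_mul, add_mul, c1, c2, add_zero, zero_add]
  · intro p q hpq
    obtain ⟨v, hv, w, hw, e1, e2⟩ := rep (p - q)
    have h0 : ((p - q).1 : I.Quot) + (p - q).2 = 0 := by
      change (p.1 : I.Quot) + p.2 = q.1 + q.2 at hpq
      change ((p.1 : I.Quot) - q.1) + (p.2 - q.2) = 0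
      rw [← add_sub_add_comm, hpq, sub_self]
    rw [e1, e2, ← I.cls_add, cls0] at h0
    obtain ⟨h1, h2⟩ := G.mem_crossSpan_of_add_mem hv hw h0
    rw [cls0.2 h1] at e1
    rw [cls0.2 h2] at e2
    refine sub_eq_zero.1 (Prod.ext (Subtype.ext e1) (Subtype.ext e2))
  · intro y
    obtain ⟨u, rfl⟩ := I.cls_surjective y
    obtain ⟨v, hv, w, hw, z, hz, rfl⟩ := G.exists_decomp u
    refine ⟨(⟨I.cls v, v, G.mem_adjoin_left.2 hv, rfl⟩,
      ⟨I.cls w, w, G.symm.mem_adjoin_left.2 hw, rfl⟩), ?_⟩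
    change I.cls v + I.cls w = I.cls (v + w + z)
    rw [I.cls_add, I.cls_add, cls0.2 hz, add_zero]

theorem exists_right_proj (G : AxialGenerators l d X' X'') :
    ∃ q : A →ₙₐ[F] (NonUnitalAlgebra.adjoin F X'').map G.crossIdeal.proj,
      ∀ v ∈ Submodule.span F X', ∀ w ∈ Submodule.span F X'', ∀ z ∈ crossSpan F X' X'',
        (q (v + w + z) : G.crossIdeal.Quot) = G.crossIdeal.cls w := by
  obtain ⟨f, hf, hfp⟩ := G.exists_prod_iso
  obtain ⟨g, hg⟩ := exists_inverse_hom f hf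
  refine ⟨(NonUnitalAlgHom.snd F _ _).comp (g.comp G.crossIdeal.proj), ?_⟩
  intro v hv w hw z hz
  have hz0 : G.crossIdeal.cls z = 0 :=
    (G.crossIdeal.cls_eq (x := z) (y := 0)).2 (by rw [sub_zero]; exact hz)
  have : G.crossIdeal.cls (v + w + z) = f (⟨_, v, G.mem_adjoin_left.2 hv, rfl⟩,
      ⟨_, w, G.symm.mem_adjoin_left.2 hw, rfl⟩) := by
    rw [hfp, G.crossIdeal.cls_add, G.crossIdeal.cls_add, hz0, add_zero]
    rfl
  change (((g (G.crossIdeal.cls (v + w + z))).2 :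
    (NonUnitalAlgebra.adjoin F X'').map G.crossIdeal.proj) : G.crossIdeal.Quot) = _
  rw [this, hg]
  rfl

theorem mul_ne_zero_of_isConn (G : AxialGenerators l d X' X'') (hc : IsConn X') {x y : A}
    (hx : x ∈ X') (hy : y ∈ X') : x * y ≠ 0 :=
  mul_ne_zero_of_reachable G.pair G.left (hc ⟨x, hx⟩ ⟨y, hy⟩)

theorem crossSpan_le_eig_of_isConn (G : AxialGenerators l d X' X'') (hc : IsConn X') {a : A}
    (ha : a ∈ X') : crossSpan F X' X'' ≤ eig F l d a :=
  G.crossSpan_le_eig (G.left a ha) subset_rfl fun _ hx => G.mul_ne_zero_of_isConn hc ha hx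

theorem eig_eq_of_isConn (G : AxialGenerators l d X' X'') (hc : IsConn X') {a : A}
    (ha : a ∈ X') : eig F l d a =
      Submodule.span F ((fun x => x - a) '' X') ⊔ crossSpan F X' X'' := by
  rw [G.eig_eq (G.left a ha), inf_eq_left.2 (G.crossSpan_le_eig_of_isConn hc ha)]
  congr 2
  ext m
  constructor
  · rintro ⟨x, hx, -, rfl⟩; exact ⟨x, hx, rfl⟩
  · rintro ⟨x, hx, rfl⟩; exact ⟨x, hx, G.mul_ne_zero_of_isConn hc ha hx, rfl⟩

/-- The map pairs the character of `a` with the projection to the image of `A''`. For connected `X'`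
one has `A' ⊆ F a + A_{l,d}(a)` and `Z ⊆ A_{l,d}(a)`, so the kernel is exactly the odd space. -/
theorem exists_quot_of_isConn (G : AxialGenerators l d X' X'') (hc : IsConn X') {a : A}
    (ha : a ∈ X') : ∃ Ia : AlgIdeal F A, Ia.toSubmodule = eig F l d a ∧
      ∃ g : Ia.Quot →ₙₐ[F] F × (NonUnitalAlgebra.adjoin F X'').map G.crossIdeal.proj,
        Function.Bijective g := by
  have h := G.pair
  have pa := G.left a ha
  obtain ⟨f, f0, f1, fb, fo⟩ := pa.exists_character h G.span_axesOf
  obtain ⟨q, hq⟩ := G.exists_right_proj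
  have hZ := G.crossSpan_le_eig_of_isConn hc ha
  have hX : X' ⊆ {y | PAx l d y ∧ a * y ≠ 0} :=
    fun x hx => ⟨G.left x hx, G.mul_ne_zero_of_isConn hc ha hx⟩
  have feig : ∀ w ∈ eig F l d a, f w = 0 := fun w hw => fo w (mem_eig.1 hw).1
  have fw : ∀ w ∈ Submodule.span F X'', f w = 0 := by
    intro w hw
    refine Submodule.span_induction (p := fun w _ => f w = 0) ?_ (map_zero f) ?_ ?_ hw
    · exact fun b hb => fb b (G.right b hb) (G.ne a ha b hb)
    · intro x y _ _ hx hy; rw [map_add, hx, hy, add_zero]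
    · intro c x _ hx; rw [map_smul, hx, smul_zero]
  have fa : f a = 1 := f1 a pa pa.mul_self_ne
  have hqa : ∀ k : F, ∀ w ∈ Submodule.span F X'', f (k • a + w) = k ∧
      (q (k • a + w) : G.crossIdeal.Quot) = G.crossIdeal.cls w := by
    intro k w hw
    constructor
    · rw [map_add, map_smul, fa, fw w hw]; simp
    · have := hq (k • a) (Submodule.smul_mem _ _ (Submodule.subset_span ha)) w hw 0
        (Submodule.zero_mem _)
      rwa [add_zero] at this
  refine exists_quot_iso (f.prod q) ?_ fun u => ?_
  · rintro ⟨k, ⟨_, w, hw, rfl⟩⟩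
    obtain ⟨e1, e2⟩ := hqa k w (G.symm.mem_adjoin_left.1 hw)
    exact ⟨k • a + w, Prod.ext e1 (Subtype.ext e2)⟩
  · have hsplit : f.prod q u = 0 ↔ f u = 0 ∧ q u = 0 := Prod.ext_iff
    rw [hsplit]
    constructor
    · intro hu
      refine ⟨feig u hu, ?_⟩
      rw [G.eig_eq_of_isConn hc ha] at hu
      obtain ⟨v, hv, z, hz, rfl⟩ := Submodule.mem_sup.1 hu
      have hv' : v ∈ Submodule.span F X' := by
        refine Submodule.span_le.2 ?_ hv
        rintro _ ⟨x, hx, rfl⟩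
        exact Submodule.sub_mem _ (Submodule.subset_span hx) (Submodule.subset_span ha)
      have := hq v hv' 0 (Submodule.zero_mem _) z hz
      rw [add_zero] at this
      exact Subtype.ext this
    · rintro ⟨e1, e2⟩
      obtain ⟨v, hv, w, hw, z, hz, rfl⟩ := G.exists_decomp u
      have hw' : G.crossIdeal.cls w = 0 := by
        rw [← hq v hv w hw z hz, e2]; rfl
      have hwZ : w ∈ crossSpan F X' X'' := by
        have := (G.crossIdeal.cls_eq (x := w) (y := 0)).1 hw'
        rwa [sub_zero] at this
      obtain ⟨k, m, hm, rfl⟩ := PAx.exists_smul_add_classDiff (Submodule.span_mono hX hv)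
      have hm' := pa.classDiff_le_eig h hm
      rw [map_add, map_add, map_add, map_smul, fa, feig m hm', feig w (hZ hwZ),
        feig z (hZ hz)] at e1
      have hk : k = 0 := by simpa using e1
      rw [hk, zero_smul, zero_add]
      exact Submodule.add_mem _ (Submodule.add_mem _ hm' (hZ hwZ)) (hZ hz)

theorem rank_le (G : AxialGenerators l d X' X'') :
    Module.rank F A ≤ Module.rank F (NonUnitalAlgebra.adjoin F X') +
      Module.rank F (NonUnitalAlgebra.adjoin F X'') + Module.rank F (crossSpan F X' X'') := by
  have h1 : Module.rank F (NonUnitalAlgebra.adjoin F X') =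
      Module.rank F (Submodule.span F X') := by
    rw [← G.adjoin_left]; rfl
  have h2 : Module.rank F (NonUnitalAlgebra.adjoin F X'') =
      Module.rank F (Submodule.span F X'') := by
    rw [← G.symm.adjoin_left]; rfl
  rw [h1, h2, ← rank_top F A, ← G.span_sup_eq_top]
  refine (Submodule.rank_add_le_rank_add_rank _ _).trans ?_
  gcongr
  exact Submodule.rank_add_le_rank_add_rank _ _

theorem finiteDimensional (G : AxialGenerators l d X' X'') (hX : (X' ∪ X'').Finite) :
    FiniteDimensional F A := by
  have f1 := hX.subset Set.subset_union_left
  have f2 := hX.subset Set.subset_union_right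
  have := G.span_sup_eq_top
  rw [crossSpan, ← Submodule.span_union, ← Submodule.span_union] at this
  exact Module.Finite.of_fg_top
    (this ▸ Submodule.fg_span ((f1.union f2).union (f1.image2 _ f2)))

theorem exists_eig_decomp (G : AxialGenerators l d X' X'') {a : A} (ha : PAx l d a) {w : A}
    (hw : w ∈ eig F l d a) :
    ∃ v ∈ (Submodule.span F {a} ⊔ (NonUnitalAlgebra.adjoin F X').toSubmodule) ⊓ eig F l d a,
      ∃ z ∈ crossSpan F X' X'' ⊓ eig F l d a, w = v + z := by
  rw [G.eig_eq ha] at hw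
  obtain ⟨v, hv, z, hz, rfl⟩ := Submodule.mem_sup.1 hw
  refine ⟨v, ?_, z, hz, rfl⟩
  refine Submodule.span_le.2 ?_ hv
  rintro _ ⟨x, hx, hax, rfl⟩
  refine ⟨Submodule.sub_mem _ (Submodule.mem_sup_right ?_) (Submodule.mem_sup_left ?_),
    mem_eig.2 (ha.sub_odd G.pair (G.left x hx) hax)⟩
  · rw [G.adjoin_left]; exact Submodule.subset_span hx
  · exact Submodule.mem_span_singleton_self a

theorem eig_eq_sup (G : AxialGenerators l d X' X'') {a : A} (ha : a ∈ X') :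
    eig F l d a = ((NonUnitalAlgebra.adjoin F X').toSubmodule ⊓ eig F l d a) ⊔
      (crossSpan F X' X'' ⊓ eig F l d a) := by
  refine le_antisymm (fun w hw => ?_) (sup_le inf_le_right inf_le_right)
  obtain ⟨v, hv, z, hz, rfl⟩ := G.exists_eig_decomp (G.left a ha) hw
  have hle : Submodule.span F {a} ≤ (NonUnitalAlgebra.adjoin F X').toSubmodule := by
    rw [G.adjoin_left]
    exact Submodule.span_mono (by simpa using ha)
  exact Submodule.add_mem_sup ⟨sup_le hle le_rfl hv.1, hv.2⟩ hz

theorem add_idempotent_iff (G : AxialGenerators l d X' X'') {a z : A} (ha : PAx l d a)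
    (hz : z ∈ crossSpan F X' X'') :
    (a + z) * (a + z) = a + z ↔ z ∈ eig F l d a := by
  obtain ⟨z₁, -, z₂, -, rfl, m1, m2⟩ := G.crossSpan_split ha hz
  have e1 := mem_eig.1 m1.2
  have e2 := mem_eig0.1 m2.2
  have hzz := G.crossSpan_mul_crossSpan hz hz
  constructor
  · intro hi
    -- Since `Z² = 0` and `l + d = 1`, the square of `a + z₁ + z₂` is `a + z₁`.
    have : z₂ = 0 := by
      rw [mul_add, add_mul, add_mul a, hzz, ha.idem, mul_add, add_mul, e1.1, e1.2, e2.1, e2.2,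
        G.pair.d_eq] at hi
      linear_combination (norm := module) -hi
    rw [this, add_zero]
    exact m1.2
  · intro hi
    have := mem_eig.1 hi
    rw [mul_add, add_mul, add_mul a, hzz, ha.idem, this.1, this.2, G.pair.d_eq]
    module

theorem pAx_add (G : AxialGenerators l d X' X'') {a z : A} (ha : PAx l d a)
    (hz : z ∈ eig F l d a) : PAx l d (a + z) := by
  rw [ha.eig_eq_classDiff G.pair G.span_axesOf] at hz
  exact ha.add_mem_classDiff G.pair G.span_axesOf hz

theorem sub_mem_inf_eig (G : AxialGenerators l d X' X'') {r : Comp X' → A}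
    (hr : ∀ C, r C ∈ compSet C) {C : Comp X'} {x : A} (hx : x ∈ compSet C) :
    x - r C ∈ (NonUnitalAlgebra.adjoin F X').toSubmodule ⊓ eig F l d (r C) := by
  have hrX := compSet_subset C (hr C)
  have hxX := compSet_subset C hx
  refine ⟨?_, mem_eig.2 ((G.left _ hrX).sub_odd G.pair (G.left x hxX)
    (mul_ne_zero_of_mem_compSet G.pair G.left (hr C) hx))⟩
  rw [G.adjoin_left]
  exact Submodule.sub_mem _ (Submodule.subset_span hxX) (Submodule.subset_span hrX)

/-- When `X'` contains the reflections of its members, `2 cross x b` is a difference of two axes of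
one component, and both differ from the representative by an element of its odd space in `A'`. -/
theorem crossSpan_le_iSup (G : AxialGenerators l d X' X'')
    (hX : ∀ x ∈ X', ∀ b ∈ X'', x - (2 : F) • cross x b ∈ X')
    {r : Comp X' → A} (hr : ∀ C, r C ∈ compSet C) :
    crossSpan F X' X'' ≤ ⨆ C, (NonUnitalAlgebra.adjoin F X').toSubmodule ⊓ eig F l d (r C) := by
  rw [G.crossSpan_eq subset_rfl]
  refine Submodule.span_le.2 ?_
  rintro _ ⟨x, hx, b, hb, rfl⟩
  obtain ⟨C, hC⟩ := exists_mem_compSet hx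
  have hxb := G.ne x hx b hb
  have hc : x - (2 : F) • cross x b ∈ compSet C := mem_compSet_of_mul_ne_zero hC (hX x hx b hb)
    ((G.left x hx).mul_sub_cross_ne G.pair (G.right b hb) hxb)
  refine Submodule.mem_iSup_of_mem C ?_
  have e : x - r C - (x - (2 : F) • cross x b - r C) = (2 : F) • cross x b := by abel
  rw [← Submodule.smul_mem_iff _ G.pair.two, ← e]
  exact Submodule.sub_mem _ (G.sub_mem_inf_eig hr hC) (G.sub_mem_inf_eig hr hc)

/-- A reflection of `x` that fell into `X''` would have both types and lie in the class of `x`,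
hence equal `x` by `eq_of_both_types`. -/
theorem sub_cross_mem_of_forall (G : AxialGenerators l d X' X'')
    (hX : ∀ c, PAx l d c → c ∈ X' ∪ X'') :
    ∀ x ∈ X', ∀ b ∈ X'', x - (2 : F) • cross x b ∈ X' := by
  intro x hx b hb
  have px := G.left x hx
  have hxb := G.ne x hx b hb
  have hc := px.pAx_sub_cross G.pair (G.right b hb) hxb
  rcases hX _ hc with h1 | h1
  · exact h1
  · rw [← px.eq_of_both_types G.pair hc (G.right _ h1)
      (px.mul_sub_cross_ne G.pair (G.right b hb) hxb)]
    exact hx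

/-- The characters of the chosen axes are dual to those axes. Every other generator differs from its
representative by an odd vector, and `Z` is already contained in the sum of the odd spaces. -/
theorem exists_quot_finsupp (G : AxialGenerators l d X' X'')
    (h' : ∀ c, PAx l d c → c ∈ X' ∪ X'')
    {r' : Comp X' → A} {r'' : Comp X'' → A} (hr' : ∀ C, r' C ∈ compSet C)
    (hr'' : ∀ C, r'' C ∈ compSet C) :
    ∃ I : AlgIdeal F A,
      I.toSubmodule = (⨆ C, (NonUnitalAlgebra.adjoin F X').toSubmodule ⊓ eig F l d (r' C)) ⊔
        (⨆ C, (NonUnitalAlgebra.adjoin F X'').toSubmodule ⊓ eig F d l (r'' C)) ∧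
      ∃ g : I.Quot →ₙₐ[F] (Comp X' ⊕ Comp X'' →₀ F), Function.Bijective g := by
  have h := G.pair
  have m' : ∀ C, r' C ∈ X' := fun C => compSet_subset C (hr' C)
  have m'' : ∀ C, r'' C ∈ X'' := fun C => compSet_subset C (hr'' C)
  have p' : ∀ C, PAx l d (r' C) := fun C => G.left _ (m' C)
  have p'' : ∀ C, PAx d l (r'' C) := fun C => G.right _ (m'' C)
  choose f' f0' f1' fb' _ using fun C => (p' C).exists_character h G.span_axesOf
  choose f'' f0'' f1'' fb'' _ using fun C => (p'' C).exists_character h.symm G.symm.span_axesOf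
  set P' := ⨆ C, (NonUnitalAlgebra.adjoin F X').toSubmodule ⊓ eig F l d (r' C) with hP'
  set P'' := ⨆ C, (NonUnitalAlgebra.adjoin F X'').toSubmodule ⊓ eig F d l (r'' C) with hP''
  have kill : ∀ (χ : A →ₙₐ[F] F), ∀ u ∈ P' ⊔ P'', χ u = 0 := by
    intro χ
    let χ' : A →ₗ[F] F := { toFun := χ, map_add' := map_add χ, map_smul' := map_smul χ }
    have : P' ⊔ P'' ≤ LinearMap.ker χ' := by
      refine sup_le (iSup_le fun C => ?_) (iSup_le fun C => ?_)
      · exact fun w hw => character_eq_zero (p' C).idem h.l0 h.l1 (mem_eig.1 hw.2).1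
      · exact fun w hw => character_eq_zero (p'' C).idem h.d0 h.d1 (mem_eig.1 hw.2).1
    exact fun u hu => this hu
  refine exists_quot_iso_finsupp (Sum.elim r' r'') (Sum.elim f' f'') ?_ ?_
    (fun i u hu => kill _ u hu) ?_
  · rintro (C | C)
    · exact f1' C _ (p' C) (p' C).mul_self_ne
    · exact f1'' C _ (p'' C) (p'' C).mul_self_ne
  · rintro (C | C) (D | D) hCD
    · refine f0' C _ ?_
      by_contra h0
      exact hCD (congrArg _ (compSet_eq_of_mem (mem_compSet_of_mul_ne_zero (hr' C) (m' D) h0)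
        (hr' D)))
    · exact fb' C _ (p'' D) (G.ne _ (m' C) _ (m'' D))
    · exact fb'' C _ (p' D) (G.ne _ (m' D) _ (m'' C)).symm
    · refine f0'' C _ ?_
      by_contra h0
      exact hCD (congrArg _ (compSet_eq_of_mem (mem_compSet_of_mul_ne_zero (hr'' C) (m'' D) h0)
        (hr'' D)))
  · set R := Finsupp.linearCombination F (Sum.elim r' r'')
    have hZ : crossSpan F X' X'' ≤ P' := G.crossSpan_le_iSup (G.sub_cross_mem_of_forall h') hr'
    have key : (⊤ : Submodule F A) ≤ LinearMap.range R ⊔ (P' ⊔ P'') := by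
      rw [← G.span_sup_eq_top]
      refine sup_le (sup_le (Submodule.span_le.2 ?_) (Submodule.span_le.2 ?_))
        (hZ.trans (le_sup_left.trans le_sup_right))
      · intro x hx
        obtain ⟨C, hC⟩ := exists_mem_compSet hx
        have : x = R (Finsupp.single (Sum.inl C) 1) + (x - r' C) := by
          simp [R]
        rw [this]
        refine Submodule.add_mem_sup ⟨_, rfl⟩ (Submodule.mem_sup_left ?_)
        exact Submodule.mem_iSup_of_mem C (G.sub_mem_inf_eig hr' hC)
      · intro x hx
        obtain ⟨C, hC⟩ := exists_mem_compSet hx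
        have : x = R (Finsupp.single (Sum.inr C) 1) + (x - r'' C) := by
          simp [R]
        rw [this]
        refine Submodule.add_mem_sup ⟨_, rfl⟩ (Submodule.mem_sup_right ?_)
        exact Submodule.mem_iSup_of_mem C (G.symm.sub_mem_inf_eig hr'' hC)
    intro u
    obtain ⟨_, ⟨s, rfl⟩, p, hp, rfl⟩ := Submodule.mem_sup.1 (key (Submodule.mem_top (x := u)))
    exact ⟨s, by rwa [add_sub_cancel_left]⟩

end AxialGenerators

/-! ### The axial decomposition -/

/-- The primitive axes that annihilate the set `D`. -/
def axesPerp (l d : F) (D : Set A) : Set A :=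
  {y ∈ (axesOf l d : Set A) | ∀ x ∈ D, y * x = 0 ∧ x * y = 0}

/-- The axes annihilating `D` are closed under reflection: the involution of such a `b` is an
automorphism fixing `D`, so it preserves the property of annihilating `D`. Their span is therefore a
subalgebra. -/
theorem adjoin_axesPerp_le (h : AxialPair l d) {D E : Set A} (hE : E ⊆ axesPerp l d D) :
    (NonUnitalAlgebra.adjoin F E).toSubmodule ≤ Submodule.span F (axesPerp l d D) := by
  refine adjoin_le_of_mul_mem (hE.trans Submodule.subset_span) ?_
  intro u hu v hv
  refine mul_mem_of_mem_span (mul_mem_span_of_subset_axesOf h (Set.sep_subset _ _) ?_) hu hv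
  intro a ha b hb pa pb hab
  refine ⟨Or.inl (pa.pAx_sub_cross h pb hab), fun x hx => ?_⟩
  have hbx : pb.tau h.symm x = x := by
    rw [PAx.tau_apply, PAx.oddPart_of_even, smul_zero, sub_zero]
    rw [(hb.2 x hx).1, (hb.2 x hx).2]
  rw [← pa.tau_cross h pb hab]
  constructor
  · rw [← hbx, ← pb.tau_mul, (ha.2 x hx).1, map_zero]
  · rw [← hbx, ← pb.tau_mul, (ha.2 x hx).2, map_zero]

/-- In a nonassociative algebra orthogonality of generators need not pass to the generated
subalgebras. Here each side is enclosed in the span of a set of axes, one being the annihilator of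
the other. -/
theorem adjoin_mul_adjoin_eq_zero (h : AxialPair l d) {D E : Set A}
    (hD : D ⊆ (axesOf l d : Set A)) (hE : E ⊆ (axesOf l d : Set A))
    (hDE : ∀ x ∈ D, ∀ y ∈ E, x * y = 0 ∧ y * x = 0) {u v : A}
    (hu : u ∈ NonUnitalAlgebra.adjoin F D) (hv : v ∈ NonUnitalAlgebra.adjoin F E) : u * v = 0 := by
  have h1 : D ⊆ axesPerp l d E := fun x hx => ⟨hD hx, fun y hy => hDE x hx y hy⟩
  have h2 : E ⊆ axesPerp l d (axesPerp l d E : Set A) := fun y hy =>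
    ⟨hE hy, fun x hx => (hx.2 y hy).symm⟩
  exact mul_eq_zero_of_mem_span (fun x hx y hy => (hy.2 x hx).2)
    (adjoin_axesPerp_le h h1 hu) (adjoin_axesPerp_le h h2 hv)

/-- `A` is the direct product of the subalgebras generated by the components of the closure of
its generating set. -/
theorem AxialGenerators.isDirectProduct {X' X'' : Set A} (G : AxialGenerators l d X' X'') :
    IsDirectProduct F
      (fun D : Comp (Cl F (X' ∪ X'')) => NonUnitalAlgebra.adjoin F (compSet D)) ⊤ := by
  have h := G.pair
  have hX : ∀ x ∈ X' ∪ X'', PAx l d x ∨ PAx d l x := fun x hx =>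
    hx.imp (G.left x) (G.right x)
  have hC : Cl F (X' ∪ X'') ⊆ axesOf l d := fun y hy => mem_axesOf (isPAx_of_mem_Cl h hX hy)
  have hmul : ∀ i j : Comp (Cl F (X' ∪ X'')), i ≠ j →
      ∀ x ∈ NonUnitalAlgebra.adjoin F (compSet i), ∀ y ∈ NonUnitalAlgebra.adjoin F (compSet j),
        x * y = 0 := by
    intro i j hij x hx y hy
    refine adjoin_mul_adjoin_eq_zero h ((compSet_subset i).trans hC)
      ((compSet_subset j).trans hC) ?_ hx hy
    intro u hu v hv
    constructor
    · by_contra h0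
      exact hij (compSet_eq_of_mem (mem_compSet_of_mul_ne_zero hu (compSet_subset j hv) h0) hv)
    · by_contra h0
      exact hij (compSet_eq_of_mem hu (mem_compSet_of_mul_ne_zero hv (compSet_subset i hu) h0))
  refine ⟨fun i => ?_, ?_, hmul⟩
  · rw [Submodule.disjoint_def]
    intro u hu hu'
    -- As a member of the sum of the other factors, `u` is annihilated by factor `i`; as a member of
    -- factor `i`, it is annihilated by the others. So it annihilates all generators and is zero.
    have hmul' : ∀ x ∈ NonUnitalAlgebra.adjoin F (compSet i), x * u = 0 ∧ u * x = 0 := by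
      intro x hx
      have : (⨆ j, ⨆ (_ : j ≠ i), (NonUnitalAlgebra.adjoin F (compSet j)).toSubmodule) ≤
          LinearMap.ker (LinearMap.mulLeft F x) ⊓ LinearMap.ker (LinearMap.mulRight F x) := by
        refine iSup_le fun j => iSup_le fun hji => ?_
        exact fun y hy => ⟨hmul i j hji.symm x hx y hy, hmul j i hji y hy x hx⟩
      exact this hu'
    refine G.eq_zero_of_mul_eq_zero fun x hx => ?_
    obtain ⟨k, hk⟩ := exists_mem_compSet (subset_Cl (F := F) _ hx)
    have hxk := NonUnitalAlgebra.subset_adjoin F hk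
    by_cases hki : k = i
    · subst hki
      exact hmul' x hxk
    · exact ⟨hmul k i hki x hxk u hu, hmul i k (Ne.symm hki) u hu x hxk⟩
  · rw [eq_comm, NonUnitalAlgebra.top_toSubmodule, eq_comm, eq_top_iff]
    set P := ⨆ i : Comp (Cl F (X' ∪ X'')), (NonUnitalAlgebra.adjoin F (compSet i)).toSubmodule
      with hP
    have hPs : P = Submodule.span F (⋃ i : Comp (Cl F (X' ∪ X'')),
        ((NonUnitalAlgebra.adjoin F (compSet i)).toSubmodule : Set A)) :=
      Submodule.iSup_eq_span _
    have : (NonUnitalAlgebra.adjoin F (X' ∪ X'')).toSubmodule ≤ P := by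
      refine adjoin_le_of_mul_mem ?_ ?_
      · intro x hx
        obtain ⟨k, hk⟩ := exists_mem_compSet (subset_Cl (F := F) _ hx)
        exact Submodule.mem_iSup_of_mem k (NonUnitalAlgebra.subset_adjoin F hk)
      · intro x hx y hy
        rw [hPs] at hx hy
        refine mul_mem_of_mem_span ?_ hx hy
        intro u hu v hv
        obtain ⟨i, hi⟩ := Set.mem_iUnion.1 hu
        obtain ⟨j, hj⟩ := Set.mem_iUnion.1 hv
        by_cases hij : i = j
        · subst hij
          exact Submodule.mem_iSup_of_mem i 
            ((NonUnitalAlgebra.adjoin F (compSet i)).mul_mem' hi hj)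
        · rw [hmul i j hij u hi v hj]; exact P.zero_mem
    intro u _
    exact this (by rw [G.gen]; trivial)

end Structure

end Axial

/-! ### The theorem -/

theorem mainTheorem2 {F : Type*} {A : Type*} [Field F] (h2 : (2 : F) ≠ 0)
    [NonUnitalNonAssocRing A] [Module F A] [IsScalarTower F A A] [SMulCommClass F A A]
    (lam del : F) (hlam0 : lam ≠ 0) (hlam1 : lam ≠ 1) (hsum : lam + del = 1) (hne : lam ≠ del)
    (X' X'' : Set A) (hdisj : Disjoint X' X'')
    (hX' : ∀ x ∈ X', IsPrimitiveAxis F x lam del)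
    (hX'' : ∀ x ∈ X'', IsPrimitiveAxis F x del lam)
    (hgen : NonUnitalAlgebra.adjoin F (X' ∪ X'') = ⊤)
    (A' A'' : NonUnitalSubalgebra F A)
    (hA' : A' = NonUnitalAlgebra.adjoin F X') (hA'' : A'' = NonUnitalAlgebra.adjoin F X'')
    (Z : Submodule F A) (hZ : Z = crossSpan F X' X'') :
    -- A' and A'' are direct products of copies of U_E(lam), respectively U_E(del)
    UniformStructure F X' A' lam del ∧ UniformStructure F X'' A'' del lam ∧
    -- products of axes of different types
    (∀ a a' b : A, IsPrimitiveAxis F a lam del → IsPrimitiveAxis F a' lam del →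
      IsPrimitiveAxis F b del lam → a ≠ b →
        (a * a' ≠ 0 → a * b ∈ eig F lam del a' ∧ b * a ∈ eig F lam del a') ∧
        (a * a' = 0 → a * b ∈ eig0 F a' ∧ b * a ∈ eig0 F a')) ∧
    (∀ a' x' : A, IsPrimitiveAxis F a' lam del → IsPrimitiveAxis F x' lam del → a' * x' ≠ 0 →
      eig0 F a' ⊓ Z = eig0 F x' ⊓ Z ∧ eig F lam del a' ⊓ Z = eig F lam del x' ⊓ Z) ∧
    -- Z is an ideal of square zero, A = A' + A'' + Z, and A / Z is the product of the images
    -- of A' and A''; if X' is connected, A_{lam,del}(a) is an ideal with the stated quotient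
    (∃ IZ : AlgIdeal F A, IZ.toSubmodule = Z ∧
      (∃ f : A'.map IZ.proj × A''.map IZ.proj →ₙₐ[F] IZ.Quot,
        Function.Bijective f ∧ ∀ p, f p = (p.1 : IZ.Quot) + p.2) ∧
      (IsConn X' → ∀ a ∈ X',
        eig F lam del a = Submodule.span F ((fun x => x - a) '' X') ⊔ Z ∧
        ∃ Ia : AlgIdeal F A, Ia.toSubmodule = eig F lam del a ∧
          ∃ g : Ia.Quot →ₙₐ[F] F × A''.map IZ.proj, Function.Bijective g)) ∧
    (∀ z ∈ Z, ∀ w ∈ Z, z * w = 0) ∧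
    A'.toSubmodule ⊔ A''.toSubmodule ⊔ Z = ⊤ ∧
    Module.rank F A ≤ Module.rank F A' + Module.rank F A'' + Module.rank F Z ∧
    ((X' ∪ X'').Finite → FiniteDimensional F A) ∧
    -- the eigenspaces A_{lam,del}(a)
    (∀ a : A, IsPrimitiveAxis F a lam del → ∀ w ∈ eig F lam del a,
      ∃ v ∈ (Submodule.span F {a} ⊔ A'.toSubmodule) ⊓ eig F lam del a,
        ∃ z ∈ Z ⊓ eig F lam del a, w = v + z) ∧
    (∀ a ∈ X', eig F lam del a =
      (A'.toSubmodule ⊓ eig F lam del a) ⊔ (Z ⊓ eig F lam del a)) ∧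
    (∀ C : Comp X', ∀ a₁ ∈ compSet C, ∀ a₂ ∈ compSet C,
      eig F lam del a₁ = eig F lam del a₂) ∧
    (∀ a : A, IsPrimitiveAxis F a lam del →
      ∀ v ∈ eig F lam del a, ∀ w ∈ eig F lam del a, v * w = 0) ∧
    -- primitive axes of A' and of A'' are primitive axes of A
    (∀ c : A', c ∈ chi F A' → IsPrimitiveAxis F (c : A) lam del) ∧
    (∀ c : A'', c ∈ chi F A'' → IsPrimitiveAxis F (c : A) del lam) ∧
    -- the idempotents a + z
    (∀ a ∈ X', ∀ z ∈ Z,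
      ((a + z) * (a + z) = a + z ↔ z ∈ eig F lam del a) ∧
      ((a + z) * (a + z) = a + z → IsPrimitiveAxis F (a + z) lam del)) ∧
    (IsConn X' → ∀ a ∈ X', ∀ z ∈ Z, IsPrimitiveAxis F (a + z) lam del) ∧
    (∀ a ∈ X'', ∀ z ∈ Z,
      ((a + z) * (a + z) = a + z ↔ z ∈ eig F del lam a) ∧
      ((a + z) * (a + z) = a + z → IsPrimitiveAxis F (a + z) del lam)) ∧
    (IsConn X'' → ∀ a ∈ X'', ∀ z ∈ Z, IsPrimitiveAxis F (a + z) del lam) ∧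
    -- the location of Z when X' (or X'') contains all primitive axes of its type
    (X' = {a | IsPrimitiveAxis F a lam del} →
      ∀ r : Comp X' → A, (∀ C, r C ∈ compSet C) →
        Z ≤ ⨆ C, A'.toSubmodule ⊓ eig F lam del (r C)) ∧
    (X'' = {a | IsPrimitiveAxis F a del lam} →
      ∀ r : Comp X'' → A, (∀ C, r C ∈ compSet C) →
        Z ≤ ⨆ C, A''.toSubmodule ⊓ eig F del lam (r C)) ∧
    -- the ideal I when X consists of all primitive axes of A
    (X' ∪ X'' = chi F A →
      ∀ (r' : Comp X' → A) (r'' : Comp X'' → A),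
        (∀ C, r' C ∈ compSet C) → (∀ C, r'' C ∈ compSet C) →
        ∃ I : AlgIdeal F A,
          I.toSubmodule = (⨆ C, A'.toSubmodule ⊓ eig F lam del (r' C)) ⊔
            (⨆ C, A''.toSubmodule ⊓ eig F del lam (r'' C)) ∧
          ∃ g : I.Quot →ₙₐ[F] (Comp X' ⊕ Comp X'' →₀ F), Function.Bijective g) ∧
    -- no nonzero annihilating elements, and the axial decomposition
    (∀ u : A, ((∀ x : A, x * u = 0) ∨ (∀ x : A, u * x = 0)) → u = 0) ∧
    IsDirectProduct F
      (fun D : Comp (Cl F (X' ∪ X'')) => NonUnitalAlgebra.adjoin F (compSet D)) ⊤ := by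
  have hdel0 : del ≠ 0 := fun h0 => hlam1 (by rw [← hsum, h0, add_zero])
  have h : AxialPair lam del := ⟨h2, hlam0, hdel0, hsum, hne⟩
  have hne' : ∀ x ∈ X', ∀ y ∈ X'', x ≠ y := fun x hx y hy e =>
    Set.disjoint_left.1 hdisj hx (e ▸ hy)
  have G : AxialGenerators lam del X' X'' :=
    ⟨h, hne', fun x hx => (hX' x hx).pAx h, fun x hx => (hX'' x hx).pAx h.symm, hgen⟩
  have iff' : ∀ {a : A}, IsPrimitiveAxis F a lam del ↔ PAx lam del a := isPrimitiveAxis_iff h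
  have iff'' : ∀ {a : A}, IsPrimitiveAxis F a del lam ↔ PAx del lam a :=
    isPrimitiveAxis_iff h.symm
  -- The statements about `X''` are those about `X'` for `G.symm`, whose ideal is formed with the
  -- two sets exchanged.
  have hZ' : crossSpan F X'' X' = Z := by rw [hZ, G.crossSpan_swap]
  subst hA' hA'' hZ
  refine ⟨uniformStructure h G.span_axesOf G.left, uniformStructure h.symm G.symm.span_axesOf
    G.right, ?_, ?_, ⟨G.crossIdeal, rfl, G.exists_prod_iso, ?_⟩,
    fun z hz w hw => G.crossSpan_mul_crossSpan hz hw, ?_, G.rank_le, G.finiteDimensional, ?_, ?_,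
    ?_, ?_, ?_, ?_, ?_, ?_, ?_, ?_, ?_, ?_, ?_, ?_, G.isDirectProduct⟩
  · exact fun a a' b ha ha' hb hab =>
      (ha.pAx h).mul_mem_eig h (ha'.pAx h) (hb.pAx h.symm) hab
  · exact fun a x ha hx hax => G.eig_inf_crossSpan_eq (ha.pAx h) (hx.pAx h) hax
  · exact fun hc a ha => ⟨G.eig_eq_of_isConn hc ha, G.exists_quot_of_isConn hc ha⟩
  · rw [G.adjoin_left, G.symm.adjoin_left]
    exact G.span_sup_eq_top
  · exact fun a ha w hw => G.exists_eig_decomp (ha.pAx h) hw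
  · exact fun a ha => G.eig_eq_sup ha
  · exact fun C a₁ h₁ a₂ h₂ => G.eig_congr (G.left _ (compSet_subset C h₁))
      (G.left _ (compSet_subset C h₂)) (mul_ne_zero_of_mem_compSet h G.left h₁ h₂)
  · intro a ha v hv w hw
    have pa := ha.pAx h
    rw [pa.eig_eq_classDiff h G.span_axesOf] at hv hw
    exact pa.mul_eq_zero_of_mem_classDiff h hv hw
  · exact fun c hc => iff'.2 (pAx_of_mem_chi_adjoin h G.span_axesOf G.left hc)
  · exact fun c hc => iff''.2 (pAx_of_mem_chi_adjoin h.symm G.symm.span_axesOf G.right hc)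
  · intro a ha z hz
    have pa := G.left a ha
    have e := G.add_idempotent_iff pa hz
    exact ⟨e, fun hi => iff'.2 (G.pAx_add pa (e.1 hi))⟩
  · exact fun hc a ha z hz =>
      iff'.2 (G.pAx_add (G.left a ha) (G.crossSpan_le_eig_of_isConn hc ha hz))
  · intro a ha z hz
    rw [← hZ'] at hz
    have pa := G.right a ha
    have e := G.symm.add_idempotent_iff pa hz
    exact ⟨e, fun hi => iff''.2 (G.symm.pAx_add pa (e.1 hi))⟩
  · intro hc a ha z hz
    rw [← hZ'] at hz
    exact iff''.2 (G.symm.pAx_add (G.right a ha) (G.symm.crossSpan_le_eig_of_isConn hc ha hz))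
  · intro hall r hr
    refine G.crossSpan_le_iSup (G.sub_cross_mem_of_forall fun c hc => Or.inl ?_) hr
    rw [hall]
    exact iff'.2 hc
  · intro hall r hr
    rw [← hZ']
    refine G.symm.crossSpan_le_iSup (G.symm.sub_cross_mem_of_forall fun c hc => Or.inl ?_) hr
    rw [hall]
    exact iff''.2 hc
  · intro hall r' r'' hr' hr''
    refine G.exists_quot_finsupp (fun c hc => ?_) hr' hr''
    rw [hall]
    exact ⟨lam, del, iff'.2 hc⟩
  · exact fun u hu => G.eq_zero_of_forall_mul_eq_zero hu
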